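/- Let $n\ge 1$, let $s>0$, and let $B,Q$ be real $n\times n$ matrices with $Q$ symmetric positive semidefinite. Consider on $L^2(\mathbb R^n)=L^2(\mathbb R^n;\mathbb C)$ the fractional Ornstein-Uhlenbeck operator $$\mathcal P=\tfrac12\mathrm{Tr}^s(-Q\nabla_x^2)+\langle Bx,\nabla_x\rangle,\qquad D(\mathcal P)=\{u\in L^2(\mathbb R^n):\mathcal Pu\in L^2(\mathbb R^n)\},$$ where $\mathrm{Tr}^s(-Q\nabla_x^2)$ is the Fourier multiplier with symbol $\langle Q\xi,\xi\rangle^s$ (for the Fourier transform $\widehat u(\xi)=\int_{\mathbb R^n} e^{-i\langle x,\xi\rangle}u(x)\,dx$), $\langle Bx,\nabla_x\rangle=\sum_{i,j}B_{i,j}x_j\partial_{x_i}$, and $\mathcal Pu$ is understood in the sense of tempered distributions. Set $V_k=\bigcap_{j=0}^{k}\ker\big(\sqrt Q(B^T)^j\big)\subset\mathbb R^n$ for $k\ge0$ and $S=\bigcap_{j=0}^{n-1}\ker\big(\sqrt Q(B^T)^j\big)$. Let $0\le r\le n-1$ be the smallest integer with $V_r=S$, and for $\xi\in S^\perp$ define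 the index $k_\xi=\min\{0\le k\le r:\xi\in V_k^\perp\}$, where orthogonal complements are taken in Euclidean $\mathbb R^n$. Then $-\mathcal P$ with domain $D(\mathcal P)$ generates a unique strongly continuous semigroup $(e^{-t\mathcal P})_{t\ge0}$ on $L^2(\mathbb R^n)$, and there are constants $c>1$ and $T>0$ such that for all $m\ge1$, all $\xi_1,\dots,\xi_m\in S^\perp$, all $0<t<T$ and all $u\in L^2(\mathbb R^n)$, the distribution $\langle\xi_1,\nabla_x\rangle\cdots\langle\xi_m,\nabla_x\rangle e^{-t\mathcal P}u$ belongs to $L^2(\mathbb R^n)$ and $$\big\|\langle\xi_1,\nabla_x\rangle\cdots\langle\xi_m,\nabla_x\rangle e^{-t\mathcal P}u\big\|_{L^2}\le\frac{c^m\,e^{\frac12\mathrm{Tr}(B)t}}{t^{\,k_{\xi_1}+\dots+k_{\xi_m}+\frac m{2s}}}\Big(\prod_{j=1}^m|\xi_j|\Big)(m!)^{\frac1{2s}}\,\|u\|_{L^2}.$$ -/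

import Mathlib

open MeasureTheory Filter Topology SchwartzMap FourierTransform LineDeriv
open scoped NNReal ENNReal MatrixOrder

noncomputable section

namespace FracOU

/-- Euclidean space of dimension `n`. -/
abbrev Rn (n : ℕ) : Type := EuclideanSpace ℝ (Fin n)

/-- Complex-valued square-integrable functions on `Rn n`, for Lebesgue measure. -/
abbrev L2 (n : ℕ) : Type := Lp ℂ 2 (volume : Measure (Rn n))

/-- The symbol `⟨Q ξ, ξ⟩ ^ s`. -/
def symbol {n : ℕ} (s : ℝ) (Q : Matrix (Fin n) (Fin n) ℝ) (ξ : Rn n) : ℝ :=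
  (inner ℝ (Matrix.toEuclideanLin Q ξ) ξ) ^ s

/-- The pairing with a Schwartz function `φ` of the tempered distribution `Tr^s(-Q∇²) u`,
the Fourier multiplier with symbol `⟨Q ξ, ξ⟩ ^ s` applied to `u`, that is
`𝓕⁻ (symbol · û)`. Mathlib's Fourier transform uses the kernel `exp (-2πi⟨x, ξ⟩)`, so that
the frequency is `2πξ`. For `s > 0` and `Q` positive semidefinite the symbol is continuous of
polynomial growth, and the integrand is integrable. -/
def diffusionPairing {n : ℕ} (s : ℝ) (Q : Matrix (Fin n) (Fin n) ℝ)
    (u : L2 n) (φ : 𝓢(Rn n, ℂ)) : ℂ :=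
  ∫ ξ : Rn n, (symbol s Q ((2 * Real.pi) • ξ) : ℂ) * (𝓕 u : L2 n) ξ * (𝓕⁻ φ) ξ

/-- The tempered distribution `⟨Bx, ∇⟩ u = ∑ i, ∑ j, B i j * x j * ∂ᵢ u`. -/
def transport {n : ℕ} (B : Matrix (Fin n) (Fin n) ℝ) (u : L2 n) : 𝓢'(Rn n, ℂ) :=
  ∑ i : Fin n, ∑ j : Fin n, (B i j : ℂ) •
    TemperedDistribution.smulLeftCLM ℂ (fun x : Rn n => ((x j : ℝ) : ℂ))
      (∂_{(EuclideanSpace.single i (1 : ℝ) : Rn n)} (u : 𝓢'(Rn n, ℂ)))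

/-- `u` lies in `D(P) = {u ∈ L² : P u ∈ L²}` and `P u = f`, where
`P = (1/2) Tr^s(-Q∇²) + ⟨Bx, ∇⟩` is computed in the sense of tempered distributions. -/
def OUApply {n : ℕ} (s : ℝ) (Q B : Matrix (Fin n) (Fin n) ℝ) (u f : L2 n) : Prop :=
  ∀ φ : 𝓢(Rn n, ℂ),
    (f : 𝓢'(Rn n, ℂ)) φ = (1 / 2 : ℂ) * diffusionPairing s Q u φ + transport B u φ

/-- `E` is the strongly continuous semigroup on `L²` whose infinitesimal generator is `-P`, with
domain `D(P)`: the difference quotient of `E` at `u` converges at `0⁺` to `g` exactly when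
`u ∈ D(P)` and `P u = -g`. -/
structure IsOUSemigroup {n : ℕ} (s : ℝ) (Q B : Matrix (Fin n) (Fin n) ℝ)
    (E : ℝ≥0 → L2 n →L[ℂ] L2 n) : Prop where
  map_zero : E 0 = ContinuousLinearMap.id ℂ (L2 n)
  map_add : ∀ t t' : ℝ≥0, E (t + t') = (E t).comp (E t')
  strongly_continuous : ∀ u : L2 n, Continuous fun t : ℝ≥0 => E t u
  generator : ∀ u g : L2 n,
    Tendsto (fun h : ℝ≥0 => ((h : ℝ)⁻¹ : ℝ) • (E h u - u)) (𝓝[>] 0) (𝓝 g) ↔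
      OUApply s Q B u (-g)

/-- `V k`, the intersection for `0 ≤ j ≤ k` of the kernels of `√Q (Bᵀ) ^ j`. -/
def V {n : ℕ} (Q B : Matrix (Fin n) (Fin n) ℝ) (k : ℕ) : Submodule ℝ (Rn n) :=
  ⨅ j ∈ Set.Iic k, LinearMap.ker (Matrix.toEuclideanLin (CFC.sqrt Q * B.transpose ^ j))

/-- `S`, the intersection for `0 ≤ j ≤ n - 1` of the kernels of `√Q (Bᵀ) ^ j`. -/
def S {n : ℕ} (Q B : Matrix (Fin n) (Fin n) ℝ) : Submodule ℝ (Rn n) :=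
  ⨅ j ∈ Set.Iio n, LinearMap.ker (Matrix.toEuclideanLin (CFC.sqrt Q * B.transpose ^ j))

/-- The smallest integer `0 ≤ r ≤ n - 1` such that `S = V r`. -/
def rIndex {n : ℕ} (Q B : Matrix (Fin n) (Fin n) ℝ) : ℕ :=
  sInf {r : ℕ | r ≤ n - 1 ∧ S Q B = V Q B r}

/-- The index of a vector of `Sᗮ`: the smallest `0 ≤ k ≤ r` such that the vector lies
in `(V k)ᗮ`. -/
def index {n : ℕ} (Q B : Matrix (Fin n) (Fin n) ℝ) (ξ : Rn n) : ℕ :=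
  sInf {k : ℕ | k ≤ rIndex Q B ∧ ξ ∈ (V Q B k)ᗮ}

end FracOU

end

noncomputable section

set_option linter.unusedSectionVars false
set_option linter.style.haveILetI false

/-! On the Fourier side the equation `∂ₜu + Pu = 0` is of first order: up to the normalisation of
frequencies, `û` solves `∂ₜû = ⟨Bᵀη, ∇û⟩ + Tr(B) û - ½ σ û` with `σ = ⟨Qη, η⟩ ^ s`. Characteristics
give the explicit solution `exp (t Tr B) * exp (-½ ∫₀ᵗ σ (exp (τBᵀ) η) dτ) * û₀ (exp (tBᵀ) η)`,
which is `evolve`. A change of variables bounds its `L²` norm by `exp (½ t Tr B) ‖û₀‖`, and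
Plancherel carries everything back to the space side.

Generator. Differentiating the transposed evolution on Schwartz functions shows that the generator
is contained in the distributional operator. The converse is the delicate half
(`generatorApply_of_weakGenerator`). The transposed evolution need not preserve Schwartz functions,
because `σ` is only known to be continuous. Transport alone does preserve them, and on bounded sets
`σ` is bounded; hence the difference quotients, tested against functions supported in a fixed ball,
are bounded by the `L²` norm of the test function. Density of Schwartz functions then allows every
compactly supported `L²` test function, a class stable under the transposed evolution. Uniqueness
follows from dissipativity and Gronwall's inequality (`eq_of_generator`).

Smoothing. A product of directional derivatives multiplies the explicit solution by a product of the
factors `2πi⟨η, ξ_j⟩`, to be beaten by `exp (-½ I)` with `I = ∫₀ᵗ σ (exp (τBᵀ) η) dτ`. For small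
`t`, the curve `τ ↦ √Q exp (τBᵀ) ζ` is close to its Taylor polynomial with coefficients `√Q (Bᵀ)^j ζ
/ j!`, and a polynomial is comparable to the sum of its coefficients on a fixed proportion of the
interval (`exists_flow_lower_bound`). This gives `I / t ≥ c (∑ t^j |√Q (Bᵀ)^j ζ|)^(2s)`, and for `ξ`
orthogonal to `V k` it follows that `t^k |⟨ξ, ζ⟩| ≤ C |ξ| (I / t)^(1/(2s))` (`exists_abs_inner_le`).
Multiplying these `m` inequalities leaves `I^(m/(2s)) exp (-I/2)`, which is at most a constant to
the power `m` times `(m!)^(1/(2s))`. -/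

namespace FracOU

section

variable {E : Type*} [NormedAddCommGroup E] [InnerProductSpace ℝ E] [FiniteDimensional ℝ E]

/-! ### The linear flow -/

/-- The derivative of the determinant at the identity is the trace. -/
theorem hasDerivAt_det_one_add_smul (X : E →L[ℝ] E) :
    HasDerivAt (fun r : ℝ => (1 + r • X).det) (LinearMap.trace ℝ E X.toLinearMap) 0 := by
  let b := Module.finBasis ℝ E
  set M := LinearMap.toMatrix b b X.toLinearMap
  have h (r : ℝ) : (1 + r • X : E →L[ℝ] E).det = 1 + M.trace * r +
      Polynomial.eval r
        (1 + (Polynomial.X : Polynomial ℝ) • M.map ⇑Polynomial.C).det.divX.divX * r ^ 2 := by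
    rw [← Matrix.det_one_add_smul, ContinuousLinearMap.det, ← LinearMap.det_toMatrix b]
    congr 1
    simp [M, LinearMap.toMatrix_one]
  simp_rw [h]
  rw [LinearMap.trace_eq_matrix_trace ℝ b]
  set p := (1 + (Polynomial.X : Polynomial ℝ) • M.map ⇑Polynomial.C).det.divX.divX
  have := (((hasDerivAt_id (0 : ℝ)).const_mul M.trace).const_add 1).add
    ((p.hasDerivAt 0).mul ((hasDerivAt_id (0 : ℝ)).pow 2))
  convert! this using 1
  simp [M]

theorem differentiable_det : Differentiable ℝ (fun A : E →L[ℝ] E => A.det) := by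
  let b := Module.finBasis ℝ E
  have h (A : E →L[ℝ] E) : A.det = (LinearMap.toMatrix b b A.toLinearMap).det := by
    rw [ContinuousLinearMap.det, LinearMap.det_toMatrix]
  have hl (i j) : Differentiable ℝ
      (fun A : E →L[ℝ] E => LinearMap.toMatrix b b A.toLinearMap i j) := by
    let l : (E →L[ℝ] E) →ₗ[ℝ] ℝ :=
      { toFun := fun A => LinearMap.toMatrix b b A.toLinearMap i j
        map_add' := by simp
        map_smul' := by simp }
    exact (LinearMap.toContinuousLinearMap l).differentiable
  simp_rw [h, Matrix.det_apply]
  fun_prop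

/-- The flow `exp (t X)` of a linear vector field. -/
def flow (X : E →L[ℝ] E) (t : ℝ) : E →L[ℝ] E := NormedSpace.exp (t • X)

variable (X : E →L[ℝ] E)

@[simp] theorem flow_zero : flow X 0 = 1 := by simp [flow]

theorem flow_add (s t : ℝ) : flow X (s + t) = flow X s * flow X t := by
  rw [flow, add_smul]
  letI : NormedAlgebra ℚ (E →L[ℝ] E) := NormedAlgebra.restrictScalars ℚ ℝ _
  exact NormedSpace.exp_add_of_commute (((Commute.refl X).smul_left s).smul_right t)

theorem flow_add_apply (s t : ℝ) (η : E) : flow X (s + t) η = flow X s (flow X t η) := by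
  rw [flow_add]; rfl

@[simp] theorem flow_neg_flow (t : ℝ) (η : E) : flow X (-t) (flow X t η) = η := by
  rw [← flow_add_apply]; simp

@[simp] theorem flow_flow_neg (t : ℝ) (η : E) : flow X t (flow X (-t) η) = η := by
  rw [← flow_add_apply]; simp

theorem hasDerivAt_flow (t : ℝ) : HasDerivAt (flow X) (X * flow X t) t :=
  hasDerivAt_exp_smul_const' X t

theorem hasDerivAt_flow_apply (t : ℝ) (η : E) :
    HasDerivAt (fun t => flow X t η) (X (flow X t η)) t :=
  (hasDerivAt_flow X t).clm_apply (hasDerivAt_const t η) |>.congr_deriv (by simp)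

theorem continuous_flow : Continuous (flow X) :=
  continuous_iff_continuousAt.2 fun t => (hasDerivAt_flow X t).continuousAt

theorem continuous_flow_apply : Continuous fun p : ℝ × E => flow X p.1 p.2 :=
  ((continuous_flow X).comp continuous_fst).clm_apply continuous_snd

/-- The trace of an endomorphism, as a real number. -/
def tr : ℝ := LinearMap.trace ℝ (E) X.toLinearMap

/-- Liouville's formula: multiplicativity moves the derivative at time `0`, which is the trace, to
every time, so `det * exp (-t tr X)` is constant. -/
theorem det_flow (t : ℝ) : (flow X t).det = Real.exp (t * tr X) := by
  have hmul (A B : E →L[ℝ] E) : (A * B).det = A.det * B.det := LinearMap.det_comp _ _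
  have h0 : HasDerivAt (fun h => (flow X h).det) (tr X) 0 := by
    have hd := (differentiable_det (E := E) 1).hasFDerivAt
    have h1 : HasDerivAt (fun r : ℝ => 1 + r • X) X 0 := by
      simpa using ((hasDerivAt_id (0 : ℝ)).smul_const X).const_add 1
    have h2 := HasFDerivAt.comp_hasDerivAt_of_eq (0 : ℝ) hd h1 (by simp)
    have h3 := h2.unique (hasDerivAt_det_one_add_smul X)
    have h4 : HasDerivAt (flow X) X 0 := by simpa using hasDerivAt_flow X 0
    have h5 := HasFDerivAt.comp_hasDerivAt_of_eq (0 : ℝ) hd h4 (by simp)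
    rw [h3] at h5
    exact h5
  have hd (t : ℝ) : HasDerivAt (fun h => (flow X h).det) ((flow X t).det * tr X) t := by
    have h1 : HasDerivAt (fun h => (flow X (h - t)).det) (tr X) t :=
      HasDerivAt.comp_sub_const (f := fun h => (flow X h).det) t t (by simpa using h0)
    refine (h1.const_mul (flow X t).det).congr_of_eventuallyEq (Eventually.of_forall fun h => ?_)
    simp only [← hmul, ← flow_add, add_sub_cancel]
  have hc (t : ℝ) : HasDerivAt (fun h => (flow X h).det * Real.exp (-(h * tr X))) 0 t := by
    refine ((hd t).mul (((hasDerivAt_id t).mul_const (tr X)).neg.exp)).congr_deriv ?_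
    simp; ring
  have := is_const_of_deriv_eq_zero (fun t => (hc t).differentiableAt) (fun t => (hc t).deriv) t 0
  simp only [flow_zero, zero_mul, neg_zero, Real.exp_zero, mul_one] at this
  have h1 : (1 : E →L[ℝ] E).det = 1 := LinearMap.det_id
  rw [h1, Real.exp_neg, mul_inv_eq_one₀ (Real.exp_pos _).ne'] at this
  exact this

/-- Negative times are included so that the same constant also bounds the inverse flow, that is,
bounds `‖flow X t η‖` from below. -/
theorem exists_norm_flow_le (T : ℝ) :
    ∃ K : ℝ, 1 ≤ K ∧ ∀ t ∈ Set.Icc (-T) T, ∀ η, ‖flow X t η‖ ≤ K * ‖η‖ := by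
  obtain ⟨K, hK⟩ := isCompact_Icc.exists_bound_of_continuousOn (s := Set.Icc (-T) T)
    (continuous_flow X).continuousOn
  refine ⟨max K 1, le_max_right _ _, fun t ht η => ?_⟩
  exact ((flow X t).le_opNorm η).trans
    (mul_le_mul_of_nonneg_right ((hK t ht).trans (le_max_left _ _)) (norm_nonneg _))

/-- The integral of `σ` along the flow. -/
def accum (σ : E → ℝ) (t : ℝ) (η : E) : ℝ := ∫ τ in (0 : ℝ)..t, σ (flow X τ η)

variable {X} {σ : E → ℝ}

theorem continuous_accum (hσ : Continuous σ) (t : ℝ) : Continuous (accum X σ t) :=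
  intervalIntegral.continuous_parametric_intervalIntegral_of_continuous'
    (f := fun η τ => σ (flow X τ η)) (hσ.comp ((continuous_flow_apply X).comp continuous_swap)) 0 t

theorem continuous_comp_flow (hσ : Continuous σ) (η : E) :
    Continuous fun τ => σ (flow X τ η) :=
  hσ.comp ((continuous_flow_apply X).comp (continuous_id.prodMk continuous_const))

theorem accum_nonneg (hσ : ∀ η, 0 ≤ σ η) {t : ℝ} (ht : 0 ≤ t) (η : E) : 0 ≤ accum X σ t η :=
  intervalIntegral.integral_nonneg ht fun _ _ => hσ _

@[simp] theorem accum_zero_time (η : E) : accum X σ 0 η = 0 := by simp [accum]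

theorem accum_add (hσ : Continuous σ) (s t : ℝ) (η : E) :
    accum X σ (s + t) η = accum X σ s η + accum X σ t (flow X s η) := by
  have h1 : accum X σ t (flow X s η) = ∫ τ in s..(s + t), σ (flow X τ η) := by
    have := intervalIntegral.integral_comp_add_right (fun τ => σ (flow X τ η)) (a := 0) (b := t) s
    simp only [flow_add_apply, zero_add] at this
    rw [accum, this, add_comm]
  rw [h1]
  exact (intervalIntegral.integral_add_adjacent_intervals
    ((continuous_comp_flow hσ η).intervalIntegrable _ _)
    ((continuous_comp_flow hσ η).intervalIntegrable _ _)).symm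

end

section

variable {E : Type*} [NormedAddCommGroup E] [InnerProductSpace ℝ E] [FiniteDimensional ℝ E]
  [MeasurableSpace E] [BorelSpace E]

/-! ### Weighted composition operators on `L²` -/

variable (E) in
/-- Complex-valued square-integrable functions on a Euclidean space. -/
abbrev LTwo : Type _ := Lp ℂ 2 (volume : Measure E)

theorem quasiMeasurePreserving_of_det_ne_zero {A : E →L[ℝ] E} (hA : A.det ≠ 0) :
    Measure.QuasiMeasurePreserving A (volume : Measure E) volume := by
  refine ⟨A.continuous.measurable, ?_⟩
  have := Measure.map_linearMap_addHaar_eq_smul_addHaar (volume : Measure E)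
    (f := A.toLinearMap) hA
  rw [show (⇑A : E → E) = ⇑A.toLinearMap from rfl, this]
  exact Measure.smul_absolutelyContinuous

theorem eLpNorm_comp_of_det_ne_zero {A : E →L[ℝ] E} (hA : A.det ≠ 0) {f : E → ℂ}
    (hf : AEStronglyMeasurable f) :
    eLpNorm (fun η => f (A η)) 2 =
      ENNReal.ofReal (|A.det| ^ (-(1 / 2) : ℝ)) * eLpNorm f 2 := by
  have hmap := Measure.map_linearMap_addHaar_eq_smul_addHaar (volume : Measure E)
    (f := A.toLinearMap) hA
  have h1 := eLpNorm_map_measure (p := 2) (μ := (volume : Measure E)) (f := A) (g := f)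
    (by
      rw [show (⇑A : E → E) = ⇑A.toLinearMap from rfl, hmap]
      exact hf.mono_ac Measure.smul_absolutelyContinuous)
    A.continuous.aemeasurable
  rw [show (fun η => f (A η)) = f ∘ A from rfl, ← h1,
    show (⇑A : E → E) = ⇑A.toLinearMap from rfl, hmap,
    eLpNorm_smul_measure_of_ne_top (by simp), smul_eq_mul]
  congr 1
  rw [ENNReal.ofReal_rpow_of_pos (abs_pos.2 (inv_ne_zero hA))]
  congr 1
  rw [abs_inv, Real.inv_rpow (abs_nonneg _), Real.rpow_neg (abs_nonneg _)]
  norm_num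

theorem eLpNorm_weighted_comp_le {A : E →L[ℝ] E} (hA : A.det ≠ 0) {m : E → ℝ} {C : ℝ}
    (hC : ∀ η, |m η| ≤ C) {f : E → ℂ} (hf : AEStronglyMeasurable f) :
    eLpNorm (fun η => (m η : ℂ) * f (A η)) 2 ≤
      ENNReal.ofReal (C * |A.det| ^ (-(1 / 2) : ℝ)) * eLpNorm f 2 := by
  have hC0 : 0 ≤ C := (abs_nonneg _).trans (hC 0)
  rw [ENNReal.ofReal_mul hC0, mul_assoc, ← eLpNorm_comp_of_det_ne_zero hA hf]
  refine eLpNorm_le_mul_eLpNorm_of_ae_le_mul (Eventually.of_forall fun η => ?_) 2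
  rw [norm_mul, Complex.norm_real]
  exact mul_le_mul_of_nonneg_right (hC η) (norm_nonneg _)

theorem memLp_weighted_comp {A : E →L[ℝ] E} (hA : A.det ≠ 0) {m : E → ℝ} (hm : Continuous m)
    {C : ℝ} (hC : ∀ η, |m η| ≤ C) {f : E → ℂ} (hf : MemLp f 2) :
    MemLp (fun η => (m η : ℂ) * f (A η)) 2 := by
  refine ⟨?_, (eLpNorm_weighted_comp_le hA hC hf.1).trans_lt
    (ENNReal.mul_lt_top ENNReal.ofReal_lt_top hf.2)⟩
  exact (Complex.continuous_ofReal.comp hm).aestronglyMeasurable.mul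
    (hf.1.comp_quasiMeasurePreserving (quasiMeasurePreserving_of_det_ne_zero hA))

/-- The operator `f ↦ m · (f ∘ A)` on `L²`, for an invertible linear map `A` and a bounded
continuous function `m`. -/
def weightedComp (A : E →L[ℝ] E) (hA : A.det ≠ 0) (m : E → ℝ) (hm : Continuous m) (C : ℝ)
    (hC : ∀ η, |m η| ≤ C) : LTwo E →L[ℂ] LTwo E :=
  LinearMap.mkContinuous
    { toFun := fun f => (memLp_weighted_comp hA hm hC (Lp.memLp f)).toLp _
      map_add' := fun f g => by
        rw [← MemLp.toLp_add, MemLp.toLp_eq_toLp_iff]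
        filter_upwards [(quasiMeasurePreserving_of_det_ne_zero hA).ae_eq_comp (Lp.coeFn_add f g)]
          with η h
        simp only [Function.comp_apply, Pi.add_apply] at h ⊢
        rw [h, mul_add]
      map_smul' := fun c f => by
        rw [RingHom.id_apply, ← MemLp.toLp_const_smul, MemLp.toLp_eq_toLp_iff]
        filter_upwards [(quasiMeasurePreserving_of_det_ne_zero hA).ae_eq_comp (Lp.coeFn_smul c f)]
          with η h
        simp only [Function.comp_apply, Pi.smul_apply] at h ⊢
        rw [h, mul_smul_comm] }
    (C * |A.det| ^ (-(1 / 2) : ℝ))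
    (fun f => by
      have hC0 : 0 ≤ C := (abs_nonneg _).trans (hC 0)
      simp only [LinearMap.coe_mk, AddHom.coe_mk, Lp.norm_toLp]
      rw [Lp.norm_def, ← ENNReal.toReal_ofReal (r := C * _) (by positivity), ← ENNReal.toReal_mul]
      exact ENNReal.toReal_mono
        (ENNReal.mul_ne_top ENNReal.ofReal_ne_top (Lp.eLpNorm_ne_top f))
        (eLpNorm_weighted_comp_le hA hC (Lp.aestronglyMeasurable f)))

section weightedComp

variable {A : E →L[ℝ] E} {hA : A.det ≠ 0} {m : E → ℝ} {hm : Continuous m} {C : ℝ}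
  {hC : ∀ η, |m η| ≤ C}

theorem coeFn_weightedComp (f : LTwo E) :
    weightedComp A hA m hm C hC f =ᵐ[volume] fun η => (m η : ℂ) * f (A η) :=
  MemLp.coeFn_toLp (memLp_weighted_comp hA hm hC (Lp.memLp f))

theorem norm_weightedComp_le (f : LTwo E) :
    ‖weightedComp A hA m hm C hC f‖ ≤ C * |A.det| ^ (-(1 / 2) : ℝ) * ‖f‖ :=
  LinearMap.mkContinuous_norm_le _ (by
    have hC0 : 0 ≤ C := (abs_nonneg _).trans (hC 0)
    positivity) _ |> ContinuousLinearMap.le_of_opNorm_le _ <| f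

end weightedComp

/-! ### The evolution on the Fourier side -/

variable {X : E →L[ℝ] E} {σ : E → ℝ}

theorem det_flow_ne_zero (t : ℝ) : (flow X t).det ≠ 0 := by
  rw [det_flow]; exact (Real.exp_pos _).ne'

/-- The weight `exp (t tr X - ½ ∫₀ᵗ σ (exp (τ X) η) dτ)`. -/
def weight (X : E →L[ℝ] E) (σ : E → ℝ) (t : ℝ) (η : E) : ℝ :=
  Real.exp (t * tr X) * Real.exp (-(1 / 2) * accum X σ t η)

theorem continuous_weight (hσ : Continuous σ) (t : ℝ) : Continuous (weight X σ t) :=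
  continuous_const.mul (Real.continuous_exp.comp (continuous_const.mul (continuous_accum hσ t)))

theorem abs_weight_le (hσ0 : ∀ η, 0 ≤ σ η) {t : ℝ} (ht : 0 ≤ t) (η : E) :
    |weight X σ t η| ≤ Real.exp (t * tr X) := by
  rw [weight, abs_of_pos (by positivity)]
  refine mul_le_of_le_one_right (by positivity) (Real.exp_le_one_iff.2 ?_)
  have := accum_nonneg (X := X) hσ0 ht η
  linarith

/-- The evolution `f ↦ weight t · (f ∘ flow t)` on `L²`. -/
def evolve (X : E →L[ℝ] E) (hσ : Continuous σ) (hσ0 : ∀ η, 0 ≤ σ η) (t : ℝ≥0) :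
    LTwo E →L[ℂ] LTwo E :=
  weightedComp (flow X t) (det_flow_ne_zero _) (weight X σ t) (continuous_weight hσ t)
    (Real.exp (t * tr X)) (abs_weight_le hσ0 t.2)

variable (hσ : Continuous σ) (hσ0 : ∀ η, 0 ≤ σ η)

theorem coeFn_evolve (t : ℝ≥0) (f : LTwo E) :
    evolve X hσ hσ0 t f =ᵐ[volume] fun η => (weight X σ t η : ℂ) * f (flow X t η) :=
  coeFn_weightedComp f

/-- The change of variables contributes `exp (-t tr X / 2)`, which halves the growth exponent of the
weight. -/
theorem norm_evolve_le (t : ℝ≥0) (f : LTwo E) :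
    ‖evolve X hσ hσ0 t f‖ ≤ Real.exp (tr X / 2 * t) * ‖f‖ := by
  refine (norm_weightedComp_le f).trans_eq ?_
  rw [det_flow, Real.abs_exp, ← Real.exp_mul, ← Real.exp_add]
  congr 2
  ring

theorem evolve_zero : evolve X hσ hσ0 0 = ContinuousLinearMap.id ℂ (LTwo E) := by
  ext1 f
  refine Lp.ext ?_
  filter_upwards [coeFn_evolve (X := X) hσ hσ0 0 f] with η h
  rw [h]
  simp [weight]

/-- The semigroup law is the cocycle property of the weight, inherited from the additivity of
`accum` along the flow. -/
theorem evolve_add (s t : ℝ≥0) :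
    evolve X hσ hσ0 (s + t) = (evolve X hσ hσ0 s).comp (evolve X hσ hσ0 t) := by
  ext1 f
  refine Lp.ext ?_
  filter_upwards [coeFn_evolve (X := X) hσ hσ0 (s + t) f,
    coeFn_evolve (X := X) hσ hσ0 s (evolve X hσ hσ0 t f),
    (quasiMeasurePreserving_of_det_ne_zero (det_flow_ne_zero (X := X) s)).ae_eq_comp
      (coeFn_evolve (X := X) hσ hσ0 t f)] with η h1 h2 h3
  simp only [Function.comp_apply] at h3
  rw [h1, ContinuousLinearMap.comp_apply, h2, h3, NNReal.coe_add, ← mul_assoc, ← flow_add_apply,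
    add_comm (t : ℝ) s]
  congr 1
  rw [weight, weight, weight, accum_add hσ, add_mul, Real.exp_add, mul_add, Real.exp_add]
  push_cast
  ring

end

section

variable {E : Type*} [NormedAddCommGroup E] [InnerProductSpace ℝ E] [FiniteDimensional ℝ E]
  [MeasurableSpace E] [BorelSpace E]

/-! ### The bilinear pairing and the transposed evolution -/

variable (E) in
/-- The bilinear pairing `∫ g f` on `L²`. -/
def pair : LTwo E →L[ℂ] LTwo E →L[ℂ] ℂ := (ContinuousLinearMap.mul ℂ ℂ).lpPairing volume 2 2

theorem pair_apply (g f : LTwo E) : pair E g f = ∫ η, g η * f η :=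
  ContinuousLinearMap.lpPairing_eq_integral _ _ _

theorem pair_toLp (ψ : 𝓢(E, ℂ)) (f : LTwo E) : pair E (ψ.toLp 2) f = ∫ η, ψ η * f η := by
  rw [pair_apply]
  refine integral_congr_ae ?_
  filter_upwards [ψ.coeFn_toLp 2 volume] with η h
  rw [h]

theorem integral_comp_of_det_ne_zero {A : E →L[ℝ] E} (hA : A.det ≠ 0) {F : E → ℂ}
    (hF : AEStronglyMeasurable F) : ∫ η, F (A η) = |A.det|⁻¹ • ∫ η, F η := by
  have hmap := Measure.map_linearMap_addHaar_eq_smul_addHaar (volume : Measure E)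
    (f := A.toLinearMap) hA
  have h1 := integral_map (μ := (volume : Measure E)) (φ := A) (f := F)
    A.continuous.aemeasurable
    (by
      rw [show (⇑A : E → E) = ⇑A.toLinearMap from rfl, hmap]
      exact hF.mono_ac Measure.smul_absolutelyContinuous)
  rw [← h1, show (⇑A : E → E) = ⇑A.toLinearMap from rfl, hmap, integral_smul_measure,
    ENNReal.toReal_ofReal (abs_nonneg _), abs_inv]

variable {X : E →L[ℝ] E} {σ : E → ℝ}

theorem flow_neg_field (t : ℝ) : flow (-X) t = flow X (-t) := by
  rw [flow, flow, smul_neg, neg_smul]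

theorem tr_neg : tr (-X) = -tr X := by
  simp [tr]

theorem accum_flow_neg (t : ℝ) (η : E) :
    accum X σ t (flow X (-t) η) = accum (-X) σ t η := by
  have := intervalIntegral.integral_comp_sub_left (a := 0) (b := t)
    (fun τ => σ (flow X (-τ) η)) t
  simp only [sub_self, sub_zero] at this
  simp only [accum, flow_neg_field, ← this, ← flow_add_apply]
  simp only [neg_sub]
  simp only [sub_eq_add_neg]

variable (hσ : Continuous σ) (hσ0 : ∀ η, 0 ≤ σ η)

/-- The transpose is computed by substituting `flow X (-t)`: the Jacobian cancels the trace factor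
of the weight. Since `evolve (-X)` carries a factor `exp (-t tr X)` of its own, a compensating
exponential appears, and the transpose is plain damping times composition with the reversed flow. -/
theorem pair_evolve (t : ℝ≥0) (g f : LTwo E) :
    pair E g (evolve X hσ hσ0 t f) =
      (Real.exp (t * tr X) : ℂ) * pair E (evolve (-X) hσ hσ0 t g) f := by
  set F : E → ℂ := fun η => ((Real.exp (t * tr X) * Real.exp (-(1 / 2) * accum (-X) σ t η) : ℝ) : ℂ)
    * g (flow X (-t) η) * f η
  have hF : AEStronglyMeasurable F volume := by
    refine AEStronglyMeasurable.mul (AEStronglyMeasurable.mul ?_ ?_) (Lp.aestronglyMeasurable f)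
    · refine (Complex.continuous_ofReal.comp (continuous_const.mul
        (Real.continuous_exp.comp (continuous_const.mul ?_)))).aestronglyMeasurable
      exact continuous_accum hσ t
    · exact (Lp.aestronglyMeasurable g).comp_quasiMeasurePreserving
        (quasiMeasurePreserving_of_det_ne_zero (det_flow_ne_zero _))
  have h1 : pair E g (evolve X hσ hσ0 t f) = ∫ η, F (flow X t η) := by
    rw [pair_apply]
    refine integral_congr_ae ?_
    filter_upwards [coeFn_evolve (X := X) hσ hσ0 t f] with η h
    simp only [h, F, flow_neg_flow, ← accum_flow_neg, weight]
    push_cast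
    ring
  have h2 : pair E (evolve (-X) hσ hσ0 t g) f =
      ∫ η, (Real.exp (-(t * tr X)) * Real.exp (-(t * tr X)) : ℂ) * F η := by
    rw [pair_apply]
    refine integral_congr_ae ?_
    filter_upwards [coeFn_evolve (X := -X) hσ hσ0 t g] with η h
    simp only [h, F, flow_neg_field, weight, tr_neg, mul_neg]
    rw [Real.exp_neg]
    have := (Real.exp_pos (t * tr X)).ne'
    push_cast
    field_simp
  rw [h1, h2, integral_comp_of_det_ne_zero (det_flow_ne_zero _) hF, det_flow, Real.abs_exp,
    integral_const_mul, Real.exp_neg, Complex.real_smul]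
  have : (Real.exp (t * tr X) : ℂ) ≠ 0 := by exact_mod_cast (Real.exp_pos (t * tr X)).ne'
  push_cast at this ⊢
  field_simp

/-! ### Decay of Schwartz functions -/

theorem exists_schwartz_decay {F : Type*} [NormedAddCommGroup F] [NormedSpace ℝ F]
    (ψ : 𝓢(E, F)) (k : ℕ) : ∃ C, 0 ≤ C ∧ ∀ x, (1 + ‖x‖) ^ k * ‖ψ x‖ ≤ C := by
  have h (x : E) := SchwartzMap.one_add_le_sup_seminorm_apply (𝕜 := ℝ) (m := (k, 0))
    le_rfl le_rfl ψ x
  refine ⟨_, le_trans (by positivity) (h 0), fun x => ?_⟩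
  simpa using h x

/-- The transpose of `-P` on a Schwartz function, on the Fourier side. -/
def transposeGen (X : E →L[ℝ] E) (σ : E → ℝ) (ψ : 𝓢(E, ℂ)) (η : E) : ℂ :=
  -(1 / 2 : ℂ) * σ η * ψ η - fderiv ℝ ψ η (X η)

include hσ in
theorem continuous_transposeGen (ψ : 𝓢(E, ℂ)) : Continuous (transposeGen X σ ψ) := by
  refine ((continuous_const.mul (Complex.continuous_ofReal.comp hσ)).mul ψ.continuous).sub ?_
  exact ((SchwartzMap.fderivCLM ℝ E ℂ ψ).continuous.clm_apply X.continuous).congr fun _ => rfl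

variable (hσg : ∃ C : ℝ, ∃ k : ℕ, ∀ η, σ η ≤ C * (1 + ‖η‖) ^ k)

include hσ0 hσg in
theorem exists_transposeGen_decay (X : E →L[ℝ] E) (ψ : 𝓢(E, ℂ)) (N : ℕ) :
    ∃ C, 0 ≤ C ∧ ∀ x, ‖transposeGen X σ ψ x‖ ≤ C * ((1 + ‖x‖) ^ N)⁻¹ := by
  obtain ⟨C₀, k, hC₀⟩ := hσg
  obtain ⟨C₁, hC₁0, hC₁⟩ := exists_schwartz_decay ψ (k + N)
  obtain ⟨C₂, hC₂0, hC₂⟩ := exists_schwartz_decay (SchwartzMap.fderivCLM ℝ E ℂ ψ) (N + 1)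
  have hC₀0 : 0 ≤ C₀ := by simpa using (hσ0 0).trans (hC₀ 0)
  refine ⟨C₀ * C₁ + C₂ * ‖X‖, by positivity, fun x => ?_⟩
  have hp : 0 < (1 + ‖x‖) ^ N := by positivity
  rw [← div_eq_mul_inv, le_div_iff₀ hp]
  have h1 : ‖(-(1 / 2 : ℂ) * σ x * ψ x)‖ ≤ C₀ * (1 + ‖x‖) ^ k * ‖ψ x‖ := by
    rw [norm_mul, norm_mul, Complex.norm_real, Real.norm_of_nonneg (hσ0 x)]
    have : ‖(-(1 / 2 : ℂ))‖ ≤ 1 := by norm_num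
    refine mul_le_mul_of_nonneg_right ?_ (norm_nonneg _)
    exact (mul_le_of_le_one_left (hσ0 x) this).trans (hC₀ x)
  have h2 : ‖fderiv ℝ ψ x (X x)‖ ≤ ‖SchwartzMap.fderivCLM ℝ E ℂ ψ x‖ * (‖X‖ * (1 + ‖x‖)) := by
    refine ((fderiv ℝ ψ x).le_opNorm _).trans ?_
    rw [SchwartzMap.fderivCLM_apply]
    gcongr
    refine (X.le_opNorm x).trans ?_
    gcongr
    linarith [norm_nonneg x]
  calc ‖transposeGen X σ ψ x‖ * (1 + ‖x‖) ^ N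
      ≤ (C₀ * (1 + ‖x‖) ^ k * ‖ψ x‖ +
          ‖SchwartzMap.fderivCLM ℝ E ℂ ψ x‖ * (‖X‖ * (1 + ‖x‖))) * (1 + ‖x‖) ^ N := by
        gcongr
        exact (norm_sub_le _ _).trans (add_le_add h1 h2)
    _ = C₀ * ((1 + ‖x‖) ^ (k + N) * ‖ψ x‖) +
          ((1 + ‖x‖) ^ (N + 1) * ‖SchwartzMap.fderivCLM ℝ E ℂ ψ x‖) * ‖X‖ := by ring
    _ ≤ _ := by gcongr; exacts [hC₁ x, hC₂ x]

-- The dominating function for all limits below. The exponent `dim + 1` is ample, since its double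
-- exceeds `dim`.
variable (E) in
theorem memLp_two_inv_one_add_norm_pow :
    MemLp (fun x : E => ((1 + ‖x‖) ^ (Module.finrank ℝ E + 1))⁻¹) 2 := by
  have hc : Continuous (fun x : E => ((1 + ‖x‖) ^ (Module.finrank ℝ E + 1))⁻¹) :=
    ((continuous_const.add continuous_norm).pow _).inv₀ fun x =>
      (pow_pos (by positivity : (0 : ℝ) < 1 + ‖x‖) _).ne'
  rw [memLp_two_iff_integrable_sq hc.aestronglyMeasurable]
  have := integrable_one_add_norm (E := E) (μ := volume)
    (r := ((2 * (Module.finrank ℝ E + 1) : ℕ) : ℝ)) (by push_cast; linarith)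
  refine this.congr (Eventually.of_forall fun x => ?_)
  have : (0 : ℝ) ≤ 1 + ‖x‖ := by positivity
  simp only [Real.rpow_neg this, Real.rpow_natCast]
  rw [inv_pow, ← pow_mul, mul_comm 2]

/-! ### The weak derivative of the evolution at time zero -/

/-- A Schwartz function transported by the transposed evolution. -/
def transported (X : E →L[ℝ] E) (σ : E → ℝ) (ψ : 𝓢(E, ℂ)) (h : ℝ) (η : E) : ℂ :=
  (Real.exp (-(1 / 2) * accum (-X) σ h η) : ℂ) * ψ (flow X (-h) η)

-- The evolution commutes with its generator, so the derivative at time `h` is the transposed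
-- generator evaluated at time `0` and then transported. A uniform bound on the derivative thus
-- reduces to the decay of `transposeGen`.
include hσ in
theorem hasDerivAt_transported (ψ : 𝓢(E, ℂ)) (h : ℝ) (η : E) :
    HasDerivAt (fun h => transported X σ ψ h η)
      ((Real.exp (-(1 / 2) * accum (-X) σ h η) : ℂ) * transposeGen X σ ψ (flow X (-h) η)) h := by
  have h1 : HasDerivAt (fun h => accum (-X) σ h η) (σ (flow X (-h) η)) h := by
    have := intervalIntegral.integral_hasDerivAt_right
      ((continuous_comp_flow (X := -X) hσ η).intervalIntegrable 0 h)
      (continuous_comp_flow (X := -X) hσ η).stronglyMeasurable.stronglyMeasurableAtFilter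
      (continuous_comp_flow (X := -X) hσ η).continuousAt
    rwa [flow_neg_field] at this
  have h2 : HasDerivAt (fun h => flow X (-h) η) (-(X (flow X (-h) η))) h := by
    have := (hasDerivAt_flow_apply (-X) h η)
    simpa only [flow_neg_field, neg_apply] using this
  have h3 := (ψ.differentiableAt (x := flow X (-h) η)).hasFDerivAt.comp_hasDerivAt h h2
  have h4 := ((h1.const_mul (-(1 / 2))).exp.ofReal_comp).mul h3
  refine h4.congr_deriv ?_
  simp only [transposeGen, map_neg, Function.comp_apply]
  push_cast
  ring

-- Mean value inequality in time. The decay of `transposeGen X σ ψ` survives composition with the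
-- flow, at the cost of `K ^ N`, because the flow distorts norms by a bounded factor on a bounded
-- time interval.
include hσ hσ0 hσg in
theorem exists_bound_transported (ψ : 𝓢(E, ℂ)) :
    ∃ C, 0 ≤ C ∧ ∀ h ∈ Set.Icc (0 : ℝ) 1, ∀ η,
      ‖transported X σ ψ h η - ψ η‖ ≤ C * ((1 + ‖η‖) ^ (Module.finrank ℝ E + 1))⁻¹ * h := by
  obtain ⟨C, hC0, hC⟩ := exists_transposeGen_decay hσ0 hσg X ψ (Module.finrank ℝ E + 1)
  obtain ⟨K, hK1, hK⟩ := exists_norm_flow_le X 1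
  set N := Module.finrank ℝ E + 1
  refine ⟨C * K ^ N, by positivity, fun h hh η => ?_⟩
  have key := norm_image_sub_le_of_norm_deriv_right_le_segment
    (f := fun h => transported X σ ψ h η) (a := 0) (b := 1)
    (C := C * K ^ N * ((1 + ‖η‖) ^ N)⁻¹)
    (fun h _ => (hasDerivAt_transported hσ ψ h η).continuousAt.continuousWithinAt)
    (fun h _ => (hasDerivAt_transported hσ ψ h η).hasDerivWithinAt)
    (fun h hh => ?_) h hh
  · simpa [transported] using key
  · have h1 : ‖η‖ ≤ K * ‖flow X (-h) η‖ := by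
      have := hK h ⟨by linarith [hh.1], hh.2.le⟩ (flow X (-h) η)
      rwa [flow_flow_neg] at this
    have h2 : (1 + ‖η‖) ^ N ≤ K ^ N * (1 + ‖flow X (-h) η‖) ^ N := by
      rw [← mul_pow]
      gcongr
      nlinarith
    have h3 : ((1 + ‖flow X (-h) η‖) ^ N)⁻¹ ≤ K ^ N * ((1 + ‖η‖) ^ N)⁻¹ := by
      rw [← div_eq_mul_inv, le_div_iff₀ (by positivity), inv_mul_le_iff₀ (by positivity)]
      linarith
    rw [norm_mul, Complex.norm_real, Real.norm_of_nonneg (Real.exp_pos _).le]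
    have h4 : Real.exp (-(1 / 2) * accum (-X) σ h η) ≤ 1 := by
      have := accum_nonneg (X := -X) hσ0 hh.1 η
      exact Real.exp_le_one_iff.2 (by linarith)
    calc _ ≤ 1 * (C * (K ^ N * ((1 + ‖η‖) ^ N)⁻¹)) := by
          gcongr
          exact (hC _).trans (by gcongr)
      _ = _ := by ring

theorem tendsto_coe_nhdsGT_zero :
    Tendsto (fun h : ℝ≥0 => (h : ℝ)) (𝓝[>] 0) (𝓝[>] 0) := by
  refine tendsto_nhdsWithin_iff.2 ⟨?_, ?_⟩
  · exact (NNReal.continuous_coe.tendsto' 0 0 rfl).mono_left nhdsWithin_le_nhds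
  · filter_upwards [self_mem_nhdsWithin] with h hh
    exact NNReal.coe_pos.2 hh

-- The evolution is moved onto the smooth factor, where difference quotients converge pointwise and
-- are dominated; no regularity of `w` is needed.
include hσg in
theorem tendsto_pair_evolve (ψ : 𝓢(E, ℂ)) (w : LTwo E) :
    Tendsto (fun h : ℝ≥0 => ((h : ℝ)⁻¹ : ℝ) • pair E (ψ.toLp 2) (evolve X hσ hσ0 h w - w))
      (𝓝[>] 0) (𝓝 (∫ η, transposeGen X σ ψ η * w η)) := by
  obtain ⟨C, hC0, hC⟩ := exists_bound_transported (X := X) hσ hσ0 hσg ψ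
  have hmem := memLp_two_inv_one_add_norm_pow E
  set b : E → ℝ := fun x : E => ((1 + ‖x‖) ^ (Module.finrank ℝ E + 1))⁻¹ with hb
  have htm (h : ℝ) : Continuous (transported X σ ψ h) := by
    refine (Complex.continuous_ofReal.comp (Real.continuous_exp.comp (continuous_const.mul ?_))).mul
      (ψ.continuous.comp (flow X (-h)).continuous)
    exact continuous_accum hσ h
  have hpair (h : ℝ≥0) : pair E (ψ.toLp 2) (evolve X hσ hσ0 h w) =
      ∫ η, transported X σ ψ h η * w η := by
    rw [pair_evolve, pair_apply, ← integral_const_mul]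
    refine integral_congr_ae ?_
    filter_upwards [coeFn_evolve (X := -X) hσ hσ0 h (ψ.toLp 2),
      (quasiMeasurePreserving_of_det_ne_zero (det_flow_ne_zero (X := -X) h)).ae_eq_comp
        (ψ.coeFn_toLp 2 volume)] with η h1 h2
    simp only [Function.comp_apply] at h2
    rw [h1, h2, transported, weight, tr_neg, flow_neg_field, mul_neg, Real.exp_neg]
    have : (Real.exp (h * tr X) : ℂ) ≠ 0 := by exact_mod_cast (Real.exp_pos (h * tr X)).ne'
    push_cast at this ⊢
    field_simp
  have hbw : Integrable (fun η => b η * ‖w η‖) volume := hmem.integrable_mul (Lp.memLp w).norm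
  have hint : ∀ h ∈ Set.Icc (0 : ℝ) 1,
      Integrable (fun η => (transported X σ ψ h η - ψ η) * w η) volume := by
    intro h hh
    refine (hbw.const_mul C).mono' (((htm h).sub ψ.continuous).aestronglyMeasurable.mul
      (Lp.aestronglyMeasurable w)) (Eventually.of_forall fun η => ?_)
    rw [norm_mul, ← mul_assoc]
    gcongr
    refine (hC h hh η).trans (mul_le_of_le_one_right ?_ hh.2)
    positivity
  have hψw : Integrable (fun η => ψ η * w η) volume :=
    (ψ.memLp 2 volume).integrable_mul (Lp.memLp w)
  have hev : ∀ᶠ h : ℝ≥0 in 𝓝[>] 0, 0 < h ∧ (h : ℝ) ∈ Set.Icc (0 : ℝ) 1 := by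
    have : ∀ᶠ h : ℝ≥0 in 𝓝[>] 0, h < 1 :=
      (eventually_lt_nhds zero_lt_one).filter_mono nhdsWithin_le_nhds
    filter_upwards [self_mem_nhdsWithin, this] with h h0 h1
    exact ⟨h0, h.2, by exact_mod_cast h1.le⟩
  have hlim : Tendsto (fun h : ℝ≥0 => ∫ η, ((h : ℝ)⁻¹ : ℝ) •
      ((transported X σ ψ h η - ψ η) * w η)) (𝓝[>] 0)
      (𝓝 (∫ η, transposeGen X σ ψ η * w η)) := by
    refine tendsto_integral_filter_of_dominated_convergence (fun η => C * (b η * ‖w η‖))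
      ?_ ?_ (hbw.const_mul C) ?_
    · exact Eventually.of_forall fun h => ((((htm h).sub ψ.continuous).aestronglyMeasurable.mul
        (Lp.aestronglyMeasurable w)).const_smul ((h : ℝ)⁻¹))
    · filter_upwards [hev] with h hh
      refine Eventually.of_forall fun η => ?_
      have h0 : (0 : ℝ) < h := hh.1
      rw [norm_smul, norm_mul, norm_inv, Real.norm_of_nonneg h0.le, inv_mul_le_iff₀ h0]
      calc _ ≤ C * b η * h * ‖w η‖ := by gcongr; exact hC h hh.2 η
        _ = _ := by ring
    · refine Eventually.of_forall fun η => ?_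
      have h1 := (hasDerivAt_transported (X := X) hσ ψ 0 η).tendsto_slope_zero_right.comp
        tendsto_coe_nhdsGT_zero
      simp only [neg_zero, flow_zero, accum_zero_time, mul_zero, Real.exp_zero,
        Complex.ofReal_one, one_mul] at h1
      refine (h1.mul_const (w η)).congr fun h => ?_
      simp [transported, mul_assoc]
  refine hlim.congr' ?_
  filter_upwards [hev] with h hh
  rw [integral_smul, map_sub, hpair, pair_toLp, ← integral_sub _ hψw]
  · simp only [sub_mul]
  · refine ((hint h hh.2).add hψw).congr (Eventually.of_forall fun η => ?_)
    simp only [Pi.add_apply]; ring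

end

section

/-! ### Semigroups of operators on a Hilbert space -/

section Semigroup

variable {H : Type*} [NormedAddCommGroup H] [InnerProductSpace ℂ H] [CompleteSpace H]

/-- A strongly continuous one-parameter semigroup. -/
structure IsC0Semigroup (M : ℝ≥0 → H →L[ℂ] H) : Prop where
  map_zero : M 0 = ContinuousLinearMap.id ℂ H
  map_add : ∀ t t' : ℝ≥0, M (t + t') = (M t).comp (M t')
  continuous_orbit : ∀ u : H, Continuous fun t : ℝ≥0 => M t u

/-- `u` is in the domain of the infinitesimal generator of `M`, which maps it to `g`. -/
def GeneratorApply (M : ℝ≥0 → H →L[ℂ] H) (u g : H) : Prop :=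
  Tendsto (fun h : ℝ≥0 => ((h : ℝ)⁻¹ : ℝ) • (M h u - u)) (𝓝[>] 0) (𝓝 g)

theorem tendsto_toNNReal_nhdsGT_zero : Tendsto Real.toNNReal (𝓝[>] 0) (𝓝[>] 0) := by
  refine tendsto_nhdsWithin_iff.2 ⟨?_, ?_⟩
  · exact (continuous_real_toNNReal.tendsto' 0 0 Real.toNNReal_zero).mono_left nhdsWithin_le_nhds
  · filter_upwards [self_mem_nhdsWithin] with h hh
    exact Real.toNNReal_pos.2 hh

theorem hasDerivWithinAt_Ici_iff {F : Type*} [NormedAddCommGroup F] [NormedSpace ℝ F] {f : ℝ → F}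
    {f' : F} {t : ℝ} : HasDerivWithinAt f f' (Set.Ici t) t ↔
      Tendsto (fun h : ℝ≥0 => ((h : ℝ)⁻¹ : ℝ) • (f (t + h) - f t)) (𝓝[>] 0) (𝓝 f') := by
  have hadd : Tendsto (fun h : ℝ => t + h) (𝓝[>] 0) (𝓝[>] t) := by
    refine tendsto_nhdsWithin_iff.2 ⟨?_, ?_⟩
    · exact ((continuous_const.add continuous_id).tendsto' 0 t (by simp)).mono_left
        nhdsWithin_le_nhds
    · filter_upwards [self_mem_nhdsWithin] with h hh
      simpa using hh
  have hsub : Tendsto (fun h : ℝ => h - t) (𝓝[>] t) (𝓝[>] 0) := by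
    refine tendsto_nhdsWithin_iff.2 ⟨?_, ?_⟩
    · exact ((continuous_id.sub continuous_const).tendsto' t 0 (by simp)).mono_left
        nhdsWithin_le_nhds
    · filter_upwards [self_mem_nhdsWithin] with h hh
      simpa using hh
  rw [hasDerivWithinAt_iff_tendsto_slope, Set.Ici_sdiff_left]
  constructor
  · intro h
    refine (h.comp (hadd.comp tendsto_coe_nhdsGT_zero)).congr fun x => ?_
    simp [slope_def_module]
  · intro h
    refine (h.comp (tendsto_toNNReal_nhdsGT_zero.comp hsub)).congr' ?_
    filter_upwards [self_mem_nhdsWithin] with x hx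
    have : 0 ≤ x - t := sub_nonneg.2 (le_of_lt hx)
    simp [slope_def_module, Real.coe_toNNReal _ this]

variable {M : ℝ≥0 → H →L[ℂ] H}

/-- A quasi-contractive semigroup that is weakly continuous at the origin is strongly
continuous. -/
theorem isC0Semigroup_of_weak (h0 : M 0 = ContinuousLinearMap.id ℂ H)
    (hadd : ∀ t t' : ℝ≥0, M (t + t') = (M t).comp (M t')) {ω : ℝ}
    (hnorm : ∀ (t : ℝ≥0) u, ‖M t u‖ ≤ Real.exp (ω * t) * ‖u‖)
    (hweak : ∀ g u : H, Tendsto (fun h : ℝ≥0 => inner ℂ g (M h u)) (𝓝[>] 0) (𝓝 (inner ℂ g u))) :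
    IsC0Semigroup M := by
  refine ⟨h0, hadd, fun u => ?_⟩
  have hsq : Tendsto (fun h : ℝ≥0 => ‖M h u - u‖ ^ 2) (𝓝[>] 0) (𝓝 0) := by
    -- Expanding `‖M h u - u‖ ^ 2` and bounding `‖M h u‖` by quasi-contractivity leaves only an
    -- inner product, for which weak convergence is enough.
    have hb : Tendsto (fun h : ℝ≥0 => (Real.exp (ω * h) * ‖u‖) ^ 2 - 2 * (inner ℂ u (M h u)).re
        + ‖u‖ ^ 2) (𝓝[>] 0) (𝓝 0) := by
      have h1 : Tendsto (fun h : ℝ≥0 => (Real.exp (ω * h) * ‖u‖) ^ 2) (𝓝[>] 0) (𝓝 (‖u‖ ^ 2)) := by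
        refine (Continuous.tendsto' ?_ 0 _ (by simp)).mono_left nhdsWithin_le_nhds
        fun_prop
      have h2 := (Complex.continuous_re.tendsto _).comp (hweak u u)
      have h3 := (h1.sub (h2.const_mul 2)).add_const (‖u‖ ^ 2)
      have h4 : (inner ℂ u u).re = ‖u‖ ^ 2 := inner_self_eq_norm_sq (𝕜 := ℂ) u
      rw [h4] at h3
      simpa [show ‖u‖ ^ 2 - 2 * ‖u‖ ^ 2 + ‖u‖ ^ 2 = 0 by ring] using h3
    refine squeeze_zero (fun _ => by positivity) (fun h => ?_) hb
    have := norm_sub_sq (𝕜 := ℂ) (M h u) u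
    rw [this, inner_re_symm (𝕜 := ℂ) (M h u) u]
    have h5 := pow_le_pow_left₀ (norm_nonneg _) (hnorm h u) 2
    simp only [RCLike.re_eq_complex_re]
    linarith
  have hlim : Tendsto (fun h : ℝ≥0 => ‖M h u - u‖) (𝓝 0) (𝓝 0) := by
    have h1 : Tendsto (fun h : ℝ≥0 => ‖M h u - u‖) (𝓝[>] 0) (𝓝 0) := by
      have := (Real.continuous_sqrt.tendsto _).comp hsq
      simpa [Function.comp_def] using this
    have h2 : (𝓝 (0 : ℝ≥0)) = pure 0 ⊔ 𝓝[>] 0 := by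
      rw [← nhdsWithin_univ, ← nhdsWithin_singleton, ← nhdsWithin_union]
      congr 1
      ext x
      simp
    rw [h2]
    refine Tendsto.sup ?_ h1
    rw [tendsto_pure_left]
    intro s hs
    simpa [h0] using mem_of_mem_nhds hs
  have key (t t' : ℝ≥0) (htt : t ≤ t') :
      ‖M t' u - M t u‖ ≤ Real.exp (|ω| * t) * ‖M (t' - t) u - u‖ := by
    have h1 : M t' u = M t (M (t' - t) u) := by
      rw [← ContinuousLinearMap.comp_apply, ← hadd, add_tsub_cancel_of_le htt]
    rw [h1, ← map_sub]
    refine (hnorm t _).trans ?_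
    gcongr
    exact le_abs_self ω
  rw [continuous_iff_continuousAt]
  intro t
  rw [ContinuousAt, tendsto_iff_norm_sub_tendsto_zero]
  -- Subtraction in `ℝ≥0` is truncated, so one of the two terms always vanishes and the sum covers
  -- `t ≤ t'` and `t' ≤ t` together.
  have hb : Tendsto (fun t' : ℝ≥0 => Real.exp (|ω| * t) * (‖M (t' - t) u - u‖ +
      ‖M (t - t') u - u‖)) (𝓝 t) (𝓝 0) := by
    have h1 : Tendsto (fun t' : ℝ≥0 => t' - t) (𝓝 t) (𝓝 0) :=
      (continuous_id.sub continuous_const).tendsto' _ _ (by simp)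
    have h2 : Tendsto (fun t' : ℝ≥0 => t - t') (𝓝 t) (𝓝 0) :=
      (continuous_const.sub continuous_id).tendsto' _ _ (by simp)
    simpa using ((hlim.comp h1).add (hlim.comp h2)).const_mul (Real.exp (|ω| * t))
  refine squeeze_zero (fun _ => norm_nonneg _) (fun t' => ?_) hb
  rcases le_total t t' with h | h
  · refine (key t t' h).trans ?_
    gcongr
    simp
  · rw [norm_sub_rev]
    refine (key t' t h).trans ?_
    gcongr
    simp

namespace IsC0Semigroup

variable (hM : IsC0Semigroup M)
include hM

theorem map_add_apply (t t' : ℝ≥0) (u : H) : M (t + t') u = M t (M t' u) := by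
  rw [hM.map_add]; rfl

theorem continuous_toNNReal (u : H) : Continuous fun t : ℝ => M t.toNNReal u :=
  (hM.continuous_orbit u).comp continuous_real_toNNReal

theorem generatorApply_orbit {u g : H} (hu : GeneratorApply M u g) (t : ℝ≥0) :
    GeneratorApply M (M t u) (M t g) := by
  refine (((M t).continuous.tendsto g).comp hu).congr fun h => ?_
  have : M h (M t u) = M t (M h u) := by
    rw [← hM.map_add_apply, ← hM.map_add_apply, add_comm]
  rw [Function.comp_apply, (M t).map_smul_of_tower, map_sub, this]

theorem hasDerivWithinAt_orbit {u g : H} (hu : GeneratorApply M u g) {t : ℝ} (ht : 0 ≤ t) :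
    HasDerivWithinAt (fun t : ℝ => M t.toNNReal u) (M t.toNNReal g) (Set.Ici t) t := by
  rw [hasDerivWithinAt_Ici_iff]
  refine (hM.generatorApply_orbit hu t.toNNReal).congr fun h => ?_
  rw [Real.toNNReal_add ht h.coe_nonneg, Real.toNNReal_coe, add_comm, hM.map_add_apply]

theorem tendsto_average (u : H) (a : ℝ) :
    Tendsto (fun h : ℝ≥0 => ((h : ℝ)⁻¹ : ℝ) • ∫ τ in a..(a + h), M τ.toNNReal u) (𝓝[>] 0)
      (𝓝 (M a.toNNReal u)) := by
  have h1 := (intervalIntegral.integral_hasDerivAt_right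
    ((hM.continuous_toNNReal u).intervalIntegrable a a)
    (hM.continuous_toNNReal u).stronglyMeasurable.stronglyMeasurableAtFilter
    (hM.continuous_toNNReal u).continuousAt).hasDerivWithinAt (s := Set.Ici a)
  rw [hasDerivWithinAt_Ici_iff] at h1
  simpa using h1

/-- Applying `M h` shifts the window of integration by `h`; in the difference only the two end
pieces of length `h` remain, and their averages converge. -/
theorem generatorApply_average (u : H) (a : ℝ) (ha : 0 ≤ a) :
    GeneratorApply M (∫ τ in (0 : ℝ)..a, M τ.toNNReal u) (M a.toNNReal u - u) := by
  have h1 := (hM.tendsto_average u a).sub (hM.tendsto_average u 0)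
  simp only [Real.toNNReal_zero, hM.map_zero, ContinuousLinearMap.id_apply, zero_add] at h1
  refine h1.congr fun h => ?_
  have hi (x y : ℝ) := (hM.continuous_toNNReal u).intervalIntegrable (μ := volume) x y
  have h2 : M h (∫ τ in (0 : ℝ)..a, M τ.toNNReal u) = ∫ τ in (h : ℝ)..(a + h), M τ.toNNReal u := by
    rw [← ContinuousLinearMap.intervalIntegral_comp_comm _ (hi 0 a)]
    have h3 := intervalIntegral.integral_comp_add_right (fun τ => M τ.toNNReal u)
      (a := 0) (b := a) h
    rw [zero_add] at h3
    rw [← h3]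
    refine intervalIntegral.integral_congr fun τ hτ => ?_
    rw [Set.uIcc_of_le ha] at hτ
    rw [Real.toNNReal_add hτ.1 h.coe_nonneg, Real.toNNReal_coe, add_comm, hM.map_add_apply]
  rw [h2, ← smul_sub]
  congr 1
  have e1 := intervalIntegral.integral_add_adjacent_intervals (hi 0 h) (hi h (a + h))
  have e2 := intervalIntegral.integral_add_adjacent_intervals (hi 0 a) (hi a (a + h))
  rw [← e1] at e2
  rw [sub_eq_sub_iff_add_eq_add, add_comm _ (∫ τ in (0 : ℝ)..a, M τ.toNNReal u), e2, add_comm]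

/-- Short time averages of an orbit lie in the domain and converge to its starting point. -/
theorem dense_generator_domain : Dense {u : H | ∃ g, GeneratorApply M u g} := by
  intro u
  have h1 := hM.tendsto_average u 0
  simp only [Real.toNNReal_zero, hM.map_zero, ContinuousLinearMap.id_apply, zero_add] at h1
  refine mem_closure_of_tendsto h1 (Eventually.of_forall fun h => ?_)
  refine ⟨((h : ℝ)⁻¹ : ℝ) • (M (h : ℝ).toNNReal u - u), ?_⟩
  refine ((hM.generatorApply_average u h h.2).const_smul ((h : ℝ)⁻¹ : ℝ)).congr fun k => ?_
  rw [(M k).map_smul_of_tower, ← smul_sub, smul_comm]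

/-- The generator can be identified by testing orbits against a separating family of
functionals. -/
theorem generatorApply_of_functionals {u g : H} {𝓛 : Set (H →L[ℂ] ℂ)}
    (hsep : ∀ f : H, (∀ ℓ ∈ 𝓛, ℓ f = 0) → f = 0)
    (hder : ∀ ℓ ∈ 𝓛, ∀ t : ℝ, 0 ≤ t →
      HasDerivWithinAt (fun t : ℝ => ℓ (M t.toNNReal u)) (ℓ (M t.toNNReal g)) (Set.Ici t) t) :
    GeneratorApply M u g := by
  -- The scalar fundamental theorem of calculus, tested on separating functionals, gives an identity
  -- between vectors; strong continuity of the integrand then upgrades weak differentiability to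
  -- strong.
  have key (h : ℝ≥0) : M h u - u = ∫ τ in (0 : ℝ)..h, M τ.toNNReal g := by
    refine sub_eq_zero.1 (hsep _ fun ℓ hℓ => ?_)
    have hi := (hM.continuous_toNNReal g).intervalIntegrable (μ := volume) 0 h
    have hc := ℓ.continuous.comp (hM.continuous_toNNReal g)
    have h1 := intervalIntegral.integral_eq_sub_of_hasDeriv_right (a := 0) (b := h)
      (f := fun t : ℝ => ℓ (M t.toNNReal u))
      (ℓ.continuous.comp (hM.continuous_toNNReal u)).continuousOn
      (fun t ht => (hder ℓ hℓ t (by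
        rw [min_eq_left h.coe_nonneg] at ht; exact ht.1.le)).mono Set.Ioi_subset_Ici_self)
      (hc.intervalIntegrable 0 h)
    rw [map_sub, ← ContinuousLinearMap.intervalIntegral_comp_comm _ hi, h1]
    simp [hM.map_zero]
  have h1 := hM.tendsto_average g 0
  simp only [Real.toNNReal_zero, hM.map_zero, ContinuousLinearMap.id_apply, zero_add] at h1
  exact h1.congr fun h => by rw [key]

/-- The generator of a quasi-contractive semigroup is quasi-dissipative. -/
theorem re_inner_generator_le {ω : ℝ} (hnorm : ∀ (t : ℝ≥0) u, ‖M t u‖ ≤ Real.exp (ω * t) * ‖u‖)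
    {u g : H} (hu : GeneratorApply M u g) : (inner ℂ u g).re ≤ ω * ‖u‖ ^ 2 := by
  have h1 : Tendsto (fun h : ℝ≥0 => (inner ℂ u (((h : ℝ)⁻¹ : ℝ) • (M h u - u))).re) (𝓝[>] 0)
      (𝓝 (inner ℂ u g).re) :=
    (Complex.continuous_re.tendsto _).comp ((tendsto_const_nhds (x := u)).inner hu)
  have h2 : Tendsto (fun h : ℝ≥0 => ((h : ℝ)⁻¹ * (Real.exp (ω * h) - 1)) * ‖u‖ ^ 2) (𝓝[>] 0)
      (𝓝 (ω * ‖u‖ ^ 2)) := by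
    have hd : HasDerivAt (fun h : ℝ => Real.exp (ω * h)) ω 0 := by
      simpa using ((hasDerivAt_id (0 : ℝ)).const_mul ω).exp
    have := hasDerivWithinAt_Ici_iff.1 (hd.hasDerivWithinAt (s := Set.Ici 0))
    simp only [zero_add, mul_zero, Real.exp_zero, smul_eq_mul] at this
    exact this.mul_const _
  refine le_of_tendsto_of_tendsto' h1 h2 fun h => ?_
  have h3 : inner ℂ u (((h : ℝ)⁻¹ : ℝ) • (M h u - u)) =
      ((h : ℝ)⁻¹ : ℝ) * (inner ℂ u (M h u) - inner ℂ u u) := by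
    rw [← inner_sub_right, ← Complex.coe_smul, inner_smul_right]
  rw [h3, Complex.re_ofReal_mul, mul_assoc]
  refine mul_le_mul_of_nonneg_left ?_ (by positivity)
  rw [Complex.sub_re, sub_mul, one_mul]
  have h4 : (inner ℂ u u).re = ‖u‖ ^ 2 := inner_self_eq_norm_sq (𝕜 := ℂ) u
  rw [h4]
  have h5 : (inner ℂ u (M h u)).re ≤ ‖u‖ * ‖M h u‖ := re_inner_le_norm (𝕜 := ℂ) u (M h u)
  have h6 := mul_le_mul_of_nonneg_left (hnorm h u) (norm_nonneg u)
  nlinarith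

/-- A quasi-contractive semigroup is determined by its generator. -/
theorem eq_of_generator {ω : ℝ} (hnorm : ∀ (t : ℝ≥0) u, ‖M t u‖ ≤ Real.exp (ω * t) * ‖u‖)
    {M' : ℝ≥0 → H →L[ℂ] H} (hM' : IsC0Semigroup M')
    (hgen : ∀ u g, GeneratorApply M u g ↔ GeneratorApply M' u g) : M' = M := by
  funext T
  refine ContinuousLinearMap.coeFn_injective (Continuous.ext_on hM.dense_generator_domain
    (M' T).continuous (M T).continuous ?_)
  rintro u ⟨g, hu⟩
  have hu' := (hgen u g).1 hu
  set z : ℝ → H := fun t => M t.toNNReal u - M' t.toNNReal u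
  have hz (t : ℝ) (ht : 0 ≤ t) :
      HasDerivWithinAt z (M t.toNNReal g - M' t.toNNReal g) (Set.Ici t) t :=
    (hM.hasDerivWithinAt_orbit hu ht).sub (hM'.hasDerivWithinAt_orbit hu' ht)
  -- Equality of the generators puts the orbit of `M'` in the domain for `M`, so dissipativity of
  -- `M` alone controls the difference of the two orbits. No growth bound on `M'` is required.
  have hzg (t : ℝ) : GeneratorApply M (z t) (M t.toNNReal g - M' t.toNNReal g) := by
    have h1 := hM.generatorApply_orbit hu t.toNNReal
    have h2 := (hgen _ _).2 (hM'.generatorApply_orbit hu' t.toNNReal)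
    refine (h1.sub h2).congr fun h => ?_
    rw [← smul_sub, map_sub]
    congr 1
    simp only [z]
    abel
  have hzc : Continuous z := (hM.continuous_toNNReal u).sub (hM'.continuous_toNNReal u)
  letI : InnerProductSpace ℝ H := InnerProductSpace.rclikeToReal ℂ H
  have hf (t : ℝ) (ht : 0 ≤ t) : HasDerivWithinAt (fun t => ‖z t‖ ^ 2)
      (2 * (inner ℂ (z t) (M t.toNNReal g - M' t.toNNReal g)).re) (Set.Ici t) t :=
    (hz t ht).norm_sq
  -- Gronwall with zero initial value and derivative at most `2ω ‖z‖ ^ 2` forces `z = 0`, whatever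
  -- the sign of `ω`.
  have hgr := le_gronwallBound_of_liminf_deriv_right_le (f := fun t => ‖z t‖ ^ 2)
    (δ := 0) (K := 2 * ω) (ε := 0) (a := 0) (b := T)
    (hzc.norm.pow 2).continuousOn
    (fun t ht r hr => ((hf t ht.1).liminf_right_slope_le hr)) (by simp [z, hM.map_zero, hM'.map_zero])
    (fun t ht => by
      have := hM.re_inner_generator_le hnorm (hzg t)
      linarith) T ⟨T.2, le_rfl⟩
  simp only [gronwallBound_ε0_δ0] at hgr
  have h0 : z T = 0 := by
    have : ‖z T‖ ^ 2 = 0 := le_antisymm hgr (by positivity)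
    simpa using this
  simp only [z, Real.toNNReal_coe] at h0
  exact (sub_eq_zero.1 h0).symm

end IsC0Semigroup

end Semigroup

end

section

variable {E : Type*} [NormedAddCommGroup E] [InnerProductSpace ℝ E] [FiniteDimensional ℝ E]
  [MeasurableSpace E] [BorelSpace E]

/-! ### Bounded families of functionals and density -/

/-- A bounded family of functionals that converges on a dense set converges everywhere. -/
theorem tendsto_apply_of_denseRange {ι α F : Type*} [NormedAddCommGroup F] [NormedSpace ℂ F]
    {l : Filter ι} {e : α → F} (he : DenseRange e) {φ : ι → F →L[ℂ] ℂ} {φ₀ : F →L[ℂ] ℂ} {C : ℝ}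
    (hC : ∀ᶠ i in l, ‖φ i‖ ≤ C)
    (h : ∀ a, Tendsto (fun i => φ i (e a)) l (𝓝 (φ₀ (e a)))) (x : F) :
    Tendsto (fun i => φ i x) l (𝓝 (φ₀ x)) := by
  rw [Metric.tendsto_nhds]
  intro ε hε
  set D := |C| + ‖φ₀‖ + 1
  have hD : 0 < D := by positivity
  obtain ⟨a, ha⟩ := he.exists_dist_lt x (ε := ε / (2 * D)) (by positivity)
  filter_upwards [hC, Metric.tendsto_nhds.1 (h a) (ε / 2) (by positivity)] with i hi hia
  rw [dist_eq_norm] at hia ha ⊢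
  have h1 : φ i x - φ₀ x = φ i (x - e a) + (φ i (e a) - φ₀ (e a)) - φ₀ (x - e a) := by
    simp only [map_sub]; ring
  have h2 : ‖φ i (x - e a)‖ ≤ |C| * ‖x - e a‖ :=
    ((φ i).le_opNorm _).trans (by gcongr; exact hi.trans (le_abs_self C))
  have h3 : ‖φ₀ (x - e a)‖ ≤ ‖φ₀‖ * ‖x - e a‖ := φ₀.le_opNorm _
  have h4 : D * ‖x - e a‖ < ε / 2 := by
    calc _ < D * (ε / (2 * D)) := by gcongr
      _ = ε / 2 := by field_simp
  rw [h1]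
  calc _ ≤ ‖φ i (x - e a)‖ + ‖φ i (e a) - φ₀ (e a)‖ + ‖φ₀ (x - e a)‖ :=
        (norm_sub_le _ _).trans (by gcongr; exact norm_add_le _ _)
    _ ≤ |C| * ‖x - e a‖ + ‖φ i (e a) - φ₀ (e a)‖ + ‖φ₀‖ * ‖x - e a‖ := by gcongr
    _ = (D * ‖x - e a‖ - ‖x - e a‖) + ‖φ i (e a) - φ₀ (e a)‖ := by simp only [D]; ring
    _ < ε := by linarith [norm_nonneg (x - e a)]

variable (E) in
theorem denseRange_toLp_two : DenseRange (fun ψ : 𝓢(E, ℂ) => (ψ.toLp 2 : LTwo E)) :=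
  SchwartzMap.denseRange_toLpCLM (E := E) (F := ℂ) (p := 2) ENNReal.ofNat_ne_top

theorem pair_real_smul (c : ℝ) (g f : LTwo E) : pair E g (c • f) = c • pair E g f := by
  have h : c • f = (c : ℂ) • f := by
    refine Lp.ext ?_
    filter_upwards [Lp.coeFn_smul c f, Lp.coeFn_smul (c : ℂ) f] with η h1 h2
    rw [h1, h2, Pi.smul_apply, Pi.smul_apply, Complex.real_smul, smul_eq_mul]
  rw [h, map_smul, Complex.real_smul, smul_eq_mul]

theorem generatorApply_lTwo_iff {M : ℝ≥0 → LTwo E →L[ℂ] LTwo E} {w G : LTwo E} :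
    GeneratorApply M w G ↔
      Tendsto (fun h : ℝ≥0 => ((h : ℝ)⁻¹ : ℝ) • (M h w - w)) (𝓝[>] 0) (𝓝 G) := by
  rw [GeneratorApply]
  refine iff_of_eq (congrArg (fun f => Tendsto f _ _) (funext fun h => ?_))
  rw [← Complex.coe_smul]
  refine Lp.ext ?_
  filter_upwards [Lp.coeFn_smul ((h : ℝ)⁻¹ : ℝ) (M h w - w),
    Lp.coeFn_smul (((h : ℝ)⁻¹ : ℝ) : ℂ) (M h w - w)] with η h1 h2
  rw [h1, h2, Pi.smul_apply, Pi.smul_apply, Complex.real_smul, smul_eq_mul]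

theorem inner_eq_pair (g f : LTwo E) : inner ℂ g f = pair E (star g) f := by
  rw [L2.inner_def, pair_apply]
  refine integral_congr_ae ?_
  filter_upwards [Lp.coeFn_star g] with η h
  rw [h, Pi.star_apply, RCLike.inner_apply, mul_comm]
  rfl

theorem norm_pair_le (g f : LTwo E) : ‖pair E g f‖ ≤ ‖g‖ * ‖f‖ := by
  have h1 : ‖star g‖ = ‖g‖ := by
    have h : ∀ᵐ η, ‖(star g : LTwo E) η‖ = ‖g η‖ := by
      filter_upwards [Lp.coeFn_star g] with η h
      rw [h, Pi.star_apply, norm_star]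
    exact le_antisymm (Lp.norm_le_norm_of_ae_le (h.mono fun _ h => h.le))
      (Lp.norm_le_norm_of_ae_le (h.mono fun _ h => h.ge))
  have h2 := inner_eq_pair (star g) f
  rw [star_star] at h2
  rw [← h2, ← h1]
  exact norm_inner_le_norm _ _

/-! ### Strong continuity and weak generator of the evolution -/

variable {X : E →L[ℝ] E} {σ : E → ℝ} (hσ : Continuous σ) (hσ0 : ∀ η, 0 ≤ σ η)
  (hσg : ∃ C : ℝ, ∃ k : ℕ, ∀ η, σ η ≤ C * (1 + ‖η‖) ^ k)

theorem eventually_le_one : ∀ᶠ h : ℝ≥0 in 𝓝[>] 0, 0 < h ∧ h ≤ 1 := by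
  have : ∀ᶠ h : ℝ≥0 in 𝓝[>] 0, h < 1 :=
    (eventually_lt_nhds zero_lt_one).filter_mono nhdsWithin_le_nhds
  filter_upwards [self_mem_nhdsWithin, this] with h h0 h1
  exact ⟨h0, h1.le⟩

include hσg in
theorem isC0Semigroup_evolve : IsC0Semigroup (evolve X hσ hσ0) := by
  refine isC0Semigroup_of_weak (evolve_zero hσ hσ0) (evolve_add hσ hσ0) (ω := tr X / 2)
    (norm_evolve_le hσ hσ0) fun g u => ?_
  have key : Tendsto (fun h : ℝ≥0 => (pair E).flip (evolve X hσ hσ0 h u) (star g)) (𝓝[>] 0)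
      (𝓝 ((pair E).flip u (star g))) := by
    refine tendsto_apply_of_denseRange (denseRange_toLp_two E)
      (C := ‖(pair E).flip‖ * (Real.exp |tr X / 2| * ‖u‖)) ?_ (fun ψ => ?_) (star g)
    · filter_upwards [eventually_le_one] with h hh
      refine ((pair E).flip.le_opNorm _).trans ?_
      gcongr
      refine (norm_evolve_le hσ hσ0 h u).trans ?_
      gcongr
      have h1 : (h : ℝ) ≤ 1 := by exact_mod_cast hh.2
      calc tr X / 2 * h ≤ |tr X / 2| * h := by gcongr; exact le_abs_self _
        _ ≤ _ := mul_le_of_le_one_right (abs_nonneg _) h1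
    · simp only [ContinuousLinearMap.flip_apply]
      have h1 := tendsto_pair_evolve (X := X) hσ hσ0 hσg ψ u
      have h2 : Tendsto (fun h : ℝ≥0 => (h : ℝ)) (𝓝[>] 0) (𝓝 0) :=
        tendsto_coe_nhdsGT_zero.mono_right nhdsWithin_le_nhds
      -- On Schwartz tests the difference quotient converges, so the increment, which is `h` times
      -- it, tends to `0`.
      have h3 := (h2.smul h1).add_const (pair E (ψ.toLp 2) u)
      rw [zero_smul, zero_add] at h3
      refine h3.congr' ?_
      filter_upwards [self_mem_nhdsWithin] with h hh
      have : (h : ℝ) ≠ 0 := (NNReal.coe_pos.2 hh).ne'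
      rw [smul_smul, mul_inv_cancel₀ this, one_smul, map_sub, sub_add_cancel]
  simpa only [inner_eq_pair, ContinuousLinearMap.flip_apply] using key

/-- `G` is the weak generator of the evolution at `w`, tested against Schwartz functions. -/
def WeakGenerator (X : E →L[ℝ] E) (σ : E → ℝ) (w G : LTwo E) : Prop :=
  ∀ ψ : 𝓢(E, ℂ), pair E (ψ.toLp 2) G = ∫ η, transposeGen X σ ψ η * w η

include hσg in
theorem weakGenerator_of_generatorApply {w G : LTwo E}
    (h : GeneratorApply (evolve X hσ hσ0) w G) : WeakGenerator X σ w G := by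
  intro ψ
  have h1 := ((pair E (ψ.toLp 2)).continuous.tendsto G).comp (generatorApply_lTwo_iff.1 h)
  refine tendsto_nhds_unique ?_ (tendsto_pair_evolve (X := X) hσ hσ0 hσg ψ w)
  refine h1.congr fun h => ?_
  rw [Function.comp_apply, pair_real_smul]

/-! ### Multiplication operators and cutoffs -/

/-- Multiplication by a bounded continuous real function on `L²`. -/
def mulOp (m : E → ℝ) (hm : Continuous m) (C : ℝ) (hC : ∀ η, |m η| ≤ C) : LTwo E →L[ℂ] LTwo E :=
  weightedComp 1 (by
    have h1 : (1 : E →L[ℝ] E).det = 1 := LinearMap.det_id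
    rw [h1]; exact one_ne_zero) m hm C hC

section mulOp

variable {m : E → ℝ} {hm : Continuous m} {C : ℝ} {hC : ∀ η, |m η| ≤ C}

theorem coeFn_mulOp (f : LTwo E) : mulOp m hm C hC f =ᵐ[volume] fun η => (m η : ℂ) * f η :=
  coeFn_weightedComp f

theorem norm_mulOp_le (f : LTwo E) : ‖mulOp m hm C hC f‖ ≤ C * ‖f‖ := by
  refine (norm_weightedComp_le f).trans_eq ?_
  have h1 : (1 : E →L[ℝ] E).det = 1 := LinearMap.det_id
  rw [h1, abs_one, Real.one_rpow, mul_one]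

theorem pair_mulOp (g f : LTwo E) : pair E g (mulOp m hm C hC f) = pair E (mulOp m hm C hC g) f := by
  rw [pair_apply, pair_apply]
  refine integral_congr_ae ?_
  filter_upwards [coeFn_mulOp (hm := hm) (hC := hC) g, coeFn_mulOp (hm := hm) (hC := hC) f]
    with η h1 h2
  rw [h1, h2]; ring

end mulOp

theorem exists_cutoff (E : Type*) [NormedAddCommGroup E] [InnerProductSpace ℝ E]
    [FiniteDimensional ℝ E] {R : ℝ} (hR : 0 < R) :
    ∃ χ : E → ℝ, ContDiff ℝ (⊤ : ℕ∞) χ ∧ HasCompactSupport χ ∧ (∀ η, 0 ≤ χ η) ∧ (∀ η, χ η ≤ 1) ∧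
      (∀ η, ‖η‖ ≤ R → χ η = 1) ∧ ∀ η, R + 1 ≤ ‖η‖ → χ η = 0 := by
  let f : ContDiffBump (0 : E) := ⟨R, R + 1, hR, by linarith⟩
  refine ⟨f, f.contDiff, f.hasCompactSupport, fun η => f.nonneg, fun η => f.le_one,
    fun η h => f.one_of_mem_closedBall (by simpa using h),
    fun η h => f.zero_of_le_dist (by simpa using h)⟩

theorem HasCompactSupport.hasTemperateGrowth_ofReal {χ : E → ℝ} (h1 : HasCompactSupport χ)
    (h2 : ContDiff ℝ (⊤ : ℕ∞) χ) : Function.HasTemperateGrowth (fun η => (χ η : ℂ)) := by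
  have hg₁ : HasCompactSupport (Complex.ofRealCLM ∘ χ) := h1.comp_left rfl
  have hg₂ : ContDiff ℝ (⊤ : ℕ∞) (Complex.ofRealCLM ∘ χ) := by fun_prop
  exact (hg₁.toSchwartzMap hg₂).hasTemperateGrowth

theorem mulOp_toLp {χ : E → ℝ} {hm : Continuous χ} {C : ℝ} {hC : ∀ η, |χ η| ≤ C}
    (hg : Function.HasTemperateGrowth (fun η => (χ η : ℂ))) (ψ : 𝓢(E, ℂ)) :
    mulOp χ hm C hC (ψ.toLp 2) = (SchwartzMap.smulLeftCLM ℂ (fun η => (χ η : ℂ)) ψ).toLp 2 := by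
  refine Lp.ext ?_
  filter_upwards [coeFn_mulOp (hm := hm) (hC := hC) (ψ.toLp 2), ψ.coeFn_toLp 2 volume,
    (SchwartzMap.smulLeftCLM ℂ (fun η => (χ η : ℂ)) ψ).coeFn_toLp 2 volume] with η h1 h2 h3
  rw [h1, h2, h3, SchwartzMap.smulLeftCLM_apply_apply hg, smul_eq_mul]

theorem eq_zero_of_pair_eq_zero {f : LTwo E}
    (h : ∀ (ψ : 𝓢(E, ℂ)) (R : ℝ), (∀ η, R ≤ ‖η‖ → ψ η = 0) → pair E (ψ.toLp 2) f = 0) : f = 0 := by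
  rw [Lp.eq_zero_iff_ae_eq_zero]
  refine ae_eq_zero_of_integral_contDiff_smul_eq_zero
    ((Lp.memLp f).locallyIntegrable (by norm_num)) fun g g_smooth g_cpt => ?_
  have hg₁ : HasCompactSupport (Complex.ofRealCLM ∘ g) := g_cpt.comp_left rfl
  have hg₂ : ContDiff ℝ (⊤ : ℕ∞) (Complex.ofRealCLM ∘ g) := by fun_prop
  obtain ⟨R, hR⟩ := hg₁.isCompact.isBounded.subset_ball 0
  have := h (hg₁.toSchwartzMap hg₂) R fun η hη => by
    have : η ∉ tsupport (Complex.ofRealCLM ∘ g) := fun hmem => by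
      have := hR hmem
      rw [mem_ball_zero_iff] at this
      linarith
    exact image_eq_zero_of_notMem_tsupport this
  rw [pair_toLp] at this
  rw [← this]
  refine integral_congr_ae (Eventually.of_forall fun η => ?_)
  exact (Complex.real_smul (x := g η) (z := f η))

end

section

variable {E : Type*} [NormedAddCommGroup E] [InnerProductSpace ℝ E] [FiniteDimensional ℝ E]
  [MeasurableSpace E] [BorelSpace E]

/-! ### The weak generator is the generator -/

/-- A Schwartz function composed with the flow at time `-t`. -/
def flowComp (X : E →L[ℝ] E) (t : ℝ) : 𝓢(E, ℂ) →L[ℂ] 𝓢(E, ℂ) :=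
  SchwartzMap.compCLMOfContinuousLinearEquiv ℂ
    (ContinuousLinearEquiv.equivOfInverse (flow X (-t)) (flow X t)
      (fun η => flow_flow_neg X t η) (fun η => flow_neg_flow X t η))

theorem flowComp_apply (X : E →L[ℝ] E) (t : ℝ) (ψ : 𝓢(E, ℂ)) (η : E) :
    flowComp X t ψ η = ψ (flow X (-t) η) := rfl

variable {X : E →L[ℝ] E} {σ : E → ℝ} (hσ : Continuous σ) (hσ0 : ∀ η, 0 ≤ σ η)
  (hσg : ∃ C : ℝ, ∃ k : ℕ, ∀ η, σ η ≤ C * (1 + ‖η‖) ^ k)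

/-- The evolution by transport alone. -/
def transportEvolve (X : E →L[ℝ] E) : ℝ≥0 → LTwo E →L[ℂ] LTwo E :=
  evolve X (σ := fun _ => 0) continuous_const (fun _ => le_rfl)

theorem isC0Semigroup_transportEvolve : IsC0Semigroup (transportEvolve X) :=
  isC0Semigroup_evolve _ _ ⟨0, 0, by simp⟩

theorem coeFn_transportEvolve (t : ℝ≥0) (f : LTwo E) :
    transportEvolve X t f =ᵐ[volume] fun η => (Real.exp (t * tr X) : ℂ) * f (flow X t η) := by
  filter_upwards [coeFn_evolve (X := X) (σ := fun _ => 0) continuous_const (fun _ => le_rfl) t f]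
    with η h
  rw [transportEvolve, h]
  simp [weight, accum]

/-- Without damping, the transposed evolution is composition with a linear isomorphism and stays
within Schwartz functions. This is why transport is treated separately from `σ`. -/
theorem toLp_flowComp (t : ℝ≥0) (ψ : 𝓢(E, ℂ)) :
    ((flowComp X t ψ).toLp 2 : LTwo E) =
      (Real.exp (t * tr X) : ℂ) • transportEvolve (-X) t (ψ.toLp 2) := by
  refine Lp.ext ?_
  filter_upwards [(flowComp X t ψ).coeFn_toLp 2 volume,
    coeFn_transportEvolve (X := -X) t (ψ.toLp 2),
    Lp.coeFn_smul (Real.exp (t * tr X) : ℂ) (transportEvolve (-X) t (ψ.toLp 2)),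
    (quasiMeasurePreserving_of_det_ne_zero (det_flow_ne_zero (X := -X) t)).ae_eq_comp
      (ψ.coeFn_toLp 2 volume)] with η h1 h2 h3 h4
  simp only [Function.comp_apply] at h4
  rw [h1, h3, Pi.smul_apply, h2, h4, flowComp_apply, flow_neg_field, tr_neg, mul_neg, Real.exp_neg,
    smul_eq_mul]
  have : (Real.exp (t * tr X) : ℂ) ≠ 0 := by exact_mod_cast (Real.exp_pos (t * tr X)).ne'
  push_cast at this ⊢
  field_simp

theorem norm_toLp_flowComp_le (t : ℝ≥0) (ht : t ≤ 1) (ψ : 𝓢(E, ℂ)) :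
    ‖((flowComp X t ψ).toLp 2 : LTwo E)‖ ≤ Real.exp |tr X| * ‖(ψ.toLp 2 : LTwo E)‖ := by
  rw [toLp_flowComp, norm_smul, Complex.norm_real, Real.norm_of_nonneg (Real.exp_pos _).le]
  have h1 := norm_evolve_le (X := -X) (σ := fun _ => 0) continuous_const (fun _ => le_rfl) t
    (ψ.toLp 2)
  rw [tr_neg] at h1
  have ht' : (t : ℝ) ≤ 1 := by exact_mod_cast ht
  calc _ ≤ Real.exp (t * tr X) * (Real.exp (-tr X / 2 * t) * ‖(ψ.toLp 2 : LTwo E)‖) := by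
        gcongr; exact h1
    _ = Real.exp (t * (tr X / 2)) * ‖(ψ.toLp 2 : LTwo E)‖ := by
        rw [← mul_assoc, ← Real.exp_add]; congr 2; ring
    _ ≤ _ := by
        gcongr
        have h2 : tr X / 2 ≤ |tr X| := by
          have := le_abs_self (tr X); have := abs_nonneg (tr X); linarith
        calc (t : ℝ) * (tr X / 2) ≤ t * |tr X| := by gcongr
          _ ≤ _ := mul_le_of_le_one_left (abs_nonneg _) ht'

include hσg in
theorem pair_evolve_add_sub (t h : ℝ≥0) (g w : LTwo E) :
    pair E g (evolve X hσ hσ0 (t + h) w) - pair E g (evolve X hσ hσ0 t w) =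
      pair E ((Real.exp (t * tr X) : ℂ) • evolve (-X) hσ hσ0 t g) (evolve X hσ hσ0 h w - w) := by
  have hM := isC0Semigroup_evolve (X := X) hσ hσ0 hσg
  rw [hM.map_add_apply, ← map_sub, ← map_sub, pair_evolve, map_smul]
  rfl

include hσ hσ0 hσg in
theorem integrable_transposeGen_mul (ψ : 𝓢(E, ℂ)) (w : LTwo E) :
    Integrable (fun η => transposeGen X σ ψ η * w η) volume := by
  obtain ⟨C, hC0, hC⟩ := exists_transposeGen_decay hσ0 hσg X ψ (Module.finrank ℝ E + 1)
  have hm : MemLp (transposeGen X σ ψ) 2 volume :=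
    ((memLp_two_inv_one_add_norm_pow E).const_mul C).mono'
      (continuous_transposeGen hσ ψ).aestronglyMeasurable (Eventually.of_forall hC)
  exact hm.integrable_mul (Lp.memLp w)

include hσ in
theorem exists_bound_on_ball (R : ℝ) : ∃ S : ℝ≥0, ∀ η, ‖η‖ ≤ R → σ η ≤ S := by
  obtain ⟨S, hS⟩ := (isCompact_closedBall (0 : E) R).exists_bound_of_continuousOn hσ.continuousOn
  refine ⟨S.toNNReal, fun η hη => ?_⟩
  exact (le_abs_self _).trans ((hS η (by simpa using hη)).trans (Real.le_coe_toNNReal S))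

/-- Multiplication by `min σ S` on `L²`. -/
def truncMul (S : ℝ≥0) : LTwo E →L[ℂ] LTwo E :=
  mulOp (fun η => min (σ η) S) (hσ.min continuous_const) S
    (fun η => by rw [abs_of_nonneg (le_min (hσ0 η) S.coe_nonneg)]; exact min_le_right _ _)

theorem coeFn_truncMul (S : ℝ≥0) (f : LTwo E) :
    truncMul hσ hσ0 S f =ᵐ[volume] fun η => ((min (σ η) S : ℝ) : ℂ) * f η :=
  coeFn_mulOp f

theorem norm_truncMul_le (S : ℝ≥0) (f : LTwo E) : ‖truncMul hσ hσ0 S f‖ ≤ S * ‖f‖ :=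
  norm_mulOp_le f

theorem integrable_mul_lTwo (f g : LTwo E) : Integrable (fun η => f η * g η) volume :=
  (Lp.memLp f).integrable_mul (Lp.memLp g)

/-- The `σ` term is moved to the right-hand side, where truncation at `S` changes nothing on the
support of `ψ`. The right-hand side becomes continuous in `ψ` for the `L²` norm, although the
left-hand side contains a derivative of `ψ`. -/
theorem integral_transposeGen_zero {w G : LTwo E} (hw : WeakGenerator X σ w G) {ψ : 𝓢(E, ℂ)}
    {S : ℝ≥0} (hS : ∀ η, ψ η ≠ 0 → σ η ≤ S) (hint : Integrable (fun η => transposeGen X σ ψ η * w η)) :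
    ∫ η, transposeGen X (fun _ => 0) ψ η * w η =
      pair E (ψ.toLp 2) G + (1 / 2 : ℂ) * pair E (truncMul hσ hσ0 S (ψ.toLp 2)) w := by
  rw [hw ψ, pair_apply, ← integral_const_mul, ← integral_add hint
    ((integrable_mul_lTwo _ _).const_mul _)]
  refine integral_congr_ae ?_
  filter_upwards [coeFn_truncMul hσ hσ0 S (ψ.toLp 2), ψ.coeFn_toLp 2 volume] with η h3 h4
  rw [h3, h4, transposeGen, transposeGen]
  by_cases h5 : ψ η = 0
  · rw [h5]; simp
  · rw [min_eq_left (hS η h5)]; push_cast; ring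

include hσ hσ0 hσg in
theorem hasDerivWithinAt_pair_transportEvolve {w G : LTwo E} (hw : WeakGenerator X σ w G)
    (ψ : 𝓢(E, ℂ)) {t : ℝ} (ht : 0 ≤ t) {S : ℝ≥0}
    (hS : ∀ η, flowComp X t ψ η ≠ 0 → σ η ≤ S) :
    HasDerivWithinAt (fun s : ℝ => pair E (ψ.toLp 2) (transportEvolve X s.toNNReal w))
      (pair E ((flowComp X t ψ).toLp 2) G + (1 / 2 : ℂ) *
        pair E (truncMul hσ hσ0 S ((flowComp X t ψ).toLp 2)) w) (Set.Ici t) t := by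
  lift t to ℝ≥0 using ht
  rw [hasDerivWithinAt_Ici_iff]
  have h1 := tendsto_pair_evolve (X := X) (σ := fun _ => 0) continuous_const (fun _ => le_rfl)
    ⟨0, 0, by simp⟩ (flowComp X t ψ) w
  rw [integral_transposeGen_zero hσ hσ0 hw hS
    (integrable_transposeGen_mul hσ hσ0 hσg _ _)] at h1
  refine h1.congr fun h => ?_
  rw [Real.toNNReal_add t.coe_nonneg h.coe_nonneg, Real.toNNReal_coe, Real.toNNReal_coe,
    toLp_flowComp, transportEvolve, transportEvolve,
    pair_evolve_add_sub _ _ ⟨0, 0, by simp⟩]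

theorem norm_pair_add_pair_truncMul_le (S : ℝ≥0) (φ w G : LTwo E) :
    ‖pair E φ G + (1 / 2 : ℂ) * pair E (truncMul hσ hσ0 S φ) w‖ ≤
      (‖G‖ + S * ‖w‖) * ‖φ‖ := by
  have h1 : ‖(1 / 2 : ℂ)‖ ≤ 1 := by norm_num
  have h2 := norm_pair_le φ G
  have h3 := norm_pair_le (truncMul hσ hσ0 S φ) w
  have h4 : ‖truncMul hσ hσ0 S φ‖ * ‖w‖ ≤ (S * ‖φ‖) * ‖w‖ :=
    mul_le_mul_of_nonneg_right (norm_truncMul_le hσ hσ0 S φ) (norm_nonneg _)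
  have h5 := norm_add_le (pair E φ G) ((1 / 2 : ℂ) * pair E (truncMul hσ hσ0 S φ) w)
  have h6 : ‖(1 / 2 : ℂ) * pair E (truncMul hσ hσ0 S φ) w‖ ≤ ‖pair E (truncMul hσ hσ0 S φ) w‖ := by
    rw [norm_mul]
    exact mul_le_of_le_one_left (norm_nonneg _) h1
  linarith

theorem le_of_flowComp_ne_zero {K R S : ℝ} (hK0 : 0 ≤ K)
    (hK : ∀ t ∈ Set.Icc (-1 : ℝ) 1, ∀ η, ‖flow X t η‖ ≤ K * ‖η‖)
    (hS : ∀ η, ‖η‖ ≤ K * R → σ η ≤ S) {ψ : 𝓢(E, ℂ)} (hψ : ∀ η, R ≤ ‖η‖ → ψ η = 0) {t : ℝ}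
    (ht : t ∈ Set.Icc (0 : ℝ) 1) (η : E) (hη : flowComp X t ψ η ≠ 0) : σ η ≤ S := by
  refine hS η ?_
  rw [flowComp_apply] at hη
  have h1 : ‖flow X (-t) η‖ ≤ R := by
    by_contra! hcon
    exact hη (hψ _ hcon.le)
  have h2 := hK t ⟨by linarith [ht.1], ht.2⟩ (flow X (-t) η)
  rw [flow_flow_neg] at h2
  exact h2.trans (mul_le_mul_of_nonneg_left h1 hK0)

theorem continuous_pair_orbit {M : ℝ≥0 → LTwo E →L[ℂ] LTwo E} (hM : IsC0Semigroup M)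
    (g w : LTwo E) : Continuous fun t : ℝ => pair E g (M t.toNNReal w) :=
  (pair E g).continuous.comp (hM.continuous_toNNReal w)

-- The point is that the bound involves only the `L²` norm of `ψ`. The derivative of `s ↦ ⟨ψ, U_s
-- w⟩`, with `U` the transport evolution, pairs the transported `ψ` with `G` and with a truncated
-- multiple of `w`, and supports stay in the ball of radius `K * R`, where `σ ≤ S`.
set_option maxHeartbeats 1000000 in
include hσ hσ0 hσg in
theorem exists_pair_transportEvolve_sub_le {w G : LTwo E} (hw : WeakGenerator X σ w G) (R : ℝ) :
    ∃ C : ℝ, 0 ≤ C ∧ ∀ ψ : 𝓢(E, ℂ), (∀ η, R ≤ ‖η‖ → ψ η = 0) → ∀ h : ℝ≥0, h ≤ 1 →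
      ‖pair E (ψ.toLp 2) (transportEvolve X h w - w)‖ ≤ C * h * ‖(ψ.toLp 2 : LTwo E)‖ := by
  obtain ⟨K, hK1, hK⟩ := exists_norm_flow_le X 1
  obtain ⟨S, hS⟩ := exists_bound_on_ball hσ (K * R)
  refine ⟨(‖G‖ + S * ‖w‖) * Real.exp |tr X|, by positivity, fun ψ hψ h hh => ?_⟩
  let F : ℝ → ℂ := fun s => pair E (ψ.toLp 2) (transportEvolve X s.toNNReal w)
  let d : ℝ → ℂ := fun t => pair E ((flowComp X t ψ).toLp 2) G + (1 / 2 : ℂ) *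
    pair E (truncMul hσ hσ0 S ((flowComp X t ψ).toLp 2)) w
  have hU := isC0Semigroup_transportEvolve (X := X)
  have hF : Continuous F := continuous_pair_orbit hU _ w
  have hd (t : ℝ) (ht : t ∈ Set.Ico (0 : ℝ) 1) : HasDerivWithinAt F (d t) (Set.Ici t) t :=
    hasDerivWithinAt_pair_transportEvolve hσ hσ0 hσg hw ψ ht.1
      (le_of_flowComp_ne_zero (by linarith) hK hS hψ ⟨ht.1, ht.2.le⟩)
  have hb (t : ℝ) (ht : t ∈ Set.Ico (0 : ℝ) 1) :
      ‖d t‖ ≤ (‖G‖ + S * ‖w‖) * Real.exp |tr X| * ‖(ψ.toLp 2 : LTwo E)‖ := by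
    lift t to ℝ≥0 using ht.1
    have h1 : ‖((flowComp X t ψ).toLp 2 : LTwo E)‖ ≤
        Real.exp |tr X| * ‖(ψ.toLp 2 : LTwo E)‖ :=
      norm_toLp_flowComp_le (X := X) t (by exact_mod_cast ht.2.le) ψ
    refine (norm_pair_add_pair_truncMul_le hσ hσ0 S _ w G).trans ?_
    rw [mul_assoc _ (Real.exp _)]
    exact mul_le_mul_of_nonneg_left h1 (by positivity)
  have key := norm_image_sub_le_of_norm_deriv_right_le_segment hF.continuousOn hd hb h
    ⟨h.coe_nonneg, by exact_mod_cast hh⟩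
  have h0 : F h - F 0 = pair E (ψ.toLp 2) (transportEvolve X h w - w) := by
    simp only [F, Real.toNNReal_zero, Real.toNNReal_coe, map_sub,
      hU.map_zero, ContinuousLinearMap.id_apply]
  rw [h0] at key
  linarith

end

/-! ### Localisation by cutoffs, and compactly supported `L²` test functions -/

section

variable {E : Type*} [NormedAddCommGroup E] [InnerProductSpace ℝ E] [FiniteDimensional ℝ E]
  [MeasurableSpace E] [BorelSpace E]

/-- A smooth cutoff function with values in `[0, 1]`, supported in the ball of radius `R`. -/
structure IsCutoff (χ : E → ℝ) (R : ℝ) : Prop where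
  contDiff : ContDiff ℝ (⊤ : ℕ∞) χ
  hasCompactSupport : HasCompactSupport χ
  nonneg : ∀ η, 0 ≤ χ η
  le_one : ∀ η, χ η ≤ 1
  eq_zero : ∀ η, R ≤ ‖η‖ → χ η = 0

theorem IsCutoff.abs_le_one {χ : E → ℝ} {R : ℝ} (hχ : IsCutoff χ R) (η : E) : |χ η| ≤ 1 := by
  rw [abs_of_nonneg (hχ.nonneg η)]; exact hχ.le_one η

/-- Multiplication by a cutoff on `L²`. -/
def IsCutoff.mul {χ : E → ℝ} {R : ℝ} (hχ : IsCutoff χ R) : LTwo E →L[ℂ] LTwo E :=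
  mulOp χ hχ.contDiff.continuous 1 hχ.abs_le_one

theorem IsCutoff.coeFn_mul {χ : E → ℝ} {R : ℝ} (hχ : IsCutoff χ R) (f : LTwo E) :
    hχ.mul f =ᵐ[volume] fun η => (χ η : ℂ) * f η := coeFn_mulOp f

theorem IsCutoff.norm_mul_le {χ : E → ℝ} {R : ℝ} (hχ : IsCutoff χ R) (f : LTwo E) :
    ‖hχ.mul f‖ ≤ ‖f‖ := (norm_mulOp_le f).trans_eq (one_mul _)

theorem IsCutoff.exists_mul_toLp {χ : E → ℝ} {R : ℝ} (hχ : IsCutoff χ R) (ψ : 𝓢(E, ℂ)) :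
    ∃ ψ' : 𝓢(E, ℂ), hχ.mul (ψ.toLp 2) = ψ'.toLp 2 ∧ ∀ η, R ≤ ‖η‖ → ψ' η = 0 := by
  have hg := HasCompactSupport.hasTemperateGrowth_ofReal hχ.hasCompactSupport hχ.contDiff
  refine ⟨SchwartzMap.smulLeftCLM ℂ (fun η => (χ η : ℂ)) ψ, mulOp_toLp hg ψ, fun η hη => ?_⟩
  rw [SchwartzMap.smulLeftCLM_apply_apply hg, hχ.eq_zero η hη]
  simp

variable {X : E →L[ℝ] E} {σ : E → ℝ} (hσ : Continuous σ) (hσ0 : ∀ η, 0 ≤ σ η)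
  (hσg : ∃ C : ℝ, ∃ k : ℕ, ∀ η, σ η ≤ C * (1 + ‖η‖) ^ k)

-- Both sides are continuous in `g` for the `L²` norm, so the estimate extends from Schwartz
-- functions by density.
include hσ hσ0 hσg in
theorem exists_pair_cutoff_transportEvolve_sub_le {w G : LTwo E} (hw : WeakGenerator X σ w G)
    {χ : E → ℝ} {R : ℝ} (hχ : IsCutoff χ R) :
    ∃ C : ℝ, 0 ≤ C ∧ ∀ g : LTwo E, ∀ h : ℝ≥0, h ≤ 1 →
      ‖pair E (hχ.mul g) (transportEvolve X h w - w)‖ ≤ C * h * ‖g‖ := by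
  obtain ⟨C, hC0, hC⟩ := exists_pair_transportEvolve_sub_le hσ hσ0 hσg hw R
  refine ⟨C, hC0, fun g h hh => ?_⟩
  refine (denseRange_toLp_two E).induction_on
    (p := fun g => ‖pair E (hχ.mul g) (transportEvolve X h w - w)‖ ≤ C * h * ‖g‖) g ?_ fun ψ => ?_
  · refine isClosed_le ?_ (continuous_const.mul continuous_norm)
    exact (((pair E).flip (transportEvolve X h w - w)).continuous.comp hχ.mul.continuous).norm
  · obtain ⟨ψ', h1, h2⟩ := hχ.exists_mul_toLp ψ
    have h3 := hχ.norm_mul_le (ψ.toLp 2)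
    rw [h1] at h3 ⊢
    exact (hC ψ' h2 h hh).trans (mul_le_mul_of_nonneg_left h3 (by positivity))

/-- The damping factor `exp (-½ ∫₀ʰ σ (flow τ η) dτ)`. -/
def damping (X : E →L[ℝ] E) (σ : E → ℝ) (h : ℝ) (η : E) : ℝ :=
  Real.exp (-(1 / 2) * accum X σ h η)

include hσ in
theorem continuous_damping (h : ℝ) : Continuous (damping X σ h) :=
  Real.continuous_exp.comp (continuous_const.mul (continuous_accum hσ h))

include hσ0 in
theorem damping_le_one {h : ℝ} (hh : 0 ≤ h) (η : E) : damping X σ h η ≤ 1 := by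
  have := accum_nonneg (X := X) hσ0 hh η
  exact Real.exp_le_one_iff.2 (by linarith)

include hσ0 in
theorem abs_damping_le {h : ℝ} (hh : 0 ≤ h) (η : E) : |damping X σ h η| ≤ 1 := by
  rw [damping, Real.abs_exp]; exact damping_le_one hσ0 hh η

/-- Multiplication by the damping factor on `L²`. -/
def dampingOp (X : E →L[ℝ] E) (h : ℝ≥0) : LTwo E →L[ℂ] LTwo E :=
  mulOp (damping X σ h) (continuous_damping hσ h) 1 (abs_damping_le hσ0 h.coe_nonneg)

theorem coeFn_dampingOp (h : ℝ≥0) (f : LTwo E) :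
    dampingOp hσ hσ0 X h f =ᵐ[volume] fun η => (damping X σ h η : ℂ) * f η := coeFn_mulOp f

theorem norm_dampingOp_le (h : ℝ≥0) (f : LTwo E) : ‖dampingOp hσ hσ0 X h f‖ ≤ ‖f‖ :=
  (norm_mulOp_le f).trans_eq (one_mul _)

theorem pair_dampingOp (h : ℝ≥0) (g f : LTwo E) :
    pair E g (dampingOp hσ hσ0 X h f) = pair E (dampingOp hσ hσ0 X h g) f := pair_mulOp g f

theorem evolve_eq_dampingOp (h : ℝ≥0) (w : LTwo E) :
    evolve X hσ hσ0 h w = dampingOp hσ hσ0 X h (transportEvolve X h w) := by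
  refine Lp.ext ?_
  filter_upwards [coeFn_evolve (X := X) hσ hσ0 h w, coeFn_transportEvolve (X := X) h w,
    coeFn_dampingOp (X := X) hσ hσ0 h (transportEvolve X h w)] with η h1 h2 h3
  rw [h1, h3, h2, weight, damping]
  push_cast
  ring

theorem IsCutoff.mul_dampingOp {χ : E → ℝ} {R : ℝ} (hχ : IsCutoff χ R) (h : ℝ≥0) (g : LTwo E) :
    dampingOp hσ hσ0 X h (hχ.mul g) = hχ.mul (dampingOp hσ hσ0 X h g) := by
  refine Lp.ext ?_
  filter_upwards [hχ.coeFn_mul g, hχ.coeFn_mul (dampingOp hσ hσ0 X h g),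
    coeFn_dampingOp (X := X) hσ hσ0 h g,
    coeFn_dampingOp (X := X) hσ hσ0 h (hχ.mul g)] with η h1 h2 h3 h4
  rw [h4, h1, h2, h3]
  ring

include hσ in
theorem exists_one_sub_damping_le {R : ℝ} :
    ∃ S : ℝ, 0 ≤ S ∧ ∀ h ∈ Set.Icc (0 : ℝ) 1, ∀ η : E, ‖η‖ ≤ R → 1 - damping X σ h η ≤ S * h := by
  obtain ⟨K, hK1, hK⟩ := exists_norm_flow_le X 1
  obtain ⟨S, hS⟩ := exists_bound_on_ball hσ (K * R)
  refine ⟨S, S.coe_nonneg, fun h hh η hη => ?_⟩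
  have h1 : accum X σ h η ≤ S * h := by
    have := intervalIntegral.integral_mono_on (μ := volume) hh.1
      ((continuous_comp_flow (X := X) hσ η).intervalIntegrable 0 h)
      (continuous_const (y := (S : ℝ)).intervalIntegrable 0 h) fun τ hτ => by
        refine hS _ ((hK τ ⟨by linarith [hτ.1], hτ.2.trans hh.2⟩ η).trans ?_)
        exact mul_le_mul_of_nonneg_left hη (by linarith)
    rw [intervalIntegral.integral_const, sub_zero, smul_eq_mul] at this
    rw [accum]; linarith
  have h2 := Real.add_one_le_exp (-(1 / 2) * accum X σ h η)
  have h3 : 0 ≤ S * h := mul_nonneg S.coe_nonneg hh.1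
  rw [damping]
  linarith

include hσ hσ0 in
theorem exists_norm_cutoff_sub_damping_le {χ : E → ℝ} {R : ℝ} (hχ : IsCutoff χ R) :
    ∃ S : ℝ, 0 ≤ S ∧ ∀ h : ℝ≥0, h ≤ 1 → ∀ g : LTwo E,
      ‖hχ.mul (dampingOp hσ hσ0 X h g) - hχ.mul g‖ ≤ S * h * ‖g‖ := by
  obtain ⟨S, hS0, hS⟩ := exists_one_sub_damping_le (X := X) hσ (R := R)
  refine ⟨S, hS0, fun h hh g => ?_⟩
  refine Lp.norm_le_mul_norm_of_ae_le_mul ?_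
  filter_upwards [hχ.coeFn_mul g, hχ.coeFn_mul (dampingOp hσ hσ0 X h g),
    coeFn_dampingOp (X := X) hσ hσ0 h g,
    Lp.coeFn_sub (hχ.mul (dampingOp hσ hσ0 X h g)) (hχ.mul g)] with η h1 h2 h3 h4
  rw [h4, Pi.sub_apply, h1, h2, h3, show ((χ η : ℝ) : ℂ) *
    ((damping X σ h η : ℂ) * g η) - χ η * g η = ((χ η * (damping X σ h η - 1) : ℝ) : ℂ) * g η by
      push_cast; ring, norm_mul, Complex.norm_real, norm_mul]
  refine mul_le_mul_of_nonneg_right ?_ (norm_nonneg _)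
  rcases le_total R ‖η‖ with hη | hη
  · rw [hχ.eq_zero η hη, norm_zero, zero_mul]; positivity
  · have h5 := damping_le_one (X := X) hσ0 h.coe_nonneg η
    have h6 := hS h ⟨h.coe_nonneg, by exact_mod_cast hh⟩ η hη
    rw [Real.norm_eq_abs (damping X σ h η - 1), abs_of_nonpos (by linarith)]
    refine (mul_le_of_le_one_left (by linarith) (hχ.abs_le_one η)).trans (by linarith)

include hσ hσ0 hσg in
theorem exists_pair_cutoff_evolve_sub_le {w G : LTwo E} (hw : WeakGenerator X σ w G)
    {χ : E → ℝ} {R : ℝ} (hχ : IsCutoff χ R) :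
    ∃ C : ℝ, 0 ≤ C ∧ ∀ g : LTwo E, ∀ h : ℝ≥0, h ≤ 1 →
      ‖pair E (hχ.mul g) (evolve X hσ hσ0 h w - w)‖ ≤ C * h * ‖g‖ := by
  obtain ⟨C, hC0, hC⟩ := exists_pair_cutoff_transportEvolve_sub_le hσ hσ0 hσg hw hχ
  obtain ⟨S, hS0, hS⟩ := exists_norm_cutoff_sub_damping_le (X := X) hσ hσ0 hχ
  refine ⟨C + S * ‖w‖, by positivity, fun g h hh => ?_⟩
  -- With `D` the damping and `U` the transport, `⟨χg, D U w - w⟩ = ⟨χ D g, U w - w⟩ + ⟨χ D g - χ g,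
  -- w⟩`. The first term is the transport estimate for `D g`; the second is of order `h` because `1
  -- - D` is, on the support of `χ`.
  have h1 : pair E (hχ.mul g) (evolve X hσ hσ0 h w - w) =
      pair E (hχ.mul (dampingOp hσ hσ0 X h g)) (transportEvolve X h w - w) +
        pair E (hχ.mul (dampingOp hσ hσ0 X h g) - hχ.mul g) w := by
    rw [evolve_eq_dampingOp, map_sub, pair_dampingOp, hχ.mul_dampingOp,
      map_sub, map_sub, sub_apply]
    ring
  have h2 := hC (dampingOp hσ hσ0 X h g) h hh
  have h3 : ‖dampingOp hσ hσ0 X h g‖ ≤ ‖g‖ := norm_dampingOp_le hσ hσ0 h g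
  have h4 : C * h * ‖dampingOp hσ hσ0 X h g‖ ≤ C * h * ‖g‖ :=
    mul_le_mul_of_nonneg_left h3 (by positivity)
  have h5 := norm_pair_le (hχ.mul (dampingOp hσ hσ0 X h g) - hχ.mul g) w
  have h6 := mul_le_mul_of_nonneg_right (hS h hh g) (norm_nonneg w)
  rw [h1]
  refine (norm_add_le _ _).trans ?_
  linarith

-- The preceding estimate makes the rescaled functionals uniformly bounded in `g`. They converge on
-- Schwartz functions, whose product with the cutoff is again Schwartz, hence on all of `L²`.
include hσg in
theorem tendsto_pair_cutoff_evolve {w G : LTwo E} (hw : WeakGenerator X σ w G)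
    {χ : E → ℝ} {R : ℝ} (hχ : IsCutoff χ R) (g : LTwo E) :
    Tendsto (fun h : ℝ≥0 => ((h : ℝ)⁻¹ : ℝ) • pair E (hχ.mul g) (evolve X hσ hσ0 h w - w))
      (𝓝[>] 0) (𝓝 (pair E (hχ.mul g) G)) := by
  obtain ⟨C, hC0, hC⟩ := exists_pair_cutoff_evolve_sub_le hσ hσ0 hσg hw hχ
  let φ : ℝ≥0 → LTwo E →L[ℂ] ℂ := fun h =>
    (((h : ℝ)⁻¹ : ℝ) : ℂ) • ((pair E).flip (evolve X hσ hσ0 h w - w)).comp hχ.mul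
  have happ (h : ℝ≥0) (g : LTwo E) :
      φ h g = ((h : ℝ)⁻¹ : ℝ) • pair E (hχ.mul g) (evolve X hσ hσ0 h w - w) := by
    rw [Complex.real_smul]; rfl
  have key := tendsto_apply_of_denseRange (l := 𝓝[>] (0 : ℝ≥0)) (denseRange_toLp_two E) (φ := φ)
    (φ₀ := ((pair E).flip G).comp hχ.mul) (C := C) ?_ ?_ g
  · exact key.congr fun h => happ h g
  · filter_upwards [eventually_le_one] with h hh
    refine ContinuousLinearMap.opNorm_le_bound _ hC0 fun g => ?_
    have h0 : (0 : ℝ) < h := NNReal.coe_pos.2 hh.1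
    rw [happ, norm_smul, norm_inv, Real.norm_of_nonneg h0.le, inv_mul_le_iff₀ h0]
    have := hC g h hh.2
    linarith
  · intro ψ
    obtain ⟨ψ', h1, h2⟩ := hχ.exists_mul_toLp ψ
    have h3 := tendsto_pair_evolve (X := X) hσ hσ0 hσg ψ' w
    rw [← hw ψ', ← h1] at h3
    exact h3.congr fun h => (happ h _).symm

include hσg in
theorem tendsto_pair_evolve_of_support {w G : LTwo E} (hw : WeakGenerator X σ w G)
    {g : LTwo E} {R : ℝ} (hg : ∀ᵐ η, R ≤ ‖η‖ → g η = 0) :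
    Tendsto (fun h : ℝ≥0 => ((h : ℝ)⁻¹ : ℝ) • pair E g (evolve X hσ hσ0 h w - w))
      (𝓝[>] 0) (𝓝 (pair E g G)) := by
  -- The cutoff equals `1` where `g` can be nonzero; the maximum with `1` only ensures a positive
  -- radius.
  obtain ⟨χ, h1, h2, h3, h4, h5, h6⟩ := exists_cutoff E (R := max R 1) (by positivity)
  have hχ : IsCutoff χ (max R 1 + 1) := ⟨h1, h2, h3, h4, h6⟩
  have h7 : hχ.mul g = g := by
    refine Lp.ext ?_
    filter_upwards [hχ.coeFn_mul g, hg] with η h8 h9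
    rw [h8]
    rcases le_total ‖η‖ R with hη | hη
    · rw [h5 η (hη.trans (le_max_left _ _))]; simp
    · rw [h9 hη, mul_zero]
  have := tendsto_pair_cutoff_evolve hσ hσ0 hσg hw hχ g
  rwa [h7] at this

-- Differentiating `⟨ψ, M_t w⟩` at a time `t > 0` amounts to differentiating at time `0` against the
-- transposed evolution of `ψ`. That function may fail to be smooth but has bounded support, which
-- is all the localised limit requires.
include hσg in
theorem generatorApply_of_weakGenerator {w G : LTwo E} (hw : WeakGenerator X σ w G) :
    GeneratorApply (evolve X hσ hσ0) w G := by
  have hM := isC0Semigroup_evolve (X := X) hσ hσ0 hσg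
  refine hM.generatorApply_of_functionals (𝓛 := {ℓ | ∃ (ψ : 𝓢(E, ℂ)) (R : ℝ),
    (∀ η, R ≤ ‖η‖ → ψ η = 0) ∧ ℓ = pair E (ψ.toLp 2)}) ?_ ?_
  · intro f hf
    exact eq_zero_of_pair_eq_zero fun ψ R hψ => hf _ ⟨ψ, R, hψ, rfl⟩
  · rintro ℓ ⟨ψ, R, hψ, rfl⟩ t ht
    lift t to ℝ≥0 using ht
    rw [hasDerivWithinAt_Ici_iff]
    obtain ⟨K, hK1, hK⟩ := exists_norm_flow_le X t
    set g : LTwo E := (Real.exp (t * tr X) : ℂ) • evolve (-X) hσ hσ0 t (ψ.toLp 2) with hg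
    have hsupp : ∀ᵐ η, K * R ≤ ‖η‖ → g η = 0 := by
      filter_upwards [coeFn_evolve (X := -X) hσ hσ0 t (ψ.toLp 2),
        Lp.coeFn_smul (Real.exp (t * tr X) : ℂ) (evolve (-X) hσ hσ0 t (ψ.toLp 2)),
        (quasiMeasurePreserving_of_det_ne_zero (det_flow_ne_zero (X := -X) t)).ae_eq_comp
          (ψ.coeFn_toLp 2 volume)] with η h1 h2 h3 hη
      simp only [Function.comp_apply] at h3
      have h4 : R ≤ ‖flow (-X) t η‖ := by
        have h5 := hK t ⟨by linarith [t.coe_nonneg], le_rfl⟩ (flow (-X) t η)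
        rw [flow_neg_field, flow_flow_neg, ← flow_neg_field] at h5
        exact le_of_mul_le_mul_left (hη.trans h5) (by linarith)
      rw [hg, h2, Pi.smul_apply, h1, h3, hψ _ h4]
      simp
    have key := tendsto_pair_evolve_of_support hσ hσ0 hσg hw hsupp
    have h1 : pair E g G = pair E (ψ.toLp 2) (evolve X hσ hσ0 t G) := by
      rw [pair_evolve, hg, map_smul]; rfl
    rw [Real.toNNReal_coe, ← h1]
    refine key.congr fun h => ?_
    rw [Real.toNNReal_add t.coe_nonneg h.coe_nonneg, Real.toNNReal_coe, Real.toNNReal_coe,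
      pair_evolve_add_sub hσ hσ0 hσg]

include hσg in
/-- The generator of the evolution is the weak operator with its maximal domain. -/
theorem generatorApply_evolve_iff {w G : LTwo E} :
    GeneratorApply (evolve X hσ hσ0) w G ↔ WeakGenerator X σ w G :=
  ⟨weakGenerator_of_generatorApply hσ hσ0 hσg, generatorApply_of_weakGenerator hσ hσ0 hσg⟩

end

section

theorem GeneratorApply.map {H K : Type*} [NormedAddCommGroup H] [InnerProductSpace ℂ H]
    [CompleteSpace H] [NormedAddCommGroup K] [InnerProductSpace ℂ K] [CompleteSpace K]
    {M : ℝ≥0 → H →L[ℂ] H} {N : ℝ≥0 → K →L[ℂ] K} {u g : H} (h : GeneratorApply M u g)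
    (A : H →L[ℂ] K) (hA : ∀ t, A (M t u) = N t (A u)) : GeneratorApply N (A u) (A g) := by
  refine ((A.continuous.tendsto g).comp h).congr fun t => ?_
  rw [Function.comp_apply, A.map_smul_of_tower, map_sub, hA]

variable {n : ℕ}

/-! ### The Ornstein-Uhlenbeck operator on the Fourier side -/

theorem toTemperedDistribution_fourier {E : Type*} [NormedAddCommGroup E] [InnerProductSpace ℝ E]
    [FiniteDimensional ℝ E] [MeasurableSpace E] [BorelSpace E] (u : LTwo E) (ψ : 𝓢(E, ℂ)) :
    (u : 𝓢'(E, ℂ)) (𝓕 ψ) = pair E (ψ.toLp 2) (𝓕 u : LTwo E) := by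
  rw [← TemperedDistribution.fourier_apply, Lp.fourier_toTemperedDistribution_eq,
    Lp.toTemperedDistribution_apply, pair_toLp]
  simp only [smul_eq_mul]

/-- Multiplication and differentiation exchange roles with inverse factors `2πi`, so the drift is
unaffected by the normalisation of the Fourier transform. -/
theorem lineDerivOp_smulLeft_fourier {E : Type*} [NormedAddCommGroup E] [InnerProductSpace ℝ E]
    [FiniteDimensional ℝ E] [MeasurableSpace E] [BorelSpace E] (a b : E) (ψ : 𝓢(E, ℂ)) :
    -∂_{a} (SchwartzMap.smulLeftCLM ℂ (fun x => ((inner ℝ x b : ℝ) : ℂ)) (𝓕 ψ)) =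
      𝓕 (SchwartzMap.smulLeftCLM ℂ (fun x => ((inner ℝ x a : ℝ) : ℂ)) (∂_{b} ψ)) := by
  have ha : (inner ℝ · a : E → ℝ).HasTemperateGrowth := by fun_prop
  have hb : (inner ℝ · b : E → ℝ).HasTemperateGrowth := by fun_prop
  have hc : (2 * Real.pi * Complex.I : ℂ) ≠ 0 := by simp [Real.pi_ne_zero]
  have h1 : SchwartzMap.smulLeftCLM ℂ (fun x => ((inner ℝ x b : ℝ) : ℂ)) (𝓕 ψ) =
      (2 * Real.pi * Complex.I : ℂ)⁻¹ • 𝓕 (∂_{b} ψ) := by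
    rw [SchwartzMap.fourier_lineDerivOp_eq, smul_smul, inv_mul_cancel₀ hc, one_smul]
    exact SchwartzMap.smulLeftCLM_ofReal ℂ hb _
  rw [h1, lineDerivOp_smul, SchwartzMap.lineDerivOp_fourier_eq, FourierTransform.fourier_smul,
    smul_smul, mul_neg, inv_mul_cancel₀ hc, neg_smul, one_smul, neg_neg]
  congr 1
  exact (SchwartzMap.smulLeftCLM_ofReal ℂ ha _).symm

/-- The drift field `ξ ↦ Bᵀ ξ` on the Fourier side. -/
def drift (B : Matrix (Fin n) (Fin n) ℝ) : Rn n →L[ℝ] Rn n := Matrix.toEuclideanCLM (𝕜 := ℝ) B.transpose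

theorem drift_apply (B : Matrix (Fin n) (Fin n) ℝ) (η : Rn n) (j : Fin n) :
    drift B η j = ∑ i, B i j * η i := by
  simp [drift, Matrix.ofLp_toEuclideanCLM, Matrix.mulVec, dotProduct]

theorem transport_fourier (B : Matrix (Fin n) (Fin n) ℝ) (u : L2 n) (ψ : 𝓢(Rn n, ℂ)) :
    transport B u (𝓕 ψ) = ∫ η, fderiv ℝ ψ η (drift B η) * (𝓕 u : L2 n) η := by
  have hg (i : Fin n) : (fun x : Rn n => ((x i : ℝ) : ℂ)).HasTemperateGrowth :=
    (Complex.ofRealCLM.comp (EuclideanSpace.proj i : Rn n →L[ℝ] ℝ)).hasTemperateGrowth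
  have hterm (i j : Fin n) : (B i j : ℂ) * ((∂_{(EuclideanSpace.single i (1 : ℝ) : Rn n)}
      (u : 𝓢'(Rn n, ℂ))) (SchwartzMap.smulLeftCLM ℂ (fun x : Rn n => ((x j : ℝ) : ℂ)) (𝓕 ψ))) =
      ∫ η, (B i j : ℂ) * ((η i : ℂ) * fderiv ℝ ψ η (EuclideanSpace.single j 1)) *
        (𝓕 u : L2 n) η := by
    have h1 := lineDerivOp_smulLeft_fourier (EuclideanSpace.single i (1 : ℝ) : Rn n)
      (EuclideanSpace.single j (1 : ℝ)) ψ
    simp only [EuclideanSpace.inner_single_right, one_mul, conj_trivial] at h1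
    rw [TemperedDistribution.lineDerivOp_apply_apply, h1, toTemperedDistribution_fourier,
      pair_toLp, ← integral_const_mul]
    refine integral_congr_ae (Eventually.of_forall fun η => ?_)
    simp only
    rw [SchwartzMap.smulLeftCLM_apply_apply (hg i), SchwartzMap.lineDerivOp_apply_eq_fderiv,
      smul_eq_mul]
    ring
  have hint (i j : Fin n) : Integrable (fun η => (B i j : ℂ) *
      ((η i : ℂ) * fderiv ℝ ψ η (EuclideanSpace.single j 1)) * (𝓕 u : L2 n) η) volume := by
    have h1 := (integrable_mul_lTwo ((SchwartzMap.smulLeftCLM ℂ (fun x : Rn n => ((x i : ℝ) : ℂ))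
      (∂_{(EuclideanSpace.single j (1 : ℝ) : Rn n)} ψ)).toLp 2) (𝓕 u : L2 n)).const_mul (B i j : ℂ)
    refine h1.congr ?_
    filter_upwards [(SchwartzMap.smulLeftCLM ℂ (fun x : Rn n => ((x i : ℝ) : ℂ))
      (∂_{(EuclideanSpace.single j (1 : ℝ) : Rn n)} ψ)).coeFn_toLp 2 volume] with η h2
    rw [h2, SchwartzMap.smulLeftCLM_apply_apply (hg i), SchwartzMap.lineDerivOp_apply_eq_fderiv,
      smul_eq_mul]
    ring
  have hsum : transport B u (𝓕 ψ) = ∑ i, ∑ j, ∫ η, (B i j : ℂ) *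
      ((η i : ℂ) * fderiv ℝ ψ η (EuclideanSpace.single j 1)) * (𝓕 u : L2 n) η := by
    simp_rw [← hterm]
    simp [transport]
  rw [hsum]
  simp_rw [← integral_finsetSum _ (fun j _ => hint _ j)]
  rw [← integral_finsetSum _ (fun i _ => integrable_finsetSum _ (fun j _ => hint i j))]
  refine integral_congr_ae (Eventually.of_forall fun η => ?_)
  have hexp : fderiv ℝ ψ η (drift B η) =
      ∑ j, ((drift B η j : ℝ) : ℂ) * fderiv ℝ ψ η (EuclideanSpace.single j 1) := by
    have h1 : drift B η = ∑ j, drift B η j • (EuclideanSpace.single j 1 : Rn n) := by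
      ext k
      simp [Finset.sum_apply, Pi.single_apply]
    conv_lhs => rw [h1]
    simp only [map_sum, map_smul, Complex.real_smul]
  simp only
  rw [hexp, Finset.sum_mul, Finset.sum_comm]
  refine Finset.sum_congr rfl fun j _ => ?_
  rw [drift_apply]
  push_cast
  rw [Finset.sum_mul, Finset.sum_mul]
  refine Finset.sum_congr rfl fun i _ => ?_
  ring

/-- The symbol in the frequency variable of Mathlib's Fourier transform. -/
def scaledSymbol (s : ℝ) (Q : Matrix (Fin n) (Fin n) ℝ) (η : Rn n) : ℝ :=
  symbol s Q ((2 * Real.pi) • η)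

section scaledSymbol

variable {s : ℝ} (hs : 0 < s) {Q : Matrix (Fin n) (Fin n) ℝ} (hQ : Q.PosSemidef)

theorem toEuclideanLin_continuous (Q : Matrix (Fin n) (Fin n) ℝ) :
    Continuous (Matrix.toEuclideanLin Q : Rn n → Rn n) :=
  (Matrix.toEuclideanLin Q).continuous_of_finiteDimensional

include hs in
theorem continuous_scaledSymbol : Continuous (scaledSymbol s Q) := by
  have h1 : Continuous fun ξ : Rn n => inner ℝ (Matrix.toEuclideanLin Q ξ) ξ :=
    (toEuclideanLin_continuous Q).inner continuous_id
  exact (h1.comp (continuous_const_smul (2 * Real.pi))).rpow_const fun _ => Or.inr hs.le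

include hQ in
theorem inner_toEuclideanLin_nonneg (ξ : Rn n) : 0 ≤ inner ℝ (Matrix.toEuclideanLin Q ξ) ξ := by
  have := hQ.dotProduct_mulVec_nonneg ξ
  rw [EuclideanSpace.inner_eq_star_dotProduct]
  simpa [Matrix.toLpLin_apply, dotProduct_comm] using this

include hQ in
theorem scaledSymbol_nonneg (η : Rn n) : 0 ≤ scaledSymbol s Q η :=
  Real.rpow_nonneg (inner_toEuclideanLin_nonneg hQ _) _

include hs hQ in
theorem exists_scaledSymbol_le :
    ∃ C : ℝ, ∃ k : ℕ, ∀ η, scaledSymbol s Q η ≤ C * (1 + ‖η‖) ^ k := by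
  set L := (Matrix.toEuclideanLin Q).toContinuousLinearMap
  obtain ⟨m, hm⟩ := exists_nat_ge s
  refine ⟨(‖L‖ * (2 * Real.pi) ^ 2) ^ s, 2 * m, fun η => ?_⟩
  have h1 : inner ℝ (Matrix.toEuclideanLin Q ((2 * Real.pi) • η)) ((2 * Real.pi) • η) ≤
      (‖L‖ * (2 * Real.pi) ^ 2) * (1 + ‖η‖) ^ 2 := by
    have h2 : ‖(2 * Real.pi) • η‖ = 2 * Real.pi * ‖η‖ := by
      rw [norm_smul, Real.norm_of_nonneg (by positivity)]
    calc _ ≤ ‖L ((2 * Real.pi) • η)‖ * ‖(2 * Real.pi) • η‖ := real_inner_le_norm _ _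
      _ ≤ ‖L‖ * ‖(2 * Real.pi) • η‖ * ‖(2 * Real.pi) • η‖ := by
          gcongr; exact L.le_opNorm _
      _ = ‖L‖ * (2 * Real.pi) ^ 2 * ‖η‖ ^ 2 := by rw [h2]; ring
      _ ≤ _ := by gcongr; linarith [norm_nonneg η]
  have h3 : (1 : ℝ) ≤ 1 + ‖η‖ := by linarith [norm_nonneg η]
  calc scaledSymbol s Q η ≤ ((‖L‖ * (2 * Real.pi) ^ 2) * (1 + ‖η‖) ^ 2) ^ s :=
        Real.rpow_le_rpow (inner_toEuclideanLin_nonneg hQ _) h1 hs.le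
    _ = (‖L‖ * (2 * Real.pi) ^ 2) ^ s * ((1 + ‖η‖) ^ 2) ^ s := by
        rw [Real.mul_rpow (by positivity) (by positivity)]
    _ ≤ (‖L‖ * (2 * Real.pi) ^ 2) ^ s * ((1 + ‖η‖) ^ 2) ^ (m : ℝ) := by
        gcongr
        exact one_le_pow₀ h3
    _ = _ := by rw [Real.rpow_natCast, ← pow_mul]

-- Each Schwartz function is the Fourier transform of one, so testing `P u` against `𝓕 ψ` loses
-- nothing, and there `-P` becomes `transposeGen`.
include hs hQ in
theorem ouApply_neg_iff (B : Matrix (Fin n) (Fin n) ℝ) (u g : L2 n) :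
    OUApply s Q B u (-g) ↔
      WeakGenerator (drift B) (scaledSymbol s Q) (𝓕 u : L2 n) (𝓕 g : L2 n) := by
  have key (ψ : 𝓢(Rn n, ℂ)) : ∫ η, transposeGen (drift B) (scaledSymbol s Q) ψ η *
      (𝓕 u : L2 n) η = -((1 / 2 : ℂ) * diffusionPairing s Q u (𝓕 ψ) + transport B u (𝓕 ψ)) := by
    have h1 : diffusionPairing s Q u (𝓕 ψ) =
        ∫ η, (scaledSymbol s Q η : ℂ) * (𝓕 u : L2 n) η * ψ η := by
      rw [diffusionPairing, fourierInv_fourier_eq]; rfl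
    -- Specialising to `σ = 0` and to `X = 0` yields separate integrability of the drift and
    -- diffusion terms, needed to split the integral.
    have i1 := integrable_transposeGen_mul (X := drift B) (σ := fun _ => 0) continuous_const
      (fun _ => le_rfl) ⟨0, 0, by simp⟩ ψ (𝓕 u : L2 n)
    have i2 := integrable_transposeGen_mul (X := (0 : Rn n →L[ℝ] Rn n))
      (continuous_scaledSymbol (Q := Q) hs) (scaledSymbol_nonneg hQ) (exists_scaledSymbol_le hs hQ)
      ψ (𝓕 u : L2 n)
    simp only [transposeGen, zero_apply, map_zero, sub_zero] at i2
    simp only [transposeGen, Complex.ofReal_zero, mul_zero, zero_mul, zero_sub] at i1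
    rw [h1, transport_fourier, neg_add, ← integral_const_mul, ← integral_neg, ← integral_neg,
      ← integral_add]
    · refine integral_congr_ae (Eventually.of_forall fun η => ?_)
      simp only [transposeGen]; ring
    · exact i2.congr (Eventually.of_forall fun η => by simp only; ring)
    · exact i1.congr (Eventually.of_forall fun η => by simp only; ring)
  have hneg (ψ : 𝓢(Rn n, ℂ)) : ((-g : L2 n) : 𝓢'(Rn n, ℂ)) (𝓕 ψ) =
      -pair (Rn n) (ψ.toLp 2) (𝓕 g : L2 n) := by
    rw [toTemperedDistribution_fourier, FourierTransform.fourier_neg, map_neg]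
  constructor
  · intro h ψ
    have := h (𝓕 ψ)
    rw [hneg] at this
    rw [key, ← this, neg_neg]
  · intro h φ
    have h1 := h (𝓕⁻ φ)
    rw [key, fourier_fourierInv_eq] at h1
    have h2 := hneg (𝓕⁻ φ)
    rw [fourier_fourierInv_eq, h1, neg_neg] at h2
    exact h2

end scaledSymbol

/-! ### The semigroup -/

section semigroup

variable {s : ℝ} (hs : 0 < s) {Q : Matrix (Fin n) (Fin n) ℝ} (hQ : Q.PosSemidef)

/-- The evolution conjugated to the space side. -/
def ouSemigroup (B : Matrix (Fin n) (Fin n) ℝ) (t : ℝ≥0) : L2 n →L[ℂ] L2 n :=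
  (fourierInvCLM ℂ (L2 n)).comp
    ((evolve (drift B) (continuous_scaledSymbol hs) (scaledSymbol_nonneg hQ) t).comp
      (fourierCLM ℂ (L2 n)))

theorem ouSemigroup_apply (B : Matrix (Fin n) (Fin n) ℝ) (t : ℝ≥0) (u : L2 n) :
    ouSemigroup hs hQ B t u =
      𝓕⁻ (evolve (drift B) (continuous_scaledSymbol hs) (scaledSymbol_nonneg hQ) t (𝓕 u)) := rfl

theorem norm_ouSemigroup_le (B : Matrix (Fin n) (Fin n) ℝ) (t : ℝ≥0) (u : L2 n) :
    ‖ouSemigroup hs hQ B t u‖ ≤ Real.exp (tr (drift B) / 2 * t) * ‖u‖ := by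
  rw [ouSemigroup_apply, ← Lp.norm_fourier_eq, fourier_fourierInv_eq, ← Lp.norm_fourier_eq u]
  exact norm_evolve_le _ _ t _

theorem isC0Semigroup_ouSemigroup (B : Matrix (Fin n) (Fin n) ℝ) :
    IsC0Semigroup (ouSemigroup hs hQ B) := by
  have hM := isC0Semigroup_evolve (X := drift B) (continuous_scaledSymbol hs)
    (scaledSymbol_nonneg hQ) (exists_scaledSymbol_le hs hQ)
  refine ⟨?_, fun t t' => ?_, fun u => ?_⟩
  · ext1 u
    rw [ouSemigroup_apply, hM.map_zero, ContinuousLinearMap.id_apply, fourierInv_fourier_eq,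
      ContinuousLinearMap.id_apply]
  · ext1 u
    rw [ContinuousLinearMap.comp_apply, ouSemigroup_apply, ouSemigroup_apply, ouSemigroup_apply,
      fourier_fourierInv_eq, hM.map_add_apply]
  · exact (fourierInvCLM ℂ (L2 n)).continuous.comp (hM.continuous_orbit _)

theorem generatorApply_ouSemigroup_iff (B : Matrix (Fin n) (Fin n) ℝ) (u g : L2 n) :
    GeneratorApply (ouSemigroup hs hQ B) u g ↔ OUApply s Q B u (-g) := by
  rw [ouApply_neg_iff hs hQ, ← generatorApply_evolve_iff (continuous_scaledSymbol hs)
    (scaledSymbol_nonneg hQ) (exists_scaledSymbol_le hs hQ)]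
  constructor
  · intro h
    exact h.map (fourierCLM ℂ (L2 n)) fun t => by
      simp only [fourierCLM_apply, ouSemigroup_apply, fourier_fourierInv_eq]
  · intro h
    have h1 := h.map (N := ouSemigroup hs hQ B) (fourierInvCLM ℂ (L2 n)) fun t => by
      simp only [fourierInvCLM_apply, ouSemigroup_apply, fourierInv_fourier_eq]
    simpa only [fourierInvCLM_apply, fourierInv_fourier_eq] using h1

theorem isOUSemigroup_iff (B : Matrix (Fin n) (Fin n) ℝ) (M : ℝ≥0 → L2 n →L[ℂ] L2 n) :
    IsOUSemigroup s Q B M ↔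
      IsC0Semigroup M ∧ ∀ u g, GeneratorApply M u g ↔ OUApply s Q B u (-g) := by
  simp_rw [generatorApply_lTwo_iff]
  exact ⟨fun h => ⟨⟨h.1, h.2, h.3⟩, h.4⟩, fun h => ⟨h.1.1, h.1.2, h.1.3, h.2⟩⟩

theorem isOUSemigroup_ouSemigroup (B : Matrix (Fin n) (Fin n) ℝ) :
    IsOUSemigroup s Q B (ouSemigroup hs hQ B) :=
  (isOUSemigroup_iff B _).2
    ⟨isC0Semigroup_ouSemigroup hs hQ B, generatorApply_ouSemigroup_iff hs hQ B⟩

theorem eq_ouSemigroup (B : Matrix (Fin n) (Fin n) ℝ) {M : ℝ≥0 → L2 n →L[ℂ] L2 n}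
    (hM : IsOUSemigroup s Q B M) : M = ouSemigroup hs hQ B := by
  obtain ⟨h1, h2⟩ := (isOUSemigroup_iff B M).1 hM
  exact (isC0Semigroup_ouSemigroup hs hQ B).eq_of_generator (norm_ouSemigroup_le hs hQ B) h1
    fun u g => by rw [h2, generatorApply_ouSemigroup_iff]

end semigroup

end

section

/-! ### Nondegeneracy of a linear observation along a linear flow -/

section orthogonal

variable {E F : Type*} [NormedAddCommGroup E] [InnerProductSpace ℝ E] [FiniteDimensional ℝ E]
  [NormedAddCommGroup F] [NormedSpace ℝ F]

/-- The joint map of the `L j` has kernel `W`, so it is injective on `Wᗮ`, hence bounded below there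
by finite dimensionality. The vector `p` is the projection of `ζ` to `Wᗮ`. -/
theorem exists_orthogonal_part (L : ℕ → E →L[ℝ] F) (k : ℕ) (W : Submodule ℝ E)
    (hW : ∀ ζ, ζ ∈ W ↔ ∀ j < k, L j ζ = 0) :
    ∃ C : ℝ, 0 < C ∧ ∀ ζ : E, ∃ p : E, ζ - p ∈ W ∧ (∀ ξ ∈ Wᗮ, inner ℝ ξ ζ = inner ℝ ξ p) ∧
      ‖p‖ ≤ C * ∑ j ∈ Finset.range k, ‖L j ζ‖ := by
  let T : E →ₗ[ℝ] (Fin k → F) := LinearMap.pi fun j => (L j : E →ₗ[ℝ] F)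
  have hT (ζ : E) : T ζ = 0 ↔ ζ ∈ W := by
    rw [hW, funext_iff]
    exact ⟨fun h j hj => h ⟨j, hj⟩, fun h j => h j j.2⟩
  obtain ⟨K, hK0, hK⟩ := (T.domRestrict Wᗮ).exists_antilipschitzWith (by
    rw [LinearMap.ker_eq_bot']
    rintro ⟨ζ, hζ⟩ h
    have h1 : ζ ∈ W := (hT ζ).1 h
    have h2 : ζ = 0 := by simpa using W.orthogonal_disjoint.le_bot ⟨h1, hζ⟩
    simpa using h2)
  refine ⟨K, by exact_mod_cast hK0, fun ζ => ?_⟩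
  obtain ⟨w, hw, p, hp, rfl⟩ := W.exists_add_mem_mem_orthogonal ζ
  refine ⟨p, by simpa using hw, fun ξ hξ => ?_, ?_⟩
  · rw [inner_add_right, W.inner_left_of_mem_orthogonal hw hξ, zero_add]
  · have h1 := hK.le_mul_dist ⟨p, hp⟩ 0
    have h2 : T.domRestrict Wᗮ ⟨p, hp⟩ = T (w + p) := by
      rw [map_add, (hT w).2 hw, zero_add]; rfl
    rw [dist_zero_right, map_zero, dist_zero_right, h2] at h1
    refine h1.trans (mul_le_mul_of_nonneg_left ?_ K.2)
    refine (pi_norm_le_iff_of_nonneg (by positivity)).2 fun j => ?_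
    exact Finset.single_le_sum (f := fun j => ‖L j (w + p)‖) (fun _ _ => norm_nonneg _)
      (Finset.mem_range.2 j.2)

end orthogonal

/-- Controls how far a polynomial value can drift from its value at a node. -/
theorem abs_pow_sub_pow_le_mul {a b : ℝ} (ha : |a| ≤ 1) (hb : |b| ≤ 1) (j : ℕ) :
    |a ^ j - b ^ j| ≤ j * |a - b| := by
  induction j with
  | zero => simp
  | succ j ih =>
    have h : a ^ (j + 1) - b ^ (j + 1) = a * (a ^ j - b ^ j) + (a - b) * b ^ j := by ring
    rw [h]
    refine (abs_add_le _ _).trans ?_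
    rw [abs_mul, abs_mul, abs_pow]
    have h1 : |b| ^ j ≤ 1 := pow_le_one₀ (abs_nonneg _) hb
    push_cast
    nlinarith [abs_nonneg a, abs_nonneg b, abs_nonneg (a - b), abs_nonneg (a ^ j - b ^ j)]

/-! ### Lower bounds for vector-valued polynomials on a subinterval -/

section polynomial

variable {F : Type*} [NormedAddCommGroup F] [NormedSpace ℝ F]

/-- The coefficients are recovered from the values at the distinct nodes `i / r` by the inverse
Vandermonde matrix. -/
theorem exists_sum_norm_le_sum_norm_eval (r : ℕ) :
    ∃ C : ℝ, 0 < C ∧ ∀ b : ℕ → F, ∑ j ∈ Finset.range r, ‖b j‖ ≤ C * ∑ i ∈ Finset.range r,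
      ‖∑ j ∈ Finset.range r, ((i : ℝ) / r) ^ j • b j‖ := by
  let v : Fin r → ℝ := fun i => (i : ℝ) / r
  have hv : Function.Injective v := by
    intro i j h
    have hr : (r : ℝ) ≠ 0 := by have := i.pos; positivity
    have h1 : (i : ℝ) = j := by simpa [v, div_left_inj' hr] using h
    exact Fin.ext (by exact_mod_cast h1)
  have hdet : IsUnit (Matrix.vandermonde v).det :=
    isUnit_iff_ne_zero.2 (Matrix.det_vandermonde_ne_zero_iff.2 hv)
  set A := (Matrix.vandermonde v)⁻¹
  have hA : A * Matrix.vandermonde v = 1 := Matrix.nonsing_inv_mul _ hdet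
  refine ⟨∑ j, ∑ i, |A j i| + 1, by positivity, fun b => ?_⟩
  simp_rw [← Fin.sum_univ_eq_sum_range (fun j => ‖b j‖),
    ← Fin.sum_univ_eq_sum_range (fun i : ℕ => ‖∑ j ∈ Finset.range r, ((i : ℝ) / r) ^ j • b j‖)]
  set p : Fin r → F := fun i => ∑ j ∈ Finset.range r, ((i : ℝ) / r) ^ j • b j
  have hb (j : Fin r) : b j = ∑ i, A j i • p i := by
    have h1 (i : Fin r) : p i = ∑ l : Fin r, Matrix.vandermonde v i l • b l := by
      simp only [p, Matrix.vandermonde_apply, v]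
      rw [← Fin.sum_univ_eq_sum_range (fun l => ((i : ℝ) / r) ^ l • b l)]
    simp_rw [h1, Finset.smul_sum, smul_smul]
    rw [Finset.sum_comm]
    simp_rw [← Finset.sum_smul, ← Matrix.mul_apply, hA]
    simp [Matrix.one_apply]
  have hp : ∀ i, ‖p i‖ ≤ ∑ i, ‖p i‖ := fun i =>
    Finset.single_le_sum (f := fun i => ‖p i‖) (fun _ _ => norm_nonneg _) (Finset.mem_univ i)
  calc ∑ j : Fin r, ‖b j‖ ≤ ∑ j, ∑ i, |A j i| * ∑ i, ‖p i‖ := by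
        refine Finset.sum_le_sum fun j _ => ?_
        rw [hb j]
        refine (norm_sum_le _ _).trans (Finset.sum_le_sum fun i _ => ?_)
        rw [norm_smul, Real.norm_eq_abs]
        exact mul_le_mul_of_nonneg_left (hp i) (abs_nonneg _)
    _ = (∑ j, ∑ i, |A j i|) * ∑ i, ‖p i‖ := by simp_rw [Finset.sum_mul]
    _ ≤ _ := by gcongr; linarith

theorem exists_interval_sum_norm_le (r : ℕ) :
    ∃ c : ℝ, 0 < c ∧ ∃ δ : ℝ, 0 < δ ∧ δ ≤ 1 ∧ ∀ b : ℕ → F, ∃ a : ℝ, 0 ≤ a ∧ a + δ ≤ 1 ∧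
      ∀ α ∈ Set.Icc a (a + δ), c * ∑ j ∈ Finset.range r, ‖b j‖ ≤
        ‖∑ j ∈ Finset.range r, α ^ j • b j‖ := by
  obtain ⟨C, hC, hb⟩ := exists_sum_norm_le_sum_norm_eval (F := F) r
  rcases Nat.eq_zero_or_pos r with rfl | hr
  · exact ⟨1, one_pos, 1, one_pos, le_rfl, fun b => ⟨0, le_rfl, by simp, fun α _ => by simp⟩⟩
  have hr' : (0 : ℝ) < r := by exact_mod_cast hr
  have hr1 : (1 : ℝ) ≤ r := by exact_mod_cast hr
  -- By pigeonhole some node carries at least `1 / (C * r)` of the sum of the coefficients. The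
  -- bound `δ ≤ 1 / r` keeps the interval inside `[0, 1]`, and `r * δ ≤ c / 2` makes the variation
  -- over it cost at most half of that value.
  set c := 1 / (C * r) with hc
  have hc0 : 0 < c := by positivity
  set δ : ℝ := min (1 / (r : ℝ)) (c / (2 * r)) with hδ
  have hδ0 : 0 < δ := lt_min (by positivity) (by positivity)
  have hδ1 : δ ≤ 1 / (r : ℝ) := min_le_left _ _
  have hδ2 : r * δ ≤ c / 2 := by
    calc r * δ ≤ r * (c / (2 * r)) := by gcongr; exact min_le_right _ _
      _ = c / 2 := by field_simp
  refine ⟨c / 2, by positivity, δ, hδ0, hδ1.trans (by rw [div_le_one hr']; exact hr1), fun b => ?_⟩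
  set N := ∑ j ∈ Finset.range r, ‖b j‖
  have hN : 0 ≤ N := by positivity
  obtain ⟨i, hi, hi2⟩ : ∃ i ∈ Finset.range r, c * N ≤
      ‖∑ j ∈ Finset.range r, ((i : ℝ) / r) ^ j • b j‖ := by
    by_contra! h
    have h1 := Finset.sum_lt_sum_of_nonempty (Finset.nonempty_range_iff.2 hr.ne') h
    rw [Finset.sum_const, Finset.card_range, nsmul_eq_mul] at h1
    have h2 := hb b
    have h3 : N < C * (r * (c * N)) := lt_of_le_of_lt h2 (mul_lt_mul_of_pos_left h1 hC)
    have h4 : C * (r * (c * N)) = N := by rw [hc]; field_simp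
    linarith
  have hir : ((i : ℝ) + 1) / r ≤ 1 := by
    rw [div_le_one hr']; exact_mod_cast Finset.mem_range.1 hi
  have h0 : (0 : ℝ) ≤ (i : ℝ) / r := by positivity
  have hle : (i : ℝ) / r + δ ≤ 1 := by
    rw [add_div] at hir; linarith
  refine ⟨i / r, h0, hle, fun α hα => ?_⟩
  have hdiff : ‖∑ j ∈ Finset.range r, α ^ j • b j - ∑ j ∈ Finset.range r, ((i : ℝ) / r) ^ j • b j‖
      ≤ c / 2 * N := by
    rw [← Finset.sum_sub_distrib, Finset.mul_sum]
    refine (norm_sum_le _ _).trans (Finset.sum_le_sum fun j hj => ?_)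
    rw [← sub_smul, norm_smul, Real.norm_eq_abs]
    refine mul_le_mul_of_nonneg_right ?_ (norm_nonneg _)
    have hj' : (j : ℝ) ≤ r := by exact_mod_cast (Finset.mem_range.1 hj).le
    have ha1 : |α| ≤ 1 := by rw [abs_of_nonneg (h0.trans hα.1)]; linarith [hα.2]
    have hb1 : |(i : ℝ) / r| ≤ 1 := by rw [abs_of_nonneg h0]; linarith
    have hab : |α - i / r| ≤ δ := by
      rw [abs_of_nonneg (sub_nonneg.2 hα.1)]; linarith [hα.2]
    calc _ ≤ j * |α - i / r| := abs_pow_sub_pow_le_mul ha1 hb1 j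
      _ ≤ r * δ := by gcongr
      _ ≤ c / 2 := hδ2
  have h5 := norm_sub_norm_le (∑ j ∈ Finset.range r, ((i : ℝ) / r) ^ j • b j)
    (∑ j ∈ Finset.range r, α ^ j • b j)
  rw [norm_sub_rev] at h5
  linarith

end polynomial

/-! ### Quantitative observability along the flow -/

section flow

variable {E F : Type*} [NormedAddCommGroup E] [InnerProductSpace ℝ E] [FiniteDimensional ℝ E]
  [NormedAddCommGroup F] [NormedSpace ℝ F]

theorem apply_flow_eq_zero {X : E →L[ℝ] E} {R : E →L[ℝ] F} {ζ : E}
    (h : ∀ j, R ((X ^ j) ζ) = 0) (t : ℝ) : R (flow X t ζ) = 0 := by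
  have h1 := NormedSpace.exp_series_hasSum_exp' (𝕂 := ℝ) (t • X)
  have h2 := h1.mapL ((R : E →L[ℝ] F).comp (ContinuousLinearMap.apply ℝ E ζ))
  refine h2.unique ?_
  convert hasSum_zero with j
  change R ((((j.factorial : ℝ))⁻¹ • (t • X) ^ j) ζ) = 0
  rw [smul_pow]
  simp only [smul_apply, map_smul, h, smul_zero]

theorem exists_norm_flow_sub_le (X : E →L[ℝ] E) (r : ℕ) :
    ∃ C : ℝ, 0 < C ∧ ∃ T : ℝ, 0 < T ∧ ∀ t, 0 ≤ t → t < T →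
      ‖flow X t - ∑ j ∈ Finset.range r, (t ^ j / (j.factorial : ℝ)) • X ^ j‖ ≤ C * t ^ r := by
  have h1 := (NormedSpace.exp_hasFPowerSeriesAt_zero (𝕂 := ℝ)
    (𝔸 := E →L[ℝ] E)).isBigO_sub_partialSum_pow r
  obtain ⟨C, hC, h2⟩ := h1.exists_pos
  have h3 : Tendsto (fun t : ℝ => t • X) (𝓝 0) (𝓝 0) := by
    have : Continuous fun t : ℝ => t • X := by fun_prop
    exact this.tendsto' 0 0 (zero_smul _ _)
  obtain ⟨T, hT, h4⟩ := Metric.eventually_nhds_iff.1 (h3.eventually h2.bound)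
  refine ⟨C * (‖X‖ + 1) ^ r, by positivity, T, hT, fun t ht htT => ?_⟩
  have h5 := h4 (y := t) (by rwa [dist_zero_right, Real.norm_of_nonneg ht])
  rw [zero_add, norm_pow, norm_norm, norm_smul, Real.norm_of_nonneg ht] at h5
  have h6 : (NormedSpace.expSeries ℝ (E →L[ℝ] E)).partialSum r (t • X) =
      ∑ j ∈ Finset.range r, (t ^ j / (j.factorial : ℝ)) • X ^ j := by
    refine Finset.sum_congr rfl fun j _ => ?_
    rw [NormedSpace.expSeries_apply_eq, smul_pow, smul_smul, div_eq_inv_mul]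
  rw [h6] at h5
  refine h5.trans ?_
  rw [mul_pow, mul_assoc, mul_comm (t ^ r)]
  gcongr
  linarith

/-- The polynomial estimate is applied, after rescaling time by `t`, to the Taylor polynomial of `τ
↦ R (flow X τ ζ)`. By `hker`, the part of `ζ` invisible to the first `r` coefficients is invisible
to the whole curve, so the Taylor remainder is controlled by those coefficients and absorbed for
small `t`. -/
theorem exists_flow_lower_bound (X : E →L[ℝ] E) (R : E →L[ℝ] F) (r : ℕ)
    (hker : ∀ ζ, (∀ j < r, R ((X ^ j) ζ) = 0) → ∀ j, R ((X ^ j) ζ) = 0) :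
    ∃ c : ℝ, 0 < c ∧ ∃ δ : ℝ, 0 < δ ∧ δ ≤ 1 ∧ ∃ T : ℝ, 0 < T ∧ T ≤ 1 ∧
      ∀ t, 0 < t → t < T → ∀ ζ, ∃ a, 0 ≤ a ∧ a + δ * t ≤ t ∧ ∀ τ ∈ Set.Icc a (a + δ * t),
        c * ∑ j ∈ Finset.range r, t ^ j * ‖R ((X ^ j) ζ)‖ ≤ ‖R (flow X τ ζ)‖ := by
  obtain ⟨c, hc, δ, hδ, hδ1, hpoly⟩ := exists_interval_sum_norm_le (F := F) r
  obtain ⟨C, hC, T₀, hT₀, hflow⟩ := exists_norm_flow_sub_le X r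
  let W : Submodule ℝ E := ⨅ j ∈ Finset.range r, LinearMap.ker (R.comp (X ^ j) : E →ₗ[ℝ] F)
  have hW (ζ : E) : ζ ∈ W ↔ ∀ j < r, (R.comp (X ^ j)) ζ = 0 := by
    simp only [W, Submodule.mem_iInf, Finset.mem_range, LinearMap.mem_ker]
    exact Iff.rfl
  obtain ⟨K, hK, hpart⟩ := exists_orthogonal_part (fun j => R.comp (X ^ j)) r W hW
  set A := ‖R‖ * C * K
  have hA : 0 ≤ A := by positivity
  -- The Taylor coefficients carry `1 / j!`, bounded below by `1 / r!`; half of `c'` is later given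
  -- up to the remainder.
  set c' := c / r.factorial
  have hc' : 0 < c' := by positivity
  refine ⟨c' / 2, by positivity, δ, hδ, hδ1, min (min T₀ 1) (c' / (2 * (A + 1))),
    by positivity, (min_le_left _ _).trans (min_le_right _ _), fun t ht htT ζ => ?_⟩
  have htT₀ : t < T₀ := htT.trans_le ((min_le_left _ _).trans (min_le_left _ _))
  have ht1 : t < 1 := htT.trans_le ((min_le_left _ _).trans (min_le_right _ _))
  have htA : A * t ≤ c' / 2 := by
    have h1 : t < c' / (2 * (A + 1)) := htT.trans_le (min_le_right _ _)
    rw [lt_div_iff₀ (by positivity)] at h1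
    nlinarith
  set a : ℕ → F := fun j => R ((X ^ j) ζ)
  set N := ∑ j ∈ Finset.range r, t ^ j * ‖a j‖
  have hN : 0 ≤ N := by positivity
  obtain ⟨α₀, hα₀, hα₁, hα⟩ := hpoly fun j => (t ^ j / (j.factorial : ℝ)) • a j
  refine ⟨α₀ * t, by positivity, by nlinarith, fun τ hτ => ?_⟩
  have hτ0 : 0 ≤ τ := le_trans (by positivity) hτ.1
  have hτt : τ ≤ t := hτ.2.trans (by nlinarith)
  have hpol : c' * N ≤ ‖∑ j ∈ Finset.range r, (τ ^ j / (j.factorial : ℝ)) • a j‖ := by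
    have h1 := hα (τ / t) ⟨by rw [le_div_iff₀ ht]; exact hτ.1, by
      rw [div_le_iff₀ ht]; linarith [hτ.2]⟩
    have h2 : ∑ j ∈ Finset.range r, (τ / t) ^ j • (t ^ j / (j.factorial : ℝ)) • a j =
        ∑ j ∈ Finset.range r, (τ ^ j / (j.factorial : ℝ)) • a j := by
      refine Finset.sum_congr rfl fun j _ => ?_
      rw [smul_smul, div_pow]
      congr 1
      field_simp
    rw [h2] at h1
    refine le_trans ?_ h1
    rw [div_mul_eq_mul_div, mul_div_assoc]
    refine mul_le_mul_of_nonneg_left ?_ hc.le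
    rw [Finset.sum_div]
    refine Finset.sum_le_sum fun j hj => ?_
    rw [norm_smul, Real.norm_of_nonneg (by positivity), div_mul_eq_mul_div]
    gcongr
    exact (Finset.mem_range.1 hj).le
  obtain ⟨p, hp, -, hpn⟩ := hpart ζ
  -- The remainder is proportional to the norm of the vector. That of `ζ` is not controlled by the
  -- observations, but that of `p` is.
  have hflow_p : R (flow X τ ζ) = R (flow X τ p) := by
    rw [← sub_eq_zero, ← map_sub, ← map_sub]
    exact apply_flow_eq_zero (hker _ fun j hj => (hW _).1 hp j hj) τ
  have ha_p : ∀ j ∈ Finset.range r, a j = R ((X ^ j) p) := fun j hj => by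
    rw [← sub_eq_zero, ← map_sub, ← map_sub]
    exact (hW _).1 hp j (Finset.mem_range.1 hj)
  have hrem : ‖R (flow X τ ζ) - ∑ j ∈ Finset.range r, (τ ^ j / (j.factorial : ℝ)) • a j‖ ≤
      c' / 2 * N := by
    rw [hflow_p]
    rcases Nat.eq_zero_or_pos r with rfl | hr
    · have hp0 : p = 0 := by simpa using hpn
      simp [hp0, N]
    have h1 : R (flow X τ p) - ∑ j ∈ Finset.range r, (τ ^ j / (j.factorial : ℝ)) • a j =
        R ((flow X τ - ∑ j ∈ Finset.range r, (τ ^ j / (j.factorial : ℝ)) • X ^ j) p) := by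
      rw [sub_apply, map_sub, sum_apply, map_sum]
      congr 1
      refine Finset.sum_congr rfl fun j hj => ?_
      rw [ha_p j hj, smul_apply, map_smul]
    -- The spare factor `t` comes from `j + 1 ≤ r`, and makes the remainder small relative to `N`.
    have h2 : ∑ j ∈ Finset.range r, ‖a j‖ * t ^ r ≤ t * N := by
      rw [Finset.mul_sum]
      refine Finset.sum_le_sum fun j hj => ?_
      have h3 : t ^ r ≤ t ^ (j + 1) := pow_le_pow_of_le_one ht.le ht1.le (Finset.mem_range.1 hj)
      calc ‖a j‖ * t ^ r ≤ ‖a j‖ * t ^ (j + 1) := by gcongr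
        _ = _ := by ring
    rw [h1]
    calc _ ≤ ‖R‖ * ((C * τ ^ r) * ‖p‖) := by
          refine (R.le_opNorm _).trans ?_
          gcongr
          refine (ContinuousLinearMap.le_opNorm _ _).trans ?_
          gcongr
          exact hflow τ hτ0 (hτt.trans_lt htT₀)
      _ ≤ ‖R‖ * ((C * t ^ r) * (K * ∑ j ∈ Finset.range r, ‖a j‖)) := by
          gcongr
          exact hpn
      _ = A * ∑ j ∈ Finset.range r, ‖a j‖ * t ^ r := by rw [← Finset.sum_mul]; ring
      _ ≤ A * (t * N) := by gcongr
      _ = A * t * N := by ring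
      _ ≤ c' / 2 * N := by gcongr
  have h5 := norm_sub_norm_le (∑ j ∈ Finset.range r, (τ ^ j / (j.factorial : ℝ)) • a j)
    (R (flow X τ ζ))
  rw [norm_sub_rev] at h5
  linarith

/-- The accumulated symbol `∫₀ᵗ ‖R exp (τX) ζ‖ ^ p dτ` controls the components of `ζ`
orthogonal to the kernels of `R, R X, …, R X ^ k`, with weight `t ^ k`. -/
theorem exists_abs_inner_le (X : E →L[ℝ] E) (R : E →L[ℝ] F) (r : ℕ)
    (hker : ∀ ζ, (∀ j < r, R ((X ^ j) ζ) = 0) → ∀ j, R ((X ^ j) ζ) = 0) {p : ℝ} (hp : 0 < p) :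
    ∃ C : ℝ, 0 < C ∧ ∃ T : ℝ, 0 < T ∧ ∀ t, 0 < t → t < T → ∀ k < r, ∀ W : Submodule ℝ E,
      (∀ ζ, ζ ∈ W ↔ ∀ j ≤ k, R ((X ^ j) ζ) = 0) → ∀ ξ ∈ Wᗮ, ∀ ζ,
        t ^ k * |inner ℝ ξ ζ| ≤
          C * ‖ξ‖ * (accum X (fun η => ‖R η‖ ^ p) t ζ / t) ^ (1 / p) := by
  obtain ⟨c, hc, δ, hδ, hδ1, T, hT, hT1, hlow⟩ := exists_flow_lower_bound X R r hker
  let W (k : ℕ) : Submodule ℝ E :=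
    ⨅ j ∈ Finset.range (k + 1), LinearMap.ker (R.comp (X ^ j) : E →ₗ[ℝ] F)
  have hW (k : ℕ) (ζ : E) : ζ ∈ W k ↔ ∀ j < k + 1, (R.comp (X ^ j)) ζ = 0 := by
    simp only [W, Submodule.mem_iInf, Finset.mem_range, LinearMap.mem_ker]
    exact Iff.rfl
  choose K hK hpart using fun k =>
    exists_orthogonal_part (fun j => R.comp (X ^ j)) (k + 1) (W k) (hW k)
  have hKle : ∀ k < r, K k ≤ ∑ k ∈ Finset.range r, K k := fun k hk =>
    Finset.single_le_sum (f := K) (fun _ _ => (hK _).le) (Finset.mem_range.2 hk)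
  set K' := ∑ k ∈ Finset.range r, K k
  have hK' : 0 ≤ K' := Finset.sum_nonneg fun _ _ => (hK _).le
  -- The second factor inverts `δ * t * (c * N) ^ p ≤ I`; `K'` bounds the projection constants for
  -- all `k < r`, with `1` added for positivity.
  refine ⟨(K' + 1) * ((1 / δ) ^ (1 / p) / c), by positivity, T, hT,
    fun t ht htT k hk V hV ξ hξ ζ => ?_⟩
  obtain rfl : V = W k := by
    ext ζ
    rw [hV, hW]
    exact ⟨fun h j hj => h j (by omega), fun h j hj => h j (by omega)⟩
  set N := ∑ j ∈ Finset.range r, t ^ j * ‖R ((X ^ j) ζ)‖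
  have hN : 0 ≤ N := by positivity
  set I := accum X (fun η => ‖R η‖ ^ p) t ζ
  have hcont : Continuous fun τ => ‖R (flow X τ ζ)‖ ^ p := by
    have h1 : Continuous fun τ => flow X τ ζ :=
      (continuous_flow_apply X).comp (continuous_id.prodMk continuous_const)
    exact (R.continuous.comp h1).norm.rpow_const fun _ => Or.inr hp.le
  -- The nonnegative integrand is kept only on the subinterval of length `δ * t` where the lower
  -- bound holds.
  have hI : δ * t * (c * N) ^ p ≤ I := by
    obtain ⟨a, ha, hat, hlow⟩ := hlow t ht htT ζ
    calc δ * t * (c * N) ^ p = ∫ τ in a..(a + δ * t), (c * N) ^ p := by simp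
      _ ≤ ∫ τ in a..(a + δ * t), ‖R (flow X τ ζ)‖ ^ p := by
          refine intervalIntegral.integral_mono_on (by nlinarith) (by simp)
            (hcont.intervalIntegrable _ _) fun τ hτ => ?_
          exact Real.rpow_le_rpow (by positivity) (hlow τ hτ) hp.le
      _ ≤ I := by
          refine intervalIntegral.integral_mono_interval ha (by nlinarith) hat
            (Eventually.of_forall fun τ => by positivity) (hcont.intervalIntegrable _ _)
  have hN' : N ≤ (1 / δ) ^ (1 / p) / c * (I / t) ^ (1 / p) := by
    have h1 : (c * N) ^ p ≤ 1 / δ * (I / t) := by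
      rw [div_mul_div_comm, one_mul, le_div_iff₀ (by positivity)]
      linarith
    have h2 : c * N ≤ (1 / δ * (I / t)) ^ (1 / p) := by
      have h3 := Real.rpow_le_rpow (by positivity) h1 (z := 1 / p) (by positivity)
      rwa [← Real.rpow_mul (by positivity), mul_one_div_cancel hp.ne', Real.rpow_one] at h3
    have hI0 : 0 ≤ I := le_trans (by positivity) hI
    rw [Real.mul_rpow (by positivity) (by positivity)] at h2
    rw [div_mul_eq_mul_div, le_div_iff₀ hc]
    linarith
  obtain ⟨q, -, hq, hqn⟩ := hpart k ζ
  have hinner : t ^ k * |inner ℝ ξ ζ| ≤ ‖ξ‖ * (K' * N) := by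
    rw [hq ξ hξ]
    -- For `t ≤ 1` and `j ≤ k`, `t ^ k ≤ t ^ j`: the highest order visible to `ξ` fixes the loss in
    -- `t`.
    have h1 : t ^ k * ∑ j ∈ Finset.range (k + 1), ‖R ((X ^ j) ζ)‖ ≤ N := by
      rw [Finset.mul_sum]
      refine (Finset.sum_le_sum fun j hj => ?_).trans (Finset.sum_le_sum_of_subset_of_nonneg
        (Finset.range_subset_range.2 hk) fun j _ _ => by positivity)
      gcongr ?_ * _
      exact pow_le_pow_of_le_one ht.le (htT.le.trans hT1) (by simpa [Nat.lt_succ_iff] using hj)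
    calc t ^ k * |inner ℝ ξ q| ≤ t ^ k * (‖ξ‖ * ‖q‖) := by
          gcongr; exact abs_real_inner_le_norm ξ q
      _ ≤ t ^ k * (‖ξ‖ * (K' * ∑ j ∈ Finset.range (k + 1), ‖R ((X ^ j) ζ)‖)) := by
          gcongr
          refine hqn.trans ?_
          gcongr ?_ * _
          · exact hKle k hk
      _ = ‖ξ‖ * (K' * (t ^ k * ∑ j ∈ Finset.range (k + 1), ‖R ((X ^ j) ζ)‖)) := by ring
      _ ≤ _ := by gcongr
  have hI0 : 0 ≤ I := le_trans (by positivity) hI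
  calc t ^ k * |inner ℝ ξ ζ| ≤ ‖ξ‖ * (K' * N) := hinner
    _ ≤ ‖ξ‖ * ((K' + 1) * ((1 / δ) ^ (1 / p) / c * (I / t) ^ (1 / p))) := by
        gcongr; linarith
    _ = _ := by ring

end flow

end

section

variable {n : ℕ}

/-! ### The kernel filtration -/

theorem toEuclideanLin_mul_pow_apply (R B : Matrix (Fin n) (Fin n) ℝ) (j : ℕ) (ζ : Rn n) :
    Matrix.toEuclideanLin (R * B.transpose ^ j) ζ =
      Matrix.toEuclideanCLM (𝕜 := ℝ) R ((drift B ^ j) ζ) := by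
  have h1 : Matrix.toEuclideanCLM (𝕜 := ℝ) (R * B.transpose ^ j) =
      Matrix.toEuclideanCLM (𝕜 := ℝ) R * drift B ^ j := by
    rw [map_mul, map_pow]; rfl
  exact DFunLike.congr_fun h1 ζ

/-- The operator `√Q`. -/
def sqrtOp (Q : Matrix (Fin n) (Fin n) ℝ) : Rn n →L[ℝ] Rn n :=
  Matrix.toEuclideanCLM (𝕜 := ℝ) (CFC.sqrt Q)

theorem mem_V {Q B : Matrix (Fin n) (Fin n) ℝ} {k : ℕ} {ζ : Rn n} :
    ζ ∈ V Q B k ↔ ∀ j ≤ k, sqrtOp Q ((drift B ^ j) ζ) = 0 := by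
  simp only [V, Submodule.mem_iInf, LinearMap.mem_ker, Set.mem_Iic, toEuclideanLin_mul_pow_apply]
  exact Iff.rfl

theorem mem_S {Q B : Matrix (Fin n) (Fin n) ℝ} {ζ : Rn n} :
    ζ ∈ S Q B ↔ ∀ j < n, sqrtOp Q ((drift B ^ j) ζ) = 0 := by
  simp only [S, Submodule.mem_iInf, LinearMap.mem_ker, Set.mem_Iio, toEuclideanLin_mul_pow_apply]
  exact Iff.rfl

/-- Cayley-Hamilton: every power of `Bᵀ` is a combination of those of exponent less than `n`. -/
theorem sqrtOp_drift_pow_eq_zero {Q B : Matrix (Fin n) (Fin n) ℝ} {ζ : Rn n} (h : ζ ∈ S Q B)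
    (j : ℕ) : sqrtOp Q ((drift B ^ j) ζ) = 0 := by
  rcases Nat.eq_zero_or_pos n with rfl | hn
  · exact Subsingleton.elim _ _
  have : Nonempty (Fin n) := ⟨⟨0, hn⟩⟩
  have hdeg : ((Polynomial.X ^ j : Polynomial ℝ) %ₘ B.transpose.charpoly).natDegree < n := by
    have h1 := Polynomial.natDegree_modByMonic_lt (Polynomial.X ^ j : Polynomial ℝ)
      B.transpose.charpoly_monic (fun h => by
        have := B.transpose.charpoly_natDegree_eq_dim
        rw [h, Polynomial.natDegree_one, Fintype.card_fin] at this
        omega)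
    rwa [B.transpose.charpoly_natDegree_eq_dim, Fintype.card_fin] at h1
  have h2 := B.transpose.pow_eq_aeval_mod_charpoly j
  rw [Polynomial.aeval_eq_sum_range' hdeg] at h2
  have h3 := toEuclideanLin_mul_pow_apply (CFC.sqrt Q) B j ζ
  rw [h2, Finset.mul_sum, map_sum, LinearMap.sum_apply] at h3
  refine h3.symm.trans (Finset.sum_eq_zero fun i hi => ?_)
  rw [Matrix.mul_smul, map_smul, LinearMap.smul_apply, toEuclideanLin_mul_pow_apply]
  have h4 := mem_S.1 h i (Finset.mem_range.1 hi)
  rw [sqrtOp] at h4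
  rw [h4, smul_zero]

theorem S_eq_V_rIndex (hn : 1 ≤ n) (Q B : Matrix (Fin n) (Fin n) ℝ) :
    S Q B = V Q B (rIndex Q B) := by
  have h : {r : ℕ | r ≤ n - 1 ∧ S Q B = V Q B r}.Nonempty := by
    refine ⟨n - 1, le_rfl, ?_⟩
    ext ζ
    rw [mem_S, mem_V]
    exact ⟨fun h j hj => h j (by omega), fun h j hj => h j (by omega)⟩
  exact (Nat.sInf_mem h).2

/-- For `ξ ∈ Sᗮ` the set defining `index` contains `rIndex`, so the infimum is attained and is not
the default value `0` of an empty set. -/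
theorem index_le_and_mem (hn : 1 ≤ n) {Q B : Matrix (Fin n) (Fin n) ℝ} {ξ : Rn n}
    (hξ : ξ ∈ (S Q B)ᗮ) : index Q B ξ ≤ rIndex Q B ∧ ξ ∈ (V Q B (index Q B ξ))ᗮ := by
  have h : {k : ℕ | k ≤ rIndex Q B ∧ ξ ∈ (V Q B k)ᗮ}.Nonempty :=
    ⟨rIndex Q B, le_rfl, by rwa [← S_eq_V_rIndex hn]⟩
  exact Nat.sInf_mem h

theorem symbol_eq_norm_rpow (s : ℝ) {Q : Matrix (Fin n) (Fin n) ℝ} (hQ : Q.PosSemidef)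
    (ξ : Rn n) : symbol s Q ξ = ‖sqrtOp Q ξ‖ ^ (2 * s) := by
  have h1 : CFC.sqrt Q * CFC.sqrt Q = Q := CFC.sqrt_mul_sqrt_self Q hQ.nonneg
  have h2 : (CFC.sqrt Q).IsHermitian := (CFC.sqrt_nonneg Q).isSelfAdjoint
  have h3 : IsSelfAdjoint (sqrtOp Q) := by
    rw [sqrtOp, IsSelfAdjoint, ← map_star]
    exact congrArg _ h2
  have h4 : Matrix.toEuclideanLin Q ξ = sqrtOp Q (sqrtOp Q ξ) := by
    have : Matrix.toEuclideanCLM (𝕜 := ℝ) Q = sqrtOp Q * sqrtOp Q := by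
      rw [sqrtOp, ← map_mul, h1]
    exact DFunLike.congr_fun this ξ
  have h5 : inner ℝ (sqrtOp Q (sqrtOp Q ξ)) ξ = inner ℝ (sqrtOp Q ξ) (sqrtOp Q ξ) :=
    h3.isSymmetric (sqrtOp Q ξ) ξ
  rw [symbol, h4, h5, real_inner_self_eq_norm_sq, Real.rpow_mul (norm_nonneg _),
    ← Real.rpow_natCast]
  norm_num

theorem accum_scaledSymbol (s : ℝ) {Q : Matrix (Fin n) (Fin n) ℝ} (hQ : Q.PosSemidef)
    (B : Matrix (Fin n) (Fin n) ℝ) (t : ℝ) (η : Rn n) :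
    accum (drift B) (scaledSymbol s Q) t η =
      accum (drift B) (fun η => ‖sqrtOp Q η‖ ^ (2 * s)) t ((2 * Real.pi) • η) := by
  refine intervalIntegral.integral_congr fun τ _ => ?_
  simp only [scaledSymbol]
  rw [symbol_eq_norm_rpow s hQ, (flow (drift B) τ).map_smul]

theorem exists_abs_inner_le_accum (hn : 1 ≤ n) {s : ℝ} (hs : 0 < s)
    {Q : Matrix (Fin n) (Fin n) ℝ} (hQ : Q.PosSemidef) (B : Matrix (Fin n) (Fin n) ℝ) :
    ∃ C : ℝ, 0 < C ∧ ∃ T : ℝ, 0 < T ∧ ∀ t, 0 < t → t < T → ∀ ξ ∈ (S Q B)ᗮ, ∀ η : Rn n,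
      t ^ index Q B ξ * (2 * Real.pi * |inner ℝ η ξ|) ≤
        C * ‖ξ‖ * (accum (drift B) (scaledSymbol s Q) t η / t) ^ (1 / (2 * s)) := by
  -- `V r` tests the exponents `j ≤ r`, hence `r + 1` observations. Vanishing of these puts `ζ` in
  -- `S`, where all observations vanish.
  obtain ⟨C, hC, T, hT, h⟩ := exists_abs_inner_le (drift B) (sqrtOp Q) (rIndex Q B + 1)
    (fun ζ hζ => sqrtOp_drift_pow_eq_zero (by
      rw [S_eq_V_rIndex hn, mem_V]
      exact fun j hj => hζ j (by omega))) (p := 2 * s) (by positivity)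
  refine ⟨C, hC, T, hT, fun t ht htT ξ hξ η => ?_⟩
  obtain ⟨h1, h2⟩ := index_le_and_mem hn hξ
  have h3 := h t ht htT _ (Nat.lt_succ_of_le h1) _ (fun ζ => mem_V) ξ h2 ((2 * Real.pi) • η)
  rwa [← accum_scaledSymbol s hQ, inner_smul_right, abs_mul, abs_of_nonneg (by positivity),
    real_inner_comm] at h3

theorem tr_drift (B : Matrix (Fin n) (Fin n) ℝ) : tr (drift B) = B.trace := by
  have h : (drift B).toLinearMap = Matrix.toLin (EuclideanSpace.basisFun (Fin n) ℝ).toBasis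
      (EuclideanSpace.basisFun (Fin n) ℝ).toBasis B.transpose := by
    rw [← Matrix.toEuclideanLin_eq_toLin_orthonormal]; rfl
  rw [tr, h, Matrix.trace_toLin_eq, Matrix.trace_transpose]

/-! ### The multiplier bound -/

theorem pow_mul_exp_neg_le {x a : ℝ} (hx : 0 ≤ x) (ha : 0 < a) (m : ℕ) :
    x ^ m * Real.exp (-(a * x)) ≤ m.factorial / a ^ m := by
  have h := Real.pow_div_factorial_le_exp (a * x) (by positivity) m
  rw [div_le_iff₀ (by positivity), mul_pow] at h
  rw [Real.exp_neg, le_div_iff₀ (by positivity), ← div_eq_mul_inv, div_mul_eq_mul_div,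
    div_le_iff₀ (Real.exp_pos _)]
  linarith

/-- The inequality `I ^ m * exp (-s I) ≤ m! / s ^ m` raised to the power `1 / (2s)`; the rate `s` is
chosen so that the exponential becomes `exp (-I / 2)`. -/
theorem rpow_mul_exp_neg_half_le {I s : ℝ} (hI : 0 ≤ I) (hs : 0 < s) (m : ℕ) :
    (I ^ (1 / (2 * s))) ^ m * Real.exp (-(1 / 2 * I)) ≤
      ((1 / s) ^ (1 / (2 * s))) ^ m * (m.factorial : ℝ) ^ (1 / (2 * s)) := by
  have h := Real.rpow_le_rpow (by positivity) (pow_mul_exp_neg_le hI hs m)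
    (z := 1 / (2 * s)) (by positivity)
  rw [Real.mul_rpow (by positivity) (by positivity), ← Real.exp_mul] at h
  have h1 : -(s * I) * (1 / (2 * s)) = -(1 / 2 * I) := by field_simp
  have h2 : (m.factorial : ℝ) / s ^ m = (1 / s) ^ m * m.factorial := by
    rw [one_div, inv_pow]; field_simp
  rw [h1, h2, Real.mul_rpow (by positivity) (by positivity)] at h
  have h3 (x : ℝ) (hx : 0 ≤ x) : (x ^ m) ^ (1 / (2 * s)) = (x ^ (1 / (2 * s))) ^ m := by
    rw [← Real.rpow_natCast, ← Real.rpow_natCast, ← Real.rpow_mul hx, ← Real.rpow_mul hx, mul_comm]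
  rwa [h3 I hI, h3 (1 / s) (by positivity)] at h

end

section

/-! ### Directional derivatives on the Fourier side -/

section derivatives

variable {E : Type*} [NormedAddCommGroup E] [InnerProductSpace ℝ E] [FiniteDimensional ℝ E]
  [MeasurableSpace E] [BorelSpace E]

theorem fourierInv_eq_lineDerivOp {f h : LTwo E} {ξ : E}
    (hf : f =ᵐ[volume] fun η => (2 * Real.pi * Complex.I * (inner ℝ η ξ : ℝ) : ℂ) * h η) :
    ((𝓕⁻ f : LTwo E) : 𝓢'(E, ℂ)) = ∂_{ξ} ((𝓕⁻ h : LTwo E) : 𝓢'(E, ℂ)) := by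
  have hξ : (inner ℝ · ξ : E → ℝ).HasTemperateGrowth := by fun_prop
  have h1 : (f : 𝓢'(E, ℂ)) = (2 * Real.pi * Complex.I : ℂ) •
      TemperedDistribution.smulLeftCLM ℂ (fun x => ((inner ℝ x ξ : ℝ) : ℂ)) (h : 𝓢'(E, ℂ)) := by
    ext φ
    change (f : 𝓢'(E, ℂ)) φ = (2 * Real.pi * Complex.I : ℂ) •
      (h : 𝓢'(E, ℂ)) (SchwartzMap.smulLeftCLM ℂ (fun x => ((inner ℝ x ξ : ℝ) : ℂ)) φ)
    have h2 : SchwartzMap.smulLeftCLM ℂ (fun x => ((inner ℝ x ξ : ℝ) : ℂ)) φ =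
        SchwartzMap.smulLeftCLM ℂ (inner ℝ · ξ) φ := SchwartzMap.smulLeftCLM_ofReal ℂ hξ φ
    rw [h2, Lp.toTemperedDistribution_apply,
      Lp.toTemperedDistribution_apply, smul_eq_mul,
      ← integral_const_mul]
    refine integral_congr_ae ?_
    filter_upwards [hf] with η hη
    rw [hη, SchwartzMap.smulLeftCLM_apply_apply hξ, Complex.real_smul, smul_eq_mul, smul_eq_mul]
    ring
  rw [← Lp.fourierInv_toTemperedDistribution_eq, ← Lp.fourierInv_toTemperedDistribution_eq,
    TemperedDistribution.lineDerivOp_fourierInv_eq, h1]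

/-- Induction on the number of derivatives. The hypothesis `hD` supplies the partial products as
`L²` functions, so that each step differentiates an element of `L²`. -/
theorem fourierInv_eq_iteratedLineDerivOp {w : LTwo E} {D : Set E}
    (hD : ∀ (m : ℕ) (ξ : Fin m → E), (∀ j, ξ j ∈ D) → ∃ f : LTwo E, f =ᵐ[volume]
      fun η => (∏ j, (2 * Real.pi * Complex.I * (inner ℝ η (ξ j) : ℝ) : ℂ)) * w η)
    {m : ℕ} (ξ : Fin m → E) (hξ : ∀ j, ξ j ∈ D) (f : LTwo E) (hf : f =ᵐ[volume]
      fun η => (∏ j, (2 * Real.pi * Complex.I * (inner ℝ η (ξ j) : ℝ) : ℂ)) * w η) :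
    ((𝓕⁻ f : LTwo E) : 𝓢'(E, ℂ)) = ∂^{ξ} ((𝓕⁻ w : LTwo E) : 𝓢'(E, ℂ)) := by
  induction m generalizing f with
  | zero =>
    have : f = w := Lp.ext (hf.trans (Eventually.of_forall fun η => by simp))
    rw [this, iteratedLineDerivOp_fin_zero]
  | succ m ih =>
    obtain ⟨h, hh⟩ := hD m (Fin.tail ξ) fun j => hξ _
    rw [iteratedLineDerivOp_succ_left, ← ih (Fin.tail ξ) (fun j => hξ _) h hh]
    refine fourierInv_eq_lineDerivOp ?_
    filter_upwards [hf, hh] with η h1 h2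
    rw [h1, h2, Fin.prod_univ_succ, mul_assoc]
    rfl

end derivatives

variable {n : ℕ}

theorem mul_inv_mul_rpow_eq {t : ℝ} (ht : 0 < t) (K m : ℕ) (I : ℝ) (hI : 0 ≤ I) (e : ℝ) :
    (t ^ K)⁻¹ * ((I / t) ^ e) ^ m = (I ^ e) ^ m / t ^ ((K : ℝ) + m * e) := by
  rw [Real.div_rpow hI ht.le, div_pow, ← Real.rpow_natCast (t ^ e), ← Real.rpow_mul ht.le,
    Real.rpow_add ht, Real.rpow_natCast, mul_comm e]
  field_simp

/-- All `m` factors are estimated against the same exponential at once, without splitting the time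
interval, so the factorial enters only to the power `1 / (2s)`. -/
theorem prod_abs_inner_mul_exp_le {C s t I : ℝ} {m : ℕ} (hC : 0 < C) (hs : 0 < s) (ht : 0 < t)
    (hI : 0 ≤ I) (x y : Fin m → ℝ) (k : Fin m → ℕ) (hx : ∀ j, 0 ≤ x j) (hy : ∀ j, 0 ≤ y j)
    (h : ∀ j, t ^ k j * x j ≤ C * y j * (I / t) ^ (1 / (2 * s))) :
    (∏ j, x j) * Real.exp (-(1 / 2 * I)) ≤
      (C * (1 / s) ^ (1 / (2 * s))) ^ m / t ^ (((∑ j, k j : ℕ) : ℝ) + (m : ℝ) / (2 * s)) *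
        (∏ j, y j) * (m.factorial : ℝ) ^ (1 / (2 * s)) := by
  have h1 : t ^ (∑ j, k j) * ∏ j, x j ≤ C ^ m * (∏ j, y j) * ((I / t) ^ (1 / (2 * s))) ^ m := by
    rw [← Finset.prod_pow_eq_pow_sum, ← Finset.prod_mul_distrib]
    refine (Finset.prod_le_prod (fun j _ => by have := hx j; positivity) fun j _ => h j).trans_eq ?_
    rw [Finset.prod_mul_distrib, Finset.prod_mul_distrib]
    simp
  have hy' : 0 ≤ ∏ j, y j := Finset.prod_nonneg fun j _ => hy j
  have h2 : ∏ j, x j ≤ C ^ m * (∏ j, y j) * ((I ^ (1 / (2 * s))) ^ m /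
      t ^ (((∑ j, k j : ℕ) : ℝ) + (m : ℝ) / (2 * s))) := by
    have h3 := mul_inv_mul_rpow_eq ht (∑ j, k j) m I hI (1 / (2 * s))
    rw [mul_one_div] at h3
    rw [← h3]
    have h4 : ∏ j, x j = (t ^ (∑ j, k j))⁻¹ * (t ^ (∑ j, k j) * ∏ j, x j) := by
      field_simp
    rw [h4]
    refine (mul_le_mul_of_nonneg_left h1 (by positivity)).trans_eq ?_
    ring
  have h5 := rpow_mul_exp_neg_half_le hI hs m
  set P := t ^ (((∑ j, k j : ℕ) : ℝ) + (m : ℝ) / (2 * s))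
  have hP : 0 < P := by positivity
  calc (∏ j, x j) * Real.exp (-(1 / 2 * I))
      ≤ C ^ m * (∏ j, y j) * ((I ^ (1 / (2 * s))) ^ m / P) * Real.exp (-(1 / 2 * I)) := by gcongr
    _ = C ^ m * (∏ j, y j) / P * ((I ^ (1 / (2 * s))) ^ m * Real.exp (-(1 / 2 * I))) := by ring
    _ ≤ C ^ m * (∏ j, y j) / P *
        (((1 / s) ^ (1 / (2 * s))) ^ m * (m.factorial : ℝ) ^ (1 / (2 * s))) := by gcongr
    _ = _ := by rw [mul_pow]; ring

/-! ### Smoothing of the evolution -/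

section evolve

variable {E : Type*} [NormedAddCommGroup E] [InnerProductSpace ℝ E] [FiniteDimensional ℝ E]
  [MeasurableSpace E] [BorelSpace E] {X : E →L[ℝ] E} {σ : E → ℝ}

/-- The product is absorbed into the weight, giving another weighted composition operator; the
unimodular `I ^ m` is split off to leave a real weight. -/
theorem exists_prod_mul_evolve (hσ : Continuous σ) (hσ0 : ∀ η, 0 ≤ σ η) {t : ℝ≥0} {m : ℕ}
    (ξ : Fin m → E) {A : ℝ} (hA : ∀ η, (∏ j, (2 * Real.pi * |inner ℝ η (ξ j)|)) *
      Real.exp (-(1 / 2 * accum X σ t η)) ≤ A) (f : LTwo E) :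
    ∃ g : LTwo E, (g =ᵐ[volume] fun η =>
      (∏ j, (2 * Real.pi * Complex.I * (inner ℝ η (ξ j) : ℝ) : ℂ)) * evolve X hσ hσ0 t f η) ∧
      ‖g‖ ≤ Real.exp (tr X / 2 * t) * A * ‖f‖ := by
  set μ : E → ℝ := fun η => (∏ j, (2 * Real.pi * inner ℝ η (ξ j))) * weight X σ t η
  have hμ : Continuous μ := by
    have := continuous_weight (X := X) hσ t
    fun_prop
  have hμA (η : E) : |μ η| ≤ Real.exp (t * tr X) * A := by
    have h1 : |μ η| = Real.exp (t * tr X) * ((∏ j, (2 * Real.pi * |inner ℝ η (ξ j)|)) *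
        Real.exp (-(1 / 2 * accum X σ t η))) := by
      simp only [μ, weight, abs_mul, Finset.abs_prod, Real.abs_exp, abs_of_pos Real.pi_pos, abs_two]
      rw [neg_mul]
      ring
    rw [h1]
    exact mul_le_mul_of_nonneg_left (hA η) (Real.exp_pos _).le
  refine ⟨(Complex.I ^ m) • weightedComp (flow X t) (det_flow_ne_zero _) μ hμ _ hμA f, ?_, ?_⟩
  · filter_upwards [Lp.coeFn_smul (Complex.I ^ m)
      (weightedComp (flow X t) (det_flow_ne_zero _) μ hμ _ hμA f),
      coeFn_weightedComp (hA := det_flow_ne_zero (X := X) t) (hm := hμ) (hC := hμA) f,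
      coeFn_evolve (X := X) hσ hσ0 t f] with η h1 h2 h3
    rw [h1, Pi.smul_apply, h2, h3, smul_eq_mul]
    simp only [μ]
    push_cast
    have h4 : ∏ j, (2 * Real.pi * Complex.I * (inner ℝ η (ξ j) : ℝ) : ℂ) =
        Complex.I ^ m * ∏ j, (2 * Real.pi * (inner ℝ η (ξ j) : ℝ) : ℂ) := by
      rw [← Fin.prod_const, ← Finset.prod_mul_distrib]
      exact Finset.prod_congr rfl fun j _ => by ring
    rw [h4]
    ring
  · rw [norm_smul, norm_pow, Complex.norm_I, one_pow, one_mul]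
    refine (norm_weightedComp_le f).trans_eq ?_
    rw [det_flow, Real.abs_exp, ← Real.exp_mul]
    have h5 : Real.exp (tr X / 2 * t) =
        Real.exp (t * tr X) * Real.exp (t * tr X * (-(1 / 2))) := by
      rw [← Real.exp_add]; congr 1; ring
    rw [h5]
    ring

end evolve

theorem exists_iteratedLineDerivOp_ouSemigroup (hn : 1 ≤ n) {s : ℝ} (hs : 0 < s)
    {Q : Matrix (Fin n) (Fin n) ℝ} (hQ : Q.PosSemidef) (B : Matrix (Fin n) (Fin n) ℝ) :
    ∃ c : ℝ, 1 < c ∧ ∃ T : ℝ, 0 < T ∧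
      ∀ (m : ℕ) (ξ : Fin m → Rn n), (∀ j, ξ j ∈ (S Q B)ᗮ) →
        ∀ t : ℝ≥0, 0 < t → (t : ℝ) < T → ∀ u : L2 n,
          ∃ v : L2 n, (v : 𝓢'(Rn n, ℂ)) = ∂^{ξ} ((ouSemigroup hs hQ B t u : L2 n) : 𝓢'(Rn n, ℂ)) ∧
            ‖v‖ ≤ c ^ m * Real.exp (1 / 2 * B.trace * (t : ℝ)) /
                (t : ℝ) ^ (((∑ j, index Q B (ξ j) : ℕ) : ℝ) + (m : ℝ) / (2 * s)) *
              (∏ j, ‖ξ j‖) * (m.factorial : ℝ) ^ (1 / (2 * s)) * ‖u‖ := by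
  obtain ⟨C, hC, T, hT, h⟩ := exists_abs_inner_le_accum hn hs hQ B
  have hc : 0 < C * (1 / s) ^ (1 / (2 * s)) := by positivity
  -- The summand `2` only serves to make the constant exceed `1`.
  refine ⟨C * (1 / s) ^ (1 / (2 * s)) + 2, by linarith, T, hT, fun m ξ hξ t ht htT u => ?_⟩
  have ht' : (0 : ℝ) < t := ht
  have key (m : ℕ) (ξ : Fin m → Rn n) (hξ : ∀ j, ξ j ∈ (S Q B)ᗮ) :=
    exists_prod_mul_evolve (X := drift B) (continuous_scaledSymbol hs) (scaledSymbol_nonneg hQ)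
      (t := t) ξ (fun η => prod_abs_inner_mul_exp_le hC hs ht'
        (accum_nonneg (X := drift B) (scaledSymbol_nonneg (s := s) hQ) t.2 η)
        (fun j => 2 * Real.pi * |inner ℝ η (ξ j)|) (fun j => ‖ξ j‖) (fun j => index Q B (ξ j))
        (fun j => by positivity) (fun j => norm_nonneg _) fun j => h t ht' htT _ (hξ j) η)
      (𝓕 u : L2 n)
  obtain ⟨g, hg, hgn⟩ := key m ξ hξ
  refine ⟨𝓕⁻ g, ?_, ?_⟩
  · rw [ouSemigroup_apply]
    exact fourierInv_eq_iteratedLineDerivOp (D := {ξ | ξ ∈ (S Q B)ᗮ})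
      (fun m ξ hξ => (key m ξ hξ).imp fun g hg => hg.1) ξ hξ g hg
  · rw [← Lp.norm_fourier_eq, fourier_fourierInv_eq]
    rw [Lp.norm_fourier_eq, tr_drift] at hgn
    refine hgn.trans ?_
    have h1 : Real.exp (B.trace / 2 * t) = Real.exp (1 / 2 * B.trace * t) := by
      congr 1; ring
    rw [h1]
    have h2 : (C * (1 / s) ^ (1 / (2 * s))) ^ m ≤ (C * (1 / s) ^ (1 / (2 * s)) + 2) ^ m := by
      gcongr; linarith
    have hP : 0 ≤ ∏ j, ‖ξ j‖ := by positivity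
    have hd : 0 < (t : ℝ) ^ (((∑ j, index Q B (ξ j) : ℕ) : ℝ) + (m : ℝ) / (2 * s)) := by positivity
    calc _ = (C * (1 / s) ^ (1 / (2 * s))) ^ m * (Real.exp (1 / 2 * B.trace * t) /
          (t : ℝ) ^ (((∑ j, index Q B (ξ j) : ℕ) : ℝ) + (m : ℝ) / (2 * s)) *
            (∏ j, ‖ξ j‖) * (m.factorial : ℝ) ^ (1 / (2 * s)) * ‖u‖) := by ring
      _ ≤ (C * (1 / s) ^ (1 / (2 * s)) + 2) ^ m * (Real.exp (1 / 2 * B.trace * t) /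
          (t : ℝ) ^ (((∑ j, index Q B (ξ j) : ℕ) : ℝ) + (m : ℝ) / (2 * s)) *
            (∏ j, ‖ξ j‖) * (m.factorial : ℝ) ^ (1 / (2 * s)) * ‖u‖) := by gcongr
      _ = _ := by ring

end

end FracOU

end

/-! ### Conclusion -/

theorem mainTheorem2 {n : ℕ} (hn : 1 ≤ n) (s : ℝ) (hs : 0 < s)
    (Q B : Matrix (Fin n) (Fin n) ℝ) (hQ : Q.PosSemidef) :
    ∃ E : ℝ≥0 → FracOU.L2 n →L[ℂ] FracOU.L2 n,
      FracOU.IsOUSemigroup s Q B E ∧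
      (∀ E' : ℝ≥0 → FracOU.L2 n →L[ℂ] FracOU.L2 n, FracOU.IsOUSemigroup s Q B E' → E' = E) ∧
      ∃ c : ℝ, 1 < c ∧ ∃ T : ℝ, 0 < T ∧
        ∀ m : ℕ, 1 ≤ m → ∀ ξ : Fin m → FracOU.Rn n, (∀ j, ξ j ∈ (FracOU.S Q B)ᗮ) →
          ∀ t : ℝ≥0, 0 < t → (t : ℝ) < T → ∀ u : FracOU.L2 n,
            ∃ v : FracOU.L2 n,
              (v : 𝓢'(FracOU.Rn n, ℂ)) = ∂^{ξ} ((E t u : FracOU.L2 n) : 𝓢'(FracOU.Rn n, ℂ)) ∧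
              ‖v‖ ≤ c ^ m * Real.exp (1 / 2 * B.trace * (t : ℝ)) /
                  (t : ℝ) ^ (((∑ j, FracOU.index Q B (ξ j) : ℕ) : ℝ) + (m : ℝ) / (2 * s)) *
                (∏ j, ‖ξ j‖) * (m.factorial : ℝ) ^ (1 / (2 * s)) * ‖u‖ := by
  obtain ⟨c, hc, T, hT, h⟩ := FracOU.exists_iteratedLineDerivOp_ouSemigroup hn hs hQ B
  exact ⟨FracOU.ouSemigroup hs hQ B, FracOU.isOUSemigroup_ouSemigroup hs hQ B,
    fun _ hE' => FracOU.eq_ouSemigroup hs hQ B hE', c, hc, T, hT, fun m _ => h m⟩
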